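/- **Setting.** A *computable metric space* $\mathbb X=(X,d,(x_i)_{i\in\mathbb N})$ is a complete metric space with a dense sequence of *basic points* $x_i$ such that $(i,j)\mapsto d(x_i,x_j)$ is computable. Given a metric $d$ and basic points $(x_i)$ on a set $S$, a *Cauchy name* for $y\in S$ is an $h\in\mathbb N^{\mathbb N}$ with $d(x_{h(j)},x_{h(i)})\le 2^{-i}$ for all $j\ge i$ and $x_{h(i)}\to y$. A *basic open ball* is a ball with basic center and positive rational radius. A set is *effectively open* ($\Sigma^0_1$) if it is the union of a computable set of (indices of) basic open balls, and *effectively closed* if its complement is effectively open. A function $f\colon D\to T$, with $D\subseteq S$, is *computable* if there is a partial computable $F\colon\subseteq\mathbb N^{\mathbb N}\to\mathbb N^{\mathbb N}$ that sends every Cauchy name for every $y\in D$ to a Cauchy name for $f(y)$. A function $f\colon S\to(-\infty,\infty]$ is *lower semicomputable* if $f=\sup_n g(n,\cdot)$ for a computable $g\colon\mathbb N\times S\to\mathbb R$. The spaces $\mathbb N$, $\mathbb R$, $\mathbb N^{\mathbb N}$ and finite products carry their standard metrics and basic points. Let $\mathcal M(\mathbb X)$ be the space of finite Borel measures on $\mathbb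 X$. Its metric is $$d(\mu,\nu)=\sum_{i}2^{-i}\Bigl(1-\exp\Bigl(-\Bigl|\int f_i\,d\mu-\int f_i\,d\nu\Bigr|\Bigr)\Bigr),$$ where $(f_i)_{i\in\mathbb N}$ is a standard effective enumeration of the basic functions, that is, of the closure under $\max$, $\min$ and rational linear combinations of the constant $1$ and the bump functions $f_{x,r,s}$ ($x$ a basic point, $0<r<s$ rational), where $f_{x,r,s}(y)$ is $1$ if $d(x,y)\le r$, is $0$ if $d(x,y)>s$, and is $\frac{s-d(x,y)}{s-r}$ otherwise. Its basic points are the finite sums $\sum_j q_j\delta_{y_j}$ with $q_j$ positive rationals and $y_j$ basic points. A *uniform Schnorr integral test* (with oracles from $\mathbb N^{\mathbb N}$) is a lower semicomputable function $t\colon\mathbb N^{\mathbb N}\times\mathcal M(\mathbb X)\times\mathbb X\to[0,\infty]$, written $t^h_\mu(x)$, such that $\int t^h_\mu\,d\mu<\infty$ for all $h\in\mathbb N^{\mathbb N}$ and $\mu\in\mathcal M(\mathbb X)$, and such that $(h,\mu)\mapsto\int t_\mu^h\,d\mu$ is a computable map $\mathbb N^{\mathbb N}\times\mathcal M(\mathbb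 X)\to\mathbb R$. For $h\in\mathbb N^{\mathbb N}$ and $\mu\in\mathcal M(\mathbb X)$, the set $\mathsf{SR}^h_\mu$ of points *uniformly Schnorr $\mu$-random relative to $h$* is the set of $x\in\mathbb X$ with $t^h_\mu(x)<\infty$ for every uniform Schnorr integral test $t$. A *uniform Schnorr sequential test* restricted to an effectively closed $K\subseteq\mathbb N^{\mathbb N}\times\mathcal M(\mathbb X)$ is a family $\{U^{n;h}_\mu\}_{n\in\mathbb N,(h,\mu)\in K}$ of open subsets of $\mathbb X$ such that, for some effectively open $W\subseteq\mathbb N\times\mathbb N^{\mathbb N}\times\mathcal M(\mathbb X)\times\mathbb X$, one has $U^{n;h}_\mu=\{x:(n,h,\mu,x)\in W\}$ for all $n\in\mathbb N$ and $(h,\mu)\in K$; such that $\mu(U^{n;h}_\mu)\le2^{-n}$ for all $n\in\mathbb N$ and $(h,\mu)\in K$; and such that $(n,h,\mu)\mapsto\mu(U^{n;h}_\mu)$ is a computable map $\mathbb N\times K\to\mathbb R$. **Theorem.** Let $\mathbb X$ be a computable metric space. The set $$K=\{(h,\mu)\in\mathbb N^{\mathbb N}\times\mathcal M(\mathbb X):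 h\text{ is a Cauchy name for }\mu\}$$ is effectively closed, and for all $(h_0,\mu_0)\in K$ and $x_0\in\mathbb X$ the following are equivalent: 1. $x_0\in\mathsf{SR}^{h_0}_{\mu_0}$. 2. $x_0\notin\bigcap_{n\in\mathbb N}U^{n;h_0}_{\mu_0}$ for every uniform Schnorr sequential test $\{U^{n;h}_\mu\}_{n\in\mathbb N,(h,\mu)\in K}$ restricted to $K$. -/

import Mathlib

open MeasureTheory Filter Topology
open scoped ENNReal NNReal

namespace SchnorrRandomness

noncomputable section

/-! ## Codings of rational numbers -/

/-- The `n`-th rational number, in an enumeration (with repetitions) of `ℚ`: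
the code `⟨⟨a, b⟩, c⟩` stands for `(a - b) / (c + 1)`. -/
def ratCode (n : ℕ) : ℚ :=
  ((n.unpair.1.unpair.1 : ℚ) - (n.unpair.1.unpair.2 : ℚ)) / ((n.unpair.2 : ℚ) + 1)

/-- The `n`-th positive rational number, in an enumeration (with repetitions) of `ℚ⁺`:
the code `⟨a, b⟩` stands for `(a + 1) / (b + 1)`. -/
def posRatCode (n : ℕ) : ℚ≥0 :=
  ((n.unpair.1 : ℚ≥0) + 1) / ((n.unpair.2 : ℚ≥0) + 1)

/-! ## Partial computable maps on Baire space -/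

/-- The first `k` values `[h 0, …, h (k - 1)]` of `h`. -/
def initSeg (h : ℕ → ℕ) (k : ℕ) : List ℕ := (List.range k).map h

/-- `φ` (on finite initial segments) presents a partial map `F` from `ℕ^ℕ` to `ℕ^ℕ`: the machine
computing `F(h)(n)` reads longer and longer initial segments of the oracle `h` until `φ` returns
a value. `FunctionalSends φ h g` says that `h ∈ dom F` and `F(h) = g`. The partial computable
maps on Baire space are those with `φ` computable. -/
def FunctionalSends (φ : List ℕ → ℕ → Option ℕ) (h g : ℕ → ℕ) : Prop :=
  ∀ n, ∃ k, φ (initSeg h k) n = some (g n) ∧ ∀ j < k, φ (initSeg h j) n = none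

/-! ## Metrics with basic points, and computability relative to them -/

/-- The data from which names are formed: a distance function and a sequence of basic points.
It is used below only for a computable metric space `𝕏`, for `ℕ`, `ℝ`, `ℕ^ℕ`, the space of finite
measures on `𝕏`, and their products. -/
structure MetricData (S : Type*) where
  /-- the distance -/
  dist : S → S → ℝ
  /-- the basic points -/
  pt : ℕ → S

section General

variable {S T : Type*}

/-- `h` is a Cauchy name for `y`. -/
def IsCauchyName (P : MetricData S) (h : ℕ → ℕ) (y : S) : Prop :=
  (∀ i j, i ≤ j → P.dist (P.pt (h j)) (P.pt (h i)) ≤ (2 : ℝ)⁻¹ ^ i) ∧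
    Tendsto (fun i => P.dist (P.pt (h i)) y) atTop (𝓝 0)

/-- The `n`-th basic open ball: basic center and positive rational radius. -/
def basicBall (P : MetricData S) (n : ℕ) : Set S :=
  {y | P.dist (P.pt n.unpair.1) y < (posRatCode n.unpair.2 : ℝ)}

/-- Effectively open (`Σ⁰₁`) sets: unions of computable sets of basic open balls. -/
def IsEffectivelyOpen (P : MetricData S) (U : Set S) : Prop :=
  ∃ I : Set ℕ, ComputablePred (fun n => n ∈ I) ∧ U = ⋃ n ∈ I, basicBall P n

/-- Effectively closed (`Π⁰₁`) sets. -/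
def IsEffectivelyClosed (P : MetricData S) (C : Set S) : Prop :=
  IsEffectivelyOpen P Cᶜ

/-- The product, with the maximum metric and pairs of basic points as basic points. -/
def MetricData.prod (P : MetricData S) (Q : MetricData T) : MetricData (S × T) where
  dist p q := max (P.dist p.1 q.1) (Q.dist p.2 q.2)
  pt n := (P.pt n.unpair.1, Q.pt n.unpair.2)

/-- The family `(V s)`, `s ∈ D`, of subsets of `T` is `Σ⁰₁[s]`: it consists of the sections of an
effectively open subset of `S × T`. -/
def IsSigmaOneFamilyOn (P : MetricData S) (Q : MetricData T) (D : Set S) (V : S → Set T) : Prop :=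
  ∃ W : Set (S × T), IsEffectivelyOpen (P.prod Q) W ∧ ∀ s ∈ D, V s = {y | (s, y) ∈ W}

/-- The restriction of `f` to `D` is computable: some partial computable map on Baire space
sends each Cauchy name for each `x ∈ D` to a Cauchy name for `f x`. -/
def ComputableMapOn (P : MetricData S) (Q : MetricData T) (D : Set S) (f : S → T) : Prop :=
  ∃ φ : List ℕ → ℕ → Option ℕ, Computable₂ φ ∧
    ∀ x ∈ D, ∀ h, IsCauchyName P h x → ∃ g, FunctionalSends φ h g ∧ IsCauchyName Q g (f x)

end General

/-- `ℕ`, with every point basic. -/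
def natData : MetricData ℕ where
  dist m n := |(m : ℝ) - (n : ℝ)|
  pt n := n

/-- `ℝ`, with the rational numbers as basic points. -/
def realData : MetricData ℝ where
  dist x y := |x - y|
  pt n := (ratCode n : ℝ)

open Classical in
/-- Baire space `ℕ^ℕ`, with `d(g, h) = 2^{-m}` for `m` least with `g m ≠ h m`, and with the
sequences that are eventually `0` as basic points. -/
def baireData : MetricData (ℕ → ℕ) where
  dist g h := if g = h then 0 else (2 : ℝ)⁻¹ ^ PiNat.firstDiff (E := fun _ => ℕ) g h
  pt n := fun k => (Denumerable.ofNat (List ℕ) n).getD k 0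

/-- A sequence of real numbers is computable: one computable function produces, for each `n`, a
sequence of rationals converging to `u n` with `|q j - q i| ≤ 2^{-i}` for `i ≤ j`. -/
def ComputableRealSeq (u : ℕ → ℝ) : Prop :=
  ∃ g : ℕ → ℕ → ℕ, Computable₂ g ∧ ∀ n, IsCauchyName realData (g n) (u n)

/-- A computable metric space: a complete metric space with a dense sequence of basic points whose
mutual distances are uniformly computable. -/
structure ComputableMetricSpace (X : Type*) [MetricSpace X] [CompleteSpace X] where
  /-- the basic points -/
  pt : ℕ → X
  dense : DenseRange pt
  computable_dist : ComputableRealSeq fun n => dist (pt n.unpair.1) (pt n.unpair.2)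

section Semicomputable

variable {S : Type*}

/-- Lower semicomputable functions: suprema of computable sequences of computable real-valued
functions. -/
def LowerSemicomputable (P : MetricData S) (f : S → EReal) : Prop :=
  ∃ g : ℕ × S → ℝ, ComputableMapOn (natData.prod P) realData Set.univ g ∧
    ∀ x, f x = ⨆ n, ((g (n, x) : ℝ) : EReal)

end Semicomputable

section Measures

variable {X : Type*} [MetricSpace X] [CompleteSpace X]

/-- A computable metric space as metric with basic points. -/
def ComputableMetricSpace.data (𝕏 : ComputableMetricSpace X) : MetricData X where
  dist := dist
  pt := 𝕏.pt

/-- The bump function `f_{x,r,s}`: `1` within distance `r` of `x`, `0` beyond distance `s`, and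
linear in the distance in between. -/
def bump (x : X) (r s : ℝ) (y : X) : ℝ :=
  if dist x y ≤ r then 1 else if dist x y ≤ s then (s - dist x y) / (s - r) else 0

/-- The enumeration (with repetitions) of the basic functions, i.e. of the closure of the basic
bump functions (basic center, rational radii `0 < r < s`) and the constant `1` under `max`, `min`
and rational linear combinations. The code `0` stands for `1`; the codes `4 m + 1`, `4 m + 2`,
`4 m + 3`, `4 m + 4` stand for a bump function, a maximum, a minimum and a linear combination,
whose constituents are coded by `m`. -/
def basicFun (𝕏 : ComputableMetricSpace X) : ℕ → X → ℝ
  | 0 => fun _ => 1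
  | n + 1 =>
    match n % 4 with
    | 0 =>
      bump (𝕏.pt (n / 4).unpair.1) (posRatCode (n / 4).unpair.2.unpair.1 : ℝ)
        ((posRatCode (n / 4).unpair.2.unpair.1 : ℝ) + (posRatCode (n / 4).unpair.2.unpair.2 : ℝ))
    | 1 => fun y => max (basicFun 𝕏 (n / 4).unpair.1 y) (basicFun 𝕏 (n / 4).unpair.2 y)
    | 2 => fun y => min (basicFun 𝕏 (n / 4).unpair.1 y) (basicFun 𝕏 (n / 4).unpair.2 y)
    | _ => fun y =>
      (ratCode (n / 4).unpair.1.unpair.1 : ℝ) * basicFun 𝕏 (n / 4).unpair.2.unpair.1 y +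
        (ratCode (n / 4).unpair.1.unpair.2 : ℝ) * basicFun 𝕏 (n / 4).unpair.2.unpair.2 y
decreasing_by
  all_goals
    have h1 : (n / 4).unpair.1 < n + 1 :=
      Nat.lt_succ_of_le ((Nat.unpair_left_le _).trans (Nat.div_le_self _ _))
    have h2 : (n / 4).unpair.2 < n + 1 :=
      Nat.lt_succ_of_le ((Nat.unpair_right_le _).trans (Nat.div_le_self _ _))
    have h3 : (n / 4).unpair.2.unpair.1 < n + 1 := (Nat.unpair_left_le _).trans_lt h2
    have h4 : (n / 4).unpair.2.unpair.2 < n + 1 := (Nat.unpair_right_le _).trans_lt h2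
    assumption

variable [MeasurableSpace X]

/-- The Dirac measure at `x`. -/
def diracMeasure (x : X) : FiniteMeasure X := ⟨Measure.dirac x, inferInstance⟩

/-- The space `ℳ(𝕏)` of finite measures, with the metric
`d(μ, ν) = ∑ᵢ 2^{-i} (1 - exp (-|∫ fᵢ dμ - ∫ fᵢ dν|))`, where `fᵢ` is the `i`-th basic function,
and with the finite positive rational combinations of Dirac measures at basic points as basic
points. -/
def ComputableMetricSpace.measureData (𝕏 : ComputableMetricSpace X) :
    MetricData (FiniteMeasure X) where
  dist μ ν := ∑' i : ℕ, (2 : ℝ)⁻¹ ^ i *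
    (1 - Real.exp (-|∫ y, basicFun 𝕏 i y ∂(μ : Measure X) - ∫ y, basicFun 𝕏 i y ∂(ν : Measure X)|))
  pt n := ((Denumerable.ofNat (List ℕ) n).map fun c =>
    (posRatCode c.unpair.1 : ℝ≥0) • diracMeasure (𝕏.pt c.unpair.2)).sum

variable {A : Type*}

/-- Uniform Schnorr integral tests `t`, where `t a μ x` is the value written `t_μ^a(x)`, with
oracles `a` from a space `A`. -/
structure IsUniformSchnorrIntegralTest (𝕏 : ComputableMetricSpace X) (P : MetricData A)
    (t : A → FiniteMeasure X → X → ℝ≥0∞) : Prop where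
  lower_semicomputable : LowerSemicomputable (P.prod (𝕏.measureData.prod 𝕏.data))
    fun p => ((t p.1 p.2.1 p.2.2 : ℝ≥0∞) : EReal)
  lintegral_lt_top : ∀ a (μ : FiniteMeasure X), ∫⁻ x, t a μ x ∂(μ : Measure X) < ∞
  computable_integral : ComputableMapOn (P.prod 𝕏.measureData) realData Set.univ
    fun p => (∫⁻ x, t p.1 p.2 x ∂(p.2 : Measure X)).toReal

/-- The set `SR_μ^a` of the points that are uniformly Schnorr `μ`-random relative to the
oracle `a`. -/
def SR (𝕏 : ComputableMetricSpace X) (P : MetricData A) (a : A) (μ : FiniteMeasure X) : Set X :=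
  {x | ∀ t : A → FiniteMeasure X → X → ℝ≥0∞, IsUniformSchnorrIntegralTest 𝕏 P t → t a μ x < ∞}

/-- Uniform Schnorr sequential tests restricted to a set `K` (in practice effectively closed),
where `U n a μ` is the set written `U_μ^{n;a}`. Only the values at `(a, μ) ∈ K` matter. -/
structure IsUniformSchnorrSequentialTest (𝕏 : ComputableMetricSpace X) (P : MetricData A)
    (K : Set (A × FiniteMeasure X)) (U : ℕ → A → FiniteMeasure X → Set X) : Prop where
  sigma_one : IsSigmaOneFamilyOn (natData.prod (P.prod 𝕏.measureData)) 𝕏.data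
    {p | p.2 ∈ K} fun p => U p.1 p.2.1 p.2.2
  measure_le : ∀ n a (μ : FiniteMeasure X), (a, μ) ∈ K →
    (μ : Measure X) (U n a μ) ≤ (2 : ℝ≥0∞)⁻¹ ^ n
  computable_measure : ComputableMapOn (natData.prod (P.prod 𝕏.measureData)) realData
    {p | p.2 ∈ K} fun p => (p.2.2 : Measure X).real (U p.1 p.2.1 p.2.2)

/-- The set of the pairs `(h, μ)` such that `h` is a Cauchy name for `μ`. -/
def nameSet (𝕏 : ComputableMetricSpace X) : Set ((ℕ → ℕ) × FiniteMeasure X) :=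
  {p | IsCauchyName 𝕏.measureData p.1 p.2}

end Measures

end

end SchnorrRandomness

-- On `nameSet` the oracle `h` computes the integral of every basic function against `μ`. Since `h`
-- belongs to the parameter, objects attached to `(h, μ)` may depend on the chosen name, so both
-- directions may use the outcome of a search even if it changes from one name of `μ` to another.
-- `nameSet` is effectively closed because failing to be a name is witnessed by a strict inequality
-- between computable distances.
--
-- From an integral test `t` to a sequential test: the truncated integral `M q = ∫ min t q dμ` is
-- computable, because both it and `∫ t dμ - M q = ∫ (t - q)⁺ dμ` are lower semicomputable. `M` is
-- concave and its slopes trap the tail `c ↦ μ {t > c}`. The tail is antitone, hence continuous off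
-- a countable set, so a search relative to `h` finds nested rational intervals across which it
-- varies by less than `2^{-i}`, the first lying so far out that Markov's inequality gives tail at
-- most `2^{-n}`. The points where `t` exceeds the right end of some interval form an open set of
-- computable measure that contains every point with `t = ∞` (`exists_nested_levels`,
-- `IsUniformSchnorrIntegralTest.exists_sequentialTest`).
--
-- From a sequential test to an integral test: `V = ∑ₙ 1_{Uⁿ}` has computable integral and is the
-- supremum of increasing basic functions `f_s` computed from `h`. Search for stages `s_k` with `∫ V
-- - ∫ f_{s_k} < 2^{-k}`. The increments between consecutive stages, clamped to `[0, 1]`, have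
-- integral at most `2^{-k}`, and their sum is infinite wherever `V` is
-- (`IsUniformSchnorrSequentialTest.exists_basicFun`). An integral test must however be defined for
-- all `(h, μ)`; off `nameSet` the search, which reads `h` alone, may diverge or return a function
-- of large `μ`-integral. Each increment `e` is therefore capped by `2 - 2^k ∫ e dμ` and by `1 - 2^T
-- κ`, where `T` is the search time and `κ ≥ 0` is computable with zero set `nameSet`. The first cap
-- controls the integral. The second makes the value computable even where the search diverges,
-- since `κ > 0` there and the value is `0` for every `T` with `2^T κ > 1`. On `nameSet` neither cap
-- has any effect (`cutoffPiece`, `CompReal.of_firstHit`).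
--
-- Computability is expressed by certificates on finite oracle prefixes (`SemiDec`) and by pairs of
-- Dedekind cuts (`CompReal`); `CompReal.computableMapOn`, `SemiDec.exists_balls` and
-- `isEffectivelyOpen_of_semiDec` translate back to names and effectively open sets.

attribute [fun_prop] Computable
attribute [fun_prop] Computable.const Computable.id Computable.comp

namespace SchnorrRandomness

-- Closure properties of computable functions

section ComputableToolkit

variable {α β γ δ : Type*} [Primcodable α] [Primcodable β] [Primcodable γ] [Primcodable δ]

@[fun_prop] theorem computable_fst {f : α → β × γ} (hf : Computable f) :
    Computable fun a => (f a).1 := Computable.fst.comp hf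

@[fun_prop] theorem computable_snd {f : α → β × γ} (hf : Computable f) :
    Computable fun a => (f a).2 := Computable.snd.comp hf

@[fun_prop] theorem computable_prodMk {f : α → β} {g : α → γ} (hf : Computable f)
    (hg : Computable g) : Computable fun a => (f a, g a) := Computable.pair hf hg

@[fun_prop] theorem computable_add {f g : α → ℕ} (hf : Computable f) (hg : Computable g) :
    Computable fun a => f a + g a := Primrec.nat_add.to_comp.comp hf hg

@[fun_prop] theorem computable_sub {f g : α → ℕ} (hf : Computable f) (hg : Computable g) :
    Computable fun a => f a - g a := Primrec.nat_sub.to_comp.comp hf hg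

@[fun_prop] theorem computable_mul {f g : α → ℕ} (hf : Computable f) (hg : Computable g) :
    Computable fun a => f a * g a := Primrec.nat_mul.to_comp.comp hf hg

@[fun_prop] theorem computable_div {f g : α → ℕ} (hf : Computable f) (hg : Computable g) :
    Computable fun a => f a / g a := Primrec.nat_div.to_comp.comp hf hg

@[fun_prop] theorem computable_mod {f g : α → ℕ} (hf : Computable f) (hg : Computable g) :
    Computable fun a => f a % g a := Primrec.nat_mod.to_comp.comp hf hg

@[fun_prop] theorem computable_unpair {f : α → ℕ} (hf : Computable f) :
    Computable fun a => (f a).unpair := Computable.unpair.comp hf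

@[fun_prop] theorem computable_natPair {f g : α → ℕ} (hf : Computable f) (hg : Computable g) :
    Computable fun a => Nat.pair (f a) (g a) := Primrec₂.natPair.to_comp.comp hf hg

@[fun_prop] theorem computable_encode {f : α → β} (hf : Computable f) :
    Computable fun a => Encodable.encode (f a) := Computable.encode.comp hf

@[fun_prop] theorem computable_ofNat_list {f : α → ℕ} (hf : Computable f) :
    Computable fun a => Denumerable.ofNat (List ℕ) (f a) := (Computable.ofNat (List ℕ)).comp hf

@[fun_prop] theorem computable_take {f : α → List β} {g : α → ℕ} (hf : Computable f)
    (hg : Computable g) : Computable fun a => (f a).take (g a) :=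
  Primrec.list_take.to_comp.comp hg hf

@[fun_prop] theorem computable_append {f g : α → List β} (hf : Computable f)
    (hg : Computable g) : Computable fun a => f a ++ g a :=
  Primrec.list_append.to_comp.comp hf hg

@[fun_prop] theorem computable_singleton {f : α → β} (hf : Computable f) :
    Computable fun a => [f a] :=
  Computable.list_cons.comp hf (Computable.const [])

@[fun_prop] theorem computable_getD {f : α → List ℕ} {g : α → ℕ} (hf : Computable f)
    (hg : Computable g) (d : ℕ) : Computable fun a => (f a).getD (g a) d :=
  (Primrec.list_getD d).to_comp.comp hf hg

@[fun_prop] theorem computable_length {f : α → List β} (hf : Computable f) :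
    Computable fun a => (f a).length := Computable.list_length.comp hf

@[fun_prop] theorem computable_and {f g : α → Bool} (hf : Computable f) (hg : Computable g) :
    Computable fun a => f a && g a := Primrec.and.to_comp.comp hf hg

@[fun_prop] theorem computable_or {f g : α → Bool} (hf : Computable f) (hg : Computable g) :
    Computable fun a => f a || g a := Primrec.or.to_comp.comp hf hg

@[fun_prop] theorem computable_not {f : α → Bool} (hf : Computable f) :
    Computable fun a => !f a := Primrec.not.to_comp.comp hf

@[fun_prop] theorem computable_blt {f g : α → ℕ} (hf : Computable f) (hg : Computable g) :
    Computable fun a => Nat.blt (f a) (g a) :=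
  (Primrec.nat_lt.decide.to_comp.comp hf hg).of_eq fun a => by
    rw [Bool.eq_iff_iff, decide_eq_true_iff, Nat.blt_eq]

@[fun_prop] theorem computable_ble {f g : α → ℕ} (hf : Computable f) (hg : Computable g) :
    Computable fun a => Nat.ble (f a) (g a) :=
  (Primrec.nat_le.decide.to_comp.comp hf hg).of_eq fun a => by
    rw [Bool.eq_iff_iff, decide_eq_true_iff, Nat.ble_eq]

@[fun_prop] theorem computable_beq {f g : α → ℕ} (hf : Computable f) (hg : Computable g) :
    Computable fun a => Nat.beq (f a) (g a) :=
  ((Primrec.eq (α := ℕ)).decide.to_comp.comp hf hg).of_eq fun a => by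
    rw [Bool.eq_iff_iff, decide_eq_true_iff, Nat.beq_eq]

@[fun_prop] theorem computable_decide_eq_option {f g : α → Option ℕ} (hf : Computable f)
    (hg : Computable g) : Computable fun a => decide (f a = g a) :=
  (Primrec.eq (α := Option ℕ)).decide.to_comp.comp hf hg

@[fun_prop] theorem computable_some {f : α → β} (hf : Computable f) :
    Computable fun a => some (f a) := Computable.option_some.comp hf

@[fun_prop] theorem computable_bif {c : α → Bool} {f g : α → β} (hc : Computable c)
    (hf : Computable f) (hg : Computable g) : Computable fun a => bif c a then f a else g a :=
  Computable.cond hc hf hg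

theorem computable_natRec {f : α → ℕ} {g : α → β} {h : α × ℕ × β → β} (hf : Computable f)
    (hg : Computable g) (hh : Computable h) :
    Computable fun a => (Nat.rec (g a) (fun n b => h (a, n, b)) (f a) : β) :=
  Computable.nat_rec (h := fun a p => h (a, p)) hf hg hh

/-- Bounded existential search in a decidable predicate. -/
def existsBelow (p : ℕ → Bool) (n : ℕ) : Bool := Nat.rec false (fun i b => b || p i) n

theorem existsBelow_iff (p : ℕ → Bool) (n : ℕ) : existsBelow p n = true ↔ ∃ i < n, p i = true := by
  induction n with
  | zero => simp [existsBelow]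
  | succ n ih =>
    have : existsBelow p (n + 1) = (existsBelow p n || p n) := rfl
    rw [this, Bool.or_eq_true, ih]
    constructor
    · rintro (⟨i, hi, h⟩ | h)
      exacts [⟨i, by omega, h⟩, ⟨n, by omega, h⟩]
    · rintro ⟨i, hi, h⟩
      rcases Nat.lt_succ_iff_lt_or_eq.1 hi with hi | rfl
      exacts [Or.inl ⟨i, hi, h⟩, Or.inr h]

theorem computable_existsBelow {f : α → ℕ} {p : α × ℕ → Bool} (hf : Computable f)
    (hp : Computable p) : Computable fun a => existsBelow (fun i => p (a, i)) (f a) :=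
  computable_natRec (h := fun x : α × ℕ × Bool => x.2.2 || p (x.1, x.2.1)) hf
    (Computable.const false) (by fun_prop)

/-- Bounded universal quantification over a decidable predicate. -/
def forallBelow (p : ℕ → Bool) (n : ℕ) : Bool := !existsBelow (fun i => !p i) n

theorem forallBelow_iff (p : ℕ → Bool) (n : ℕ) : forallBelow p n = true ↔ ∀ i < n, p i = true := by
  have h := existsBelow_iff (fun i => !p i) n
  simp only [forallBelow, Bool.not_eq_true', ← Bool.not_eq_true, h]
  simp

theorem computable_forallBelow {f : α → ℕ} {p : α × ℕ → Bool} (hf : Computable f)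
    (hp : Computable p) : Computable fun a => forallBelow (fun i => p (a, i)) (f a) :=
  computable_not (computable_existsBelow (p := fun x => !p x) hf (by fun_prop))

theorem computable_rangeMap {f : α → ℕ} {g : α × ℕ → β} (hf : Computable f)
    (hg : Computable g) : Computable fun a => (List.range (f a)).map fun i => g (a, i) :=
  (computable_natRec (g := fun _ => ([] : List β))
    (h := fun x : α × ℕ × List β => x.2.2 ++ [g (x.1, x.2.1)]) hf
    (Computable.const []) (by fun_prop)).of_eq fun a => by
      induction f a with
      | zero => rfl
      | succ n ih => simp only [List.range_succ, List.map_append, List.map_cons, List.map_nil, ← ih]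

end ComputableToolkit

/-! ## Computable rational-valued functions -/

section RatComputable

variable {α β : Type*} [Primcodable α] [Primcodable β]

theorem ratCode_pair (a b c : ℕ) :
    ratCode (Nat.pair (Nat.pair a b) c) = ((a : ℚ) - b) / (c + 1) := by
  simp [ratCode]

theorem ratCode_surjective : Function.Surjective ratCode := by
  intro q
  refine ⟨Nat.pair (Nat.pair q.num.toNat (-q.num).toNat) (q.den - 1), ?_⟩
  rw [ratCode_pair]
  have h1 : ((q.num.toNat : ℤ) - ((-q.num).toNat : ℤ)) = q.num := by omega
  have h2 : ((q.den - 1 : ℕ) : ℚ) + 1 = q.den := by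
    have := q.den_pos
    rw [← Nat.cast_succ]; congr 1; omega
  have h1' : ((q.num.toNat : ℚ) - ((-q.num).toNat : ℚ)) = q.num := by exact_mod_cast h1
  rw [h1', h2, Rat.num_div_den]

/-- Rational-valued functions that are computable in terms of codes. -/
@[fun_prop] def RatComputable (f : α → ℚ) : Prop :=
  ∃ c : α → ℕ, Computable c ∧ ∀ a, ratCode (c a) = f a

theorem RatComputable.of_eq {f g : α → ℚ} (hf : RatComputable f) (h : ∀ a, f a = g a) :
    RatComputable g := (funext h : f = g) ▸ hf

@[fun_prop] theorem RatComputable.ratCode {f : α → ℕ} (hf : Computable f) :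
    RatComputable fun a => ratCode (f a) := ⟨f, hf, fun _ => rfl⟩

@[fun_prop] theorem RatComputable.const (q : ℚ) : RatComputable fun _ : α => q := by
  obtain ⟨n, hn⟩ := ratCode_surjective q
  exact ⟨fun _ => n, Computable.const n, fun _ => hn⟩

theorem RatComputable.comp {f : β → ℚ} {g : α → β} (hf : RatComputable f)
    (hg : Computable g) : RatComputable fun a => f (g a) := by
  obtain ⟨c, hc, h⟩ := hf
  exact ⟨fun a => c (g a), hc.comp hg, fun a => h _⟩

@[fun_prop] theorem RatComputable.natCast {f : α → ℕ} (hf : Computable f) :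
    RatComputable fun a => (f a : ℚ) :=
  ⟨fun a => Nat.pair (Nat.pair (f a) 0) 0, by fun_prop, fun a => by simp [ratCode_pair]⟩

@[fun_prop] theorem RatComputable.neg {f : α → ℚ} (hf : RatComputable f) :
    RatComputable fun a => - f a := by
  obtain ⟨c, hc, h⟩ := hf
  refine ⟨fun a => Nat.pair (Nat.pair (c a).unpair.1.unpair.2 (c a).unpair.1.unpair.1)
    (c a).unpair.2, by fun_prop, fun a => ?_⟩
  dsimp only
  rw [← h, ratCode_pair, SchnorrRandomness.ratCode]
  ring

@[fun_prop] theorem RatComputable.add {f g : α → ℚ} (hf : RatComputable f)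
    (hg : RatComputable g) : RatComputable fun a => f a + g a := by
  obtain ⟨c, hc, h⟩ := hf
  obtain ⟨d, hd, h'⟩ := hg
  refine ⟨fun a => Nat.pair (Nat.pair
    ((c a).unpair.1.unpair.1 * ((d a).unpair.2 + 1) + (d a).unpair.1.unpair.1 * ((c a).unpair.2 + 1))
    ((c a).unpair.1.unpair.2 * ((d a).unpair.2 + 1) + (d a).unpair.1.unpair.2 * ((c a).unpair.2 + 1)))
    ((c a).unpair.2 * (d a).unpair.2 + (c a).unpair.2 + (d a).unpair.2), by fun_prop, fun a => ?_⟩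
  dsimp only
  rw [← h, ← h', ratCode_pair, SchnorrRandomness.ratCode, SchnorrRandomness.ratCode]
  have h1 : ((c a).unpair.2 : ℚ) + 1 ≠ 0 := by positivity
  have h2 : ((d a).unpair.2 : ℚ) + 1 ≠ 0 := by positivity
  rw [div_add_div _ _ h1 h2]
  push_cast
  congr 1 <;> ring

@[fun_prop] theorem RatComputable.mul {f g : α → ℚ} (hf : RatComputable f)
    (hg : RatComputable g) : RatComputable fun a => f a * g a := by
  obtain ⟨c, hc, h⟩ := hf
  obtain ⟨d, hd, h'⟩ := hg
  refine ⟨fun a => Nat.pair (Nat.pair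
    ((c a).unpair.1.unpair.1 * (d a).unpair.1.unpair.1 +
      (c a).unpair.1.unpair.2 * (d a).unpair.1.unpair.2)
    ((c a).unpair.1.unpair.1 * (d a).unpair.1.unpair.2 +
      (c a).unpair.1.unpair.2 * (d a).unpair.1.unpair.1))
    ((c a).unpair.2 * (d a).unpair.2 + (c a).unpair.2 + (d a).unpair.2), by fun_prop, fun a => ?_⟩
  dsimp only
  rw [← h, ← h', ratCode_pair, SchnorrRandomness.ratCode, SchnorrRandomness.ratCode,
    div_mul_div_comm]
  push_cast
  congr 1 <;> ring

@[fun_prop] theorem RatComputable.sub {f g : α → ℚ} (hf : RatComputable f)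
    (hg : RatComputable g) : RatComputable fun a => f a - g a :=
  (hf.add hg.neg).of_eq fun a => by ring

/-- Cross-multiplying and moving the subtracted parts to the other side leaves an inequality of
natural numbers, free of truncated subtraction. -/
theorem RatComputable.computable_lt {f g : α → ℚ} (hf : RatComputable f)
    (hg : RatComputable g) : Computable fun a => decide (f a < g a) := by
  obtain ⟨c, hc, h⟩ := hf
  obtain ⟨d, hd, h'⟩ := hg
  have : Computable fun a => Nat.blt
      ((c a).unpair.1.unpair.1 * ((d a).unpair.2 + 1) +
        (d a).unpair.1.unpair.2 * ((c a).unpair.2 + 1))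
      ((c a).unpair.1.unpair.2 * ((d a).unpair.2 + 1) +
        (d a).unpair.1.unpair.1 * ((c a).unpair.2 + 1)) := by fun_prop
  refine this.of_eq fun a => ?_
  rw [Bool.eq_iff_iff, decide_eq_true_iff, Nat.blt_eq]
  rw [← h, ← h', SchnorrRandomness.ratCode, SchnorrRandomness.ratCode,
    div_lt_div_iff₀ (by positivity) (by positivity), ← Nat.cast_lt (α := ℚ)]
  push_cast
  constructor <;> intro h <;> linarith

@[fun_prop] theorem RatComputable.bif {c : α → Bool} {f g : α → ℚ} (hc : Computable c)
    (hf : RatComputable f) (hg : RatComputable g) :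
    RatComputable fun a => bif c a then f a else g a := by
  obtain ⟨d, hd, h⟩ := hf
  obtain ⟨e, he, h'⟩ := hg
  exact ⟨fun a => bif c a then d a else e a, by fun_prop, fun a => by
    dsimp only
    cases c a <;> simp [h, h']⟩

@[fun_prop] theorem RatComputable.max {f g : α → ℚ} (hf : RatComputable f)
    (hg : RatComputable g) : RatComputable fun a => max (f a) (g a) := by
  refine (RatComputable.bif (hf.computable_lt hg) hg hf).of_eq fun a => ?_
  rcases lt_or_ge (f a) (g a) with h | h
  · simp [h, h.le]
  · simp [not_lt.2 h, h]

@[fun_prop] theorem RatComputable.min {f g : α → ℚ} (hf : RatComputable f)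
    (hg : RatComputable g) : RatComputable fun a => min (f a) (g a) := by
  refine (RatComputable.bif (hf.computable_lt hg) hf hg).of_eq fun a => ?_
  rcases lt_or_ge (f a) (g a) with h | h
  · simp [h, h.le]
  · simp [not_lt.2 h, h]

@[fun_prop] theorem RatComputable.abs {f : α → ℚ} (hf : RatComputable f) :
    RatComputable fun a => |f a| := by
  simp only [abs_eq_max_neg]
  fun_prop

@[fun_prop] theorem RatComputable.inv {f : α → ℚ} (hf : RatComputable f) :
    RatComputable fun a => (f a)⁻¹ := by
  obtain ⟨c, hc, h⟩ := hf
  -- The sign of the numerator decides which difference becomes the new denominator. The last branch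
  -- returns code `0`, which decodes to `0` and so agrees with `0⁻¹ = 0`.
  refine ⟨fun a => bif Nat.blt (c a).unpair.1.unpair.2 (c a).unpair.1.unpair.1 then
      Nat.pair (Nat.pair ((c a).unpair.2 + 1) 0)
        ((c a).unpair.1.unpair.1 - (c a).unpair.1.unpair.2 - 1)
      else bif Nat.blt (c a).unpair.1.unpair.1 (c a).unpair.1.unpair.2 then
        Nat.pair (Nat.pair 0 ((c a).unpair.2 + 1))
          ((c a).unpair.1.unpair.2 - (c a).unpair.1.unpair.1 - 1) else 0,
    by fun_prop, fun a => ?_⟩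
  dsimp only
  rw [← h, SchnorrRandomness.ratCode.eq_1 (c a)]
  generalize (c a).unpair.1.unpair.1 = x
  generalize (c a).unpair.1.unpair.2 = y
  generalize (c a).unpair.2 = z
  rcases lt_trichotomy y x with hxy | hxy | hxy
  · have hb : Nat.blt y x = true := by rw [Nat.blt_eq]; exact hxy
    obtain ⟨k, rfl⟩ := Nat.exists_eq_add_of_lt hxy
    simp only [hb, cond_true, ratCode_pair, inv_div]
    have : y + k + 1 - y - 1 = k := by omega
    rw [this]; push_cast; congr 1 <;> ring
  · subst hxy
    have hb : Nat.blt y y = false := by rw [← Bool.not_eq_true, Nat.blt_eq]; exact lt_irrefl _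
    simp [hb, SchnorrRandomness.ratCode]
  · have hb : Nat.blt x y = true := by rw [Nat.blt_eq]; exact hxy
    have hb' : Nat.blt y x = false := by rw [← Bool.not_eq_true, Nat.blt_eq]; exact hxy.not_gt
    obtain ⟨k, rfl⟩ := Nat.exists_eq_add_of_lt hxy
    simp only [hb, hb', cond_true, cond_false,
      ratCode_pair, inv_div]
    have : x + k + 1 - x - 1 = k := by omega
    rw [this]; push_cast
    rw [zero_sub, neg_div, show ((x : ℚ) - (x + k + 1)) = - (k + 1) by ring, div_neg]

@[fun_prop] theorem RatComputable.div {f g : α → ℚ} (hf : RatComputable f)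
    (hg : RatComputable g) : RatComputable fun a => f a / g a :=
  (hf.mul hg.inv).of_eq fun _ => (div_eq_mul_inv _ _).symm

/-- Rational-valued functions defined by a primitive recursion. -/
theorem RatComputable.of_rec {F : α → ℕ → ℚ} {f : α → ℕ} (hf : Computable f)
    (h0 : RatComputable fun a => F a 0) {G : α × ℕ × ℚ → ℚ}
    (hG : RatComputable fun x : α × ℕ × ℕ => G (x.1, x.2.1, SchnorrRandomness.ratCode x.2.2))
    (hs : ∀ a n, F a (n + 1) = G (a, n, F a n)) : RatComputable fun a => F a (f a) := by
  obtain ⟨c, hc, h⟩ := h0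
  obtain ⟨d, hd, h'⟩ := hG
  refine ⟨_, computable_natRec (h := d) hf hc hd, fun a => ?_⟩
  show SchnorrRandomness.ratCode (Nat.rec (c a) (fun n b => d (a, n, b)) (f a)) = F a (f a)
  induction f a with
  | zero => exact h a
  | succ n ih =>
    rw [hs, ← ih]
    exact h' (a, n, _)

@[fun_prop] theorem RatComputable.pow {f : α → ℚ} {g : α → ℕ} (hf : RatComputable f)
    (hg : Computable g) : RatComputable fun a => f a ^ g a := by
  refine RatComputable.of_rec (F := fun a n => f a ^ n) (G := fun x => x.2.2 * f x.1) hg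
    (by simp only [pow_zero]; fun_prop) ?_ (fun a n => pow_succ _ _)
  have := hf.comp (Computable.fst : Computable fun x : α × ℕ × ℕ => x.1)
  exact (RatComputable.ratCode (by fun_prop)).mul this

theorem RatComputable.sum_range {f : α × ℕ → ℚ} {g : α → ℕ} (hf : RatComputable f)
    (hg : Computable g) : RatComputable fun a => ∑ i ∈ Finset.range (g a), f (a, i) := by
  refine RatComputable.of_rec (F := fun a n => ∑ i ∈ Finset.range n, f (a, i))
    (G := fun x => x.2.2 + f (x.1, x.2.1)) hg
    (by simp only [Finset.range_zero, Finset.sum_empty]; fun_prop) ?_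
    (fun a n => Finset.sum_range_succ _ _)
  have := hf.comp (by fun_prop : Computable fun x : α × ℕ × ℕ => (x.1, x.2.1))
  exact (RatComputable.ratCode (by fun_prop)).add this

@[fun_prop] theorem RatComputable.posRatCode {f : α → ℕ} (hf : Computable f) :
    RatComputable fun a => (posRatCode (f a) : ℚ) := by
  refine ⟨fun a => Nat.pair (Nat.pair ((f a).unpair.1 + 1) 0) (f a).unpair.2, by fun_prop,
    fun a => ?_⟩
  simp [ratCode_pair, SchnorrRandomness.posRatCode]

end RatComputable

/-! ## Semidecidable predicates relative to an oracle -/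

section SemiDec

theorem length_initSeg (h : ℕ → ℕ) (k : ℕ) : (initSeg h k).length = k := by simp [initSeg]

theorem take_initSeg (h : ℕ → ℕ) {k l : ℕ} (hkl : k ≤ l) :
    (initSeg h l).take k = initSeg h k := by
  rw [initSeg, initSeg, ← List.map_take, List.take_range, min_eq_left hkl]

theorem getD_initSeg (h : ℕ → ℕ) {i k : ℕ} (hik : i < k) (d : ℕ) :
    (initSeg h k).getD i d = h i := by
  simp [initSeg, List.getD, hik]

theorem initSeg_succ (h : ℕ → ℕ) (k : ℕ) : initSeg h (k + 1) = initSeg h k ++ [h k] := by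
  simp [initSeg, List.range_succ]

variable {Ω Ω' : Type*} {α β γ : Type*} [Primcodable α] [Primcodable β] [Primcodable γ]

/-- A predicate `P ω a`, where `o ω` is the oracle attached to `ω`, is semidecidable if finite
initial segments of the oracle provide verifiable certificates for its truth. -/
def SemiDec (o : Ω → ℕ → ℕ) (P : Ω → α → Prop) : Prop :=
  ∃ R : List ℕ × α × ℕ → Bool, Computable R ∧
    ∀ ω a, P ω a ↔ ∃ w, R (initSeg (o ω) w, a, w) = true

variable {o : Ω → ℕ → ℕ} {P Q : Ω → α → Prop}

theorem SemiDec.congr (hP : SemiDec o P) (h : ∀ ω a, Q ω a ↔ P ω a) : SemiDec o Q := by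
  obtain ⟨R, hR, H⟩ := hP
  exact ⟨R, hR, fun ω a => (h ω a).trans (H ω a)⟩

theorem SemiDec.comp (hP : SemiDec o P) {f : β → α} (hf : Computable f) :
    SemiDec o fun ω b => P ω (f b) := by
  obtain ⟨R, hR, H⟩ := hP
  exact ⟨fun x => R (x.1, f x.2.1, x.2.2), by fun_prop, fun ω b => H ω (f b)⟩

/-- Every `w ≥ k a` is a certificate, since the test recovers the prefix of length `k a` by
truncation. -/
theorem SemiDec.of_initSeg (o : Ω → ℕ → ℕ) {R : List ℕ × α → Bool} (hR : Computable R) {k : α → ℕ}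
    (hk : Computable k) : SemiDec o fun ω a => R (initSeg (o ω) (k a), a) = true := by
  refine ⟨fun x => Nat.ble (k x.2.1) x.2.2 && R (x.1.take (k x.2.1), x.2.1), by fun_prop,
    fun ω a => ?_⟩
  simp only [Bool.and_eq_true, Nat.ble_eq]
  constructor
  · intro h
    exact ⟨k a, le_rfl, by rwa [take_initSeg _ le_rfl]⟩
  · rintro ⟨w, hw, h⟩
    rwa [take_initSeg _ hw] at h

theorem SemiDec.of_computable (o : Ω → ℕ → ℕ) {d : α → Bool} (hd : Computable d) :
    SemiDec o fun _ a => d a = true :=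
  SemiDec.of_initSeg o (R := fun x => d x.2) (k := fun _ => 0) (by fun_prop) (by fun_prop)

theorem SemiDec.of_lt (o : Ω → ℕ → ℕ) {f g : α → ℚ} (hf : RatComputable f)
    (hg : RatComputable g) : SemiDec o fun _ a => f a < g a :=
  (SemiDec.of_computable o (hf.computable_lt hg)).congr fun _ _ => by simp

theorem SemiDec.oracle (o : Ω → ℕ → ℕ) {f g : α → ℕ} (hf : Computable f) (hg : Computable g) :
    SemiDec o fun ω a => o ω (f a) = g a :=
  (SemiDec.of_initSeg o (R := fun x => Nat.beq (x.1.getD (f x.2) 0) (g x.2))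
    (k := fun a => f a + 1) (by fun_prop) (by fun_prop)).congr fun ω a => by
      rw [Nat.beq_eq, getD_initSeg _ (Nat.lt_succ_self _)]

/-- A certificate codes one certificate for each conjunct. Both are at most the code, so each
sub-test can be given a prefix of exactly the length it expects. -/
theorem SemiDec.and (hP : SemiDec o P) (hQ : SemiDec o Q) : SemiDec o fun ω a => P ω a ∧ Q ω a := by
  obtain ⟨R, hR, H⟩ := hP
  obtain ⟨S, hS, H'⟩ := hQ
  refine ⟨fun x => R (x.1.take x.2.2.unpair.1, x.2.1, x.2.2.unpair.1) &&
    S (x.1.take x.2.2.unpair.2, x.2.1, x.2.2.unpair.2), by fun_prop, fun ω a => ?_⟩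
  simp only [H, H', Bool.and_eq_true, take_initSeg _ (Nat.unpair_left_le _),
    take_initSeg _ (Nat.unpair_right_le _)]
  constructor
  · rintro ⟨⟨w, hw⟩, v, hv⟩
    exact ⟨Nat.pair w v, by simpa using hw, by simpa using hv⟩
  · rintro ⟨w, h1, h2⟩
    exact ⟨⟨_, h1⟩, _, h2⟩

theorem SemiDec.ex {P : Ω → α × ℕ → Prop} (hP : SemiDec o P) :
    SemiDec o fun ω a => ∃ n, P ω (a, n) := by
  obtain ⟨R, hR, H⟩ := hP
  refine ⟨fun x => R (x.1.take x.2.2.unpair.1, (x.2.1, x.2.2.unpair.2), x.2.2.unpair.1),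
    by fun_prop, fun ω a => ?_⟩
  simp only [H, take_initSeg _ (Nat.unpair_left_le _)]
  constructor
  · rintro ⟨n, w, hw⟩
    exact ⟨Nat.pair w n, by simpa using hw⟩
  · rintro ⟨w, h1⟩
    exact ⟨_, _, h1⟩

theorem SemiDec.or (hP : SemiDec o P) (hQ : SemiDec o Q) : SemiDec o fun ω a => P ω a ∨ Q ω a := by
  obtain ⟨R, hR, H⟩ := hP
  obtain ⟨S, hS, H'⟩ := hQ
  refine ⟨fun x => R x || S x, by fun_prop, fun ω a => ?_⟩
  simp only [H, H', Bool.or_eq_true, exists_or]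

/-- The certificates of a semidecidable predicate can be chosen to be stable under extension. -/
theorem SemiDec.exists_monotone (hP : SemiDec o P) :
    ∃ R : List ℕ × α × ℕ → Bool, Computable R ∧
      (∀ ω a, P ω a ↔ ∃ w, R (initSeg (o ω) w, a, w) = true) ∧
      ∀ (h : ℕ → ℕ) a w w', w ≤ w' → R (initSeg h w, a, w) = true →
        R (initSeg h w', a, w') = true := by
  obtain ⟨R, hR, H⟩ := hP
  refine ⟨fun x => existsBelow (fun i => R (x.1.take i, x.2.1, i)) (x.2.2 + 1),
    computable_existsBelow (p := fun y : (List ℕ × α × ℕ) × ℕ => R (y.1.1.take y.2, y.1.2.1, y.2)) (by fun_prop)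
      (by fun_prop), fun ω a => ?_, fun h a w w' hww' => ?_⟩
  · simp only [H, existsBelow_iff]
    constructor
    · rintro ⟨w, hw⟩
      exact ⟨w, w, Nat.lt_succ_self w, by rwa [take_initSeg _ le_rfl]⟩
    · rintro ⟨w, i, hi, h⟩
      rw [take_initSeg _ (Nat.lt_succ_iff.1 hi)] at h
      exact ⟨i, h⟩
  · simp only [existsBelow_iff]
    rintro ⟨i, hi, hh⟩
    rw [take_initSeg _ (Nat.lt_succ_iff.1 hi)] at hh
    exact ⟨i, by omega, by rwa [take_initSeg _ (by omega)]⟩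

/-- When certificates are stable under extension, the maximum of finitely many of them certifies all
instances at once. -/
theorem SemiDec.ball {P : Ω → α × ℕ → Prop} (hP : SemiDec o P) {f : α → ℕ} (hf : Computable f) :
    SemiDec o fun ω a => ∀ i < f a, P ω (a, i) := by
  obtain ⟨R, hR, H, mono⟩ := hP.exists_monotone
  refine ⟨fun x => forallBelow (fun i => R (x.1, (x.2.1, i), x.2.2)) (f x.2.1),
    computable_forallBelow (p := fun y : (List ℕ × α × ℕ) × ℕ => R (y.1.1, (y.1.2.1, y.2), y.1.2.2)) (by fun_prop)
      (by fun_prop), fun ω a => ?_⟩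
  simp only [H, forallBelow_iff]
  constructor
  · intro h
    choose! w hw using h
    refine ⟨(Finset.range (f a)).sup w, fun i hi => mono _ _ _ _ ?_ (hw i hi)⟩
    exact Finset.le_sup (Finset.mem_range.2 hi)
  · rintro ⟨w, hw⟩ i hi
    exact ⟨w, hw i hi⟩

/-- The value is guessed and the guess verified, which is possible because its graph is
semidecidable. -/
theorem SemiDec.subst_val {P : Ω → α × ℕ → Prop} (hP : SemiDec o P) {ν : Ω → α → ℕ}
    (hν : SemiDec o fun ω (p : α × ℕ) => ν ω p.1 = p.2) : SemiDec o fun ω a => P ω (a, ν ω a) :=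
  (hν.and hP).ex.congr fun ω a => by simp

/-- `Reduces o' o e`: the oracle of `e ω' c` is uniformly computable from the oracle of `ω'`. -/
def Reduces (o' : Ω' → ℕ → ℕ) (o : Ω → ℕ → ℕ) (e : Ω' → γ → Ω) : Prop :=
  ∃ F : γ × ℕ × List ℕ → ℕ, Computable F ∧
    ∀ ω' c i, o (e ω' c) i = F (c, i, initSeg (o' ω') (i + 2))

theorem SemiDec.subst {o' : Ω' → ℕ → ℕ} {e : Ω' → γ → Ω} (hP : SemiDec o P)
    (he : Reduces o' o e) : SemiDec o' fun ω' (p : γ × α) => P (e ω' p.1) p.2 := by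
  obtain ⟨R, hR, H⟩ := hP
  obtain ⟨F, hF, HF⟩ := he
  -- Value `i` of the computed oracle uses `i + 2` values of the given one, so a prefix of length
  -- `w` determines the first `w - 2` values; certificates shift by `2`.
  refine ⟨fun x => R ((List.range (x.2.2 - 2)).map fun i => F (x.2.1.1, i, x.1.take (i + 2)),
      x.2.1.2, x.2.2 - 2), ?_, fun ω' p => ?_⟩
  · have := computable_rangeMap (f := fun x : List ℕ × (γ × α) × ℕ => x.2.2 - 2)
      (g := fun y => F (y.1.2.1.1, y.2, y.1.1.take (y.2 + 2))) (by fun_prop) (by fun_prop)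
    fun_prop
  · have key : ∀ w, (List.range (w - 2)).map (fun i => F (p.1, i, (initSeg (o' ω') w).take (i + 2)))
        = initSeg (o (e ω' p.1)) (w - 2) := fun w =>
      List.map_congr_left fun i hi => by
        rw [HF, take_initSeg _ (by have := List.mem_range.1 hi; omega)]
    simp only [key, H]
    exact ⟨fun ⟨w, hw⟩ => ⟨w + 2, hw⟩, fun ⟨w, hw⟩ => ⟨w - 2, hw⟩⟩

theorem SemiDec.pullback {o' : Ω' → ℕ → ℕ} {e : Ω' → Ω} (hP : SemiDec o P)
    (he : Reduces o' o fun ω' (_ : Unit) => e ω') : SemiDec o' fun ω' a => P (e ω') a :=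
  (hP.subst he).comp (f := fun a => ((), a)) (by fun_prop)

/-- A deterministic choice of certificates: `FirstHit R h a T` says that `T` is the first stage at
which the test `R`, run on `h`, accepts. -/
def FirstHit {A : Type*} (R : List ℕ × A × ℕ → Bool) (h : ℕ → ℕ) (a : A) (T : ℕ) : Prop :=
  R (initSeg h T, a, T) = true ∧ ∀ i < T, R (initSeg h i, a, i) = false

theorem FirstHit.unique {A : Type*} {R : List ℕ × A × ℕ → Bool} {h : ℕ → ℕ} {a : A} {T T' : ℕ}
    (hT : FirstHit R h a T) (hT' : FirstHit R h a T') : T = T' := by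
  rcases lt_trichotomy T T' with hlt | heq | hlt
  · exact absurd (hT.1.symm.trans (hT'.2 T hlt)) (by simp)
  · exact heq
  · exact absurd (hT'.1.symm.trans (hT.2 T' hlt)) (by simp)

theorem exists_firstHit {A : Type*} {R : List ℕ × A × ℕ → Bool} {h : ℕ → ℕ} {a : A}
    (H : ∃ T, R (initSeg h T, a, T) = true) : ∃ T, FirstHit R h a T := by
  classical
  exact ⟨Nat.find H, Nat.find_spec H, fun i hi => Bool.not_eq_true _ ▸ Nat.find_min H hi⟩

/-- Being the first hit at `T` is decided by the prefix of length `T`. -/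
theorem SemiDec.firstHit (o : Ω → ℕ → ℕ) {R : List ℕ × α × ℕ → Bool} (hR : Computable R) :
    SemiDec o fun ω (p : α × ℕ) => FirstHit R (o ω) p.1 p.2 := by
  have hc : Computable fun x : List ℕ × α × ℕ => R (x.1, x.2.1, x.2.2) &&
      forallBelow (fun i => !R (x.1.take i, x.2.1, i)) x.2.2 := by
    have := computable_forallBelow (f := fun x : List ℕ × α × ℕ => x.2.2)
      (p := fun y => !R (y.1.1.take y.2, y.1.2.1, y.2)) (by fun_prop) (by fun_prop)
    fun_prop
  refine (SemiDec.of_initSeg o (k := fun p : α × ℕ => p.2) hc (by fun_prop)).congr fun ω p => ?_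
  simp only [Bool.and_eq_true, forallBelow_iff, FirstHit, Bool.not_eq_true']
  exact and_congr_right fun _ => forall₂_congr fun i hi => by rw [take_initSeg _ hi.le]

/-- The least accepted stage would be a first hit, so the absence of first hits below `T` amounts to
rejection at all stages below `T`, which a prefix decides. -/
theorem SemiDec.forall_lt_not (o : Ω → ℕ → ℕ) {R : List ℕ × α × ℕ → Bool} (hR : Computable R) :
    SemiDec o fun ω (p : α × ℕ) => ∀ i < p.2, ¬ FirstHit R (o ω) p.1 i := by
  have hc : Computable fun x : List ℕ × α × ℕ =>
      forallBelow (fun i => !R (x.1.take i, x.2.1, i)) x.2.2 :=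
    computable_forallBelow (f := fun x : List ℕ × α × ℕ => x.2.2)
      (p := fun y => !R (y.1.1.take y.2, y.1.2.1, y.2)) (by fun_prop) (by fun_prop)
  refine (SemiDec.of_initSeg o (k := fun p : α × ℕ => p.2) hc (by fun_prop)).congr fun ω p => ?_
  simp only [forallBelow_iff, Bool.not_eq_true']
  constructor
  · intro H i
    induction i using Nat.strong_induction_on with
    | _ i ih =>
      intro hi
      rw [take_initSeg _ hi.le]
      by_contra hc
      exact H i hi ⟨by simpa using hc, fun j hj => by
        have := ih j hj (hj.trans hi)
        rwa [take_initSeg _ (hj.trans hi).le] at this⟩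
  · intro H i hi hT
    have := H i hi
    rw [take_initSeg _ hi.le, hT.1] at this
    simp at this

/-- Selection: a semidecidable relation with a value for every argument can be uniformised by a
test on initial segments. -/
theorem SemiDec.exists_selector {P : Ω → α × ℕ → Prop} (hP : SemiDec o P) :
    ∃ R : List ℕ × α × ℕ → Bool, Computable R ∧
      (∀ ω a T, R (initSeg (o ω) T, a, T) = true → P ω (a, T.unpair.2)) ∧
      ∀ ω a, (∃ n, P ω (a, n)) → ∃ T, R (initSeg (o ω) T, a, T) = true := by
  obtain ⟨R, hR, H⟩ := hP
  refine ⟨fun x => R (x.1.take x.2.2.unpair.1, (x.2.1, x.2.2.unpair.2), x.2.2.unpair.1),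
    by fun_prop, fun ω a T hT => ?_, fun ω a ⟨n, hn⟩ => ?_⟩
  · dsimp only at hT
    rw [take_initSeg _ (Nat.unpair_left_le _)] at hT
    exact (H _ _).2 ⟨_, hT⟩
  · obtain ⟨w, hw⟩ := (H _ _).1 hn
    refine ⟨Nat.pair w n, ?_⟩
    dsimp only
    rw [take_initSeg _ (Nat.unpair_left_le _)]
    simpa using hw

end SemiDec

/-! ## Real-valued functions that are computable relative to an oracle -/

section CompReal

theorem exists_ratCode_btwn {x y : ℝ} (h : x < y) : ∃ n, x < (ratCode n : ℝ) ∧ (ratCode n : ℝ) < y := by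
  obtain ⟨q, h1, h2⟩ := exists_rat_btwn h
  obtain ⟨n, rfl⟩ := ratCode_surjective q
  exact ⟨n, h1, h2⟩

variable {Ω Ω' : Type*} {α β γ : Type*} [Primcodable α] [Primcodable β] [Primcodable γ]

/-- The function `f` is lower semicomputable relative to the oracle. -/
def LowerReal (o : Ω → ℕ → ℕ) (f : Ω → α → ℝ) : Prop :=
  SemiDec o fun ω (p : α × ℕ) => (ratCode p.2 : ℝ) < f ω p.1

/-- The function `f` is computable relative to the oracle: both its Dedekind cuts are
semidecidable. -/
def CompReal (o : Ω → ℕ → ℕ) (f : Ω → α → ℝ) : Prop :=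
  LowerReal o f ∧ LowerReal o fun ω a => - f ω a

variable {o : Ω → ℕ → ℕ} {f g : Ω → α → ℝ}

theorem LowerReal.congr (hf : LowerReal o f) (h : ∀ ω a, g ω a = f ω a) : LowerReal o g :=
  (funext₂ h : g = f) ▸ hf

theorem CompReal.congr (hf : CompReal o f) (h : ∀ ω a, g ω a = f ω a) : CompReal o g :=
  (funext₂ h : g = f) ▸ hf

theorem LowerReal.comp (hf : LowerReal o f) {c : β → α} (hc : Computable c) :
    LowerReal o fun ω b => f ω (c b) :=
  SemiDec.comp hf (f := fun p : β × ℕ => (c p.1, p.2)) (by fun_prop)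

theorem CompReal.comp (hf : CompReal o f) {c : β → α} (hc : Computable c) :
    CompReal o fun ω b => f ω (c b) := ⟨hf.1.comp hc, hf.2.comp hc⟩

theorem LowerReal.subst {o' : Ω' → ℕ → ℕ} {e : Ω' → γ → Ω} (hf : LowerReal o f)
    (he : Reduces o' o e) : LowerReal o' fun ω' (p : γ × α) => f (e ω' p.1) p.2 :=
  (SemiDec.subst hf he).comp (f := fun p : (γ × α) × ℕ => (p.1.1, (p.1.2, p.2))) (by fun_prop)

theorem CompReal.subst {o' : Ω' → ℕ → ℕ} {e : Ω' → γ → Ω} (hf : CompReal o f)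
    (he : Reduces o' o e) : CompReal o' fun ω' (p : γ × α) => f (e ω' p.1) p.2 :=
  ⟨hf.1.subst he, hf.2.subst he⟩

theorem LowerReal.pullback {o' : Ω' → ℕ → ℕ} {e : Ω' → Ω} (hf : LowerReal o f)
    (he : Reduces o' o fun ω' (_ : Unit) => e ω') : LowerReal o' fun ω' a => f (e ω') a :=
  SemiDec.pullback hf he

theorem CompReal.pullback {o' : Ω' → ℕ → ℕ} {e : Ω' → Ω} (hf : CompReal o f)
    (he : Reduces o' o fun ω' (_ : Unit) => e ω') : CompReal o' fun ω' a => f (e ω') a :=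
  ⟨hf.1.pullback he, hf.2.pullback he⟩

theorem LowerReal.subst_val {f : Ω → α × ℕ → ℝ} (hf : LowerReal o f) {ν : Ω → α → ℕ}
    (hν : SemiDec o fun ω (p : α × ℕ) => ν ω p.1 = p.2) : LowerReal o fun ω a => f ω (a, ν ω a) :=
  SemiDec.subst_val (ν := fun ω (p : α × ℕ) => ν ω p.1)
    (SemiDec.comp hf (f := fun p : (α × ℕ) × ℕ => ((p.1.1, p.2), p.1.2)) (by fun_prop))
    (hν.comp (f := fun p : (α × ℕ) × ℕ => (p.1.1, p.2)) (by fun_prop))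

theorem CompReal.subst_val {f : Ω → α × ℕ → ℝ} (hf : CompReal o f) {ν : Ω → α → ℕ}
    (hν : SemiDec o fun ω (p : α × ℕ) => ν ω p.1 = p.2) : CompReal o fun ω a => f ω (a, ν ω a) :=
  ⟨hf.1.subst_val hν, hf.2.subst_val hν⟩

theorem LowerReal.rat_lt (hf : LowerReal o f) {q : α → ℚ} (hq : RatComputable q) :
    SemiDec o fun ω a => (q a : ℝ) < f ω a := by
  obtain ⟨c, hc, h⟩ := hq
  exact (SemiDec.comp hf (f := fun a => (a, c a)) (by fun_prop)).congr fun ω a => by rw [h]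

theorem LowerReal.lt_rat (hf : LowerReal o fun ω a => - f ω a) {q : α → ℚ}
    (hq : RatComputable q) : SemiDec o fun ω a => f ω a < (q a : ℝ) :=
  (hf.rat_lt hq.neg).congr fun ω a => by push_cast; exact neg_lt_neg_iff.symm

theorem LowerReal.lt (hf : LowerReal o fun ω a => - f ω a) (hg : LowerReal o g) :
    SemiDec o fun ω a => f ω a < g ω a := by
  refine ((hf.comp (c := fun p : α × ℕ => p.1) (by fun_prop)).lt_rat
    (q := fun p => ratCode p.2) (by fun_prop)).and hg |>.ex.congr fun ω a => ?_
  constructor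
  · intro h
    exact exists_ratCode_btwn h
  · rintro ⟨n, h1, h2⟩
    exact h1.trans h2

/-- Suprema of lower semicomputable functions over semidecidable sets. -/
theorem LowerReal.of_sup {A : Ω → α × ℕ → Prop} {g : Ω → α × ℕ → ℝ} (hA : SemiDec o A)
    (hg : LowerReal o g) (h1 : ∀ ω a n, A ω (a, n) → g ω (a, n) ≤ f ω a)
    (h2 : ∀ ω a (q : ℝ), q < f ω a → ∃ n, A ω (a, n) ∧ q < g ω (a, n)) : LowerReal o f := by
  refine (((hA.comp (f := fun p : (α × ℕ) × ℕ => (p.1.1, p.2)) (by fun_prop)).and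
    (SemiDec.comp hg (f := fun p : (α × ℕ) × ℕ => ((p.1.1, p.2), p.1.2)) (by fun_prop))).ex).congr
    fun ω p => ⟨h2 ω p.1 _, ?_⟩
  rintro ⟨n, hn, hlt⟩
  exact hlt.trans_le (h1 _ _ _ hn)

theorem LowerReal.of_rat (o : Ω → ℕ → ℕ) {q : α → ℚ} (hq : RatComputable q) :
    LowerReal o fun _ a => (q a : ℝ) := by
  refine (SemiDec.of_lt o (f := fun p : α × ℕ => ratCode p.2) (g := fun p => q p.1)
    (by fun_prop) (hq.comp (by fun_prop))).congr fun ω p => ?_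
  exact Rat.cast_lt

theorem CompReal.of_rat (o : Ω → ℕ → ℕ) {q : α → ℚ} (hq : RatComputable q) :
    CompReal o fun _ a => (q a : ℝ) :=
  ⟨LowerReal.of_rat o hq, (LowerReal.of_rat o hq.neg).congr fun _ _ => by push_cast; rfl⟩

theorem LowerReal.add (hf : LowerReal o f) (hg : LowerReal o g) :
    LowerReal o fun ω a => f ω a + g ω a := by
  have h1 : SemiDec o fun ω (p : α × ℕ) => (ratCode p.2.unpair.1 : ℝ) < f ω p.1 :=
    SemiDec.comp hf (f := fun p : α × ℕ => (p.1, p.2.unpair.1)) (by fun_prop)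
  have h2 : SemiDec o fun ω (p : α × ℕ) => (ratCode p.2.unpair.2 : ℝ) < g ω p.1 :=
    SemiDec.comp hg (f := fun p : α × ℕ => (p.1, p.2.unpair.2)) (by fun_prop)
  refine LowerReal.of_sup (h1.and h2) (LowerReal.of_rat o
    (q := fun p : α × ℕ => ratCode p.2.unpair.1 + ratCode p.2.unpair.2) (by fun_prop)) ?_ ?_
  · rintro ω a n ⟨h, h'⟩
    push_cast
    exact add_le_add h.le h'.le
  · intro ω a q hq
    obtain ⟨m, h1, h2⟩ := exists_ratCode_btwn
      (show f ω a - (f ω a + g ω a - q) / 2 < f ω a by linarith)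
    obtain ⟨n, h3, h4⟩ := exists_ratCode_btwn
      (show g ω a - (f ω a + g ω a - q) / 2 < g ω a by linarith)
    refine ⟨Nat.pair m n, ⟨by simpa using h2, by simpa using h4⟩, ?_⟩
    simp only [Nat.unpair_pair]
    push_cast
    linarith

theorem LowerReal.max (hf : LowerReal o f) (hg : LowerReal o g) :
    LowerReal o fun ω a => max (f ω a) (g ω a) :=
  (SemiDec.or hf hg).congr fun _ _ => lt_max_iff

theorem LowerReal.min (hf : LowerReal o f) (hg : LowerReal o g) :
    LowerReal o fun ω a => min (f ω a) (g ω a) :=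
  (SemiDec.and hf hg).congr fun _ _ => lt_min_iff

theorem LowerReal.rat_mul (hf : LowerReal o f) {c : α → ℚ} (hc : RatComputable c)
    (hc0 : ∀ a, 0 ≤ c a) : LowerReal o fun ω a => (c a : ℝ) * f ω a := by
  refine LowerReal.of_sup hf (LowerReal.of_rat o (q := fun p : α × ℕ => c p.1 * ratCode p.2)
    ((hc.comp (by fun_prop)).mul (by fun_prop))) ?_ ?_
  · intro ω a n h
    push_cast
    exact mul_le_mul_of_nonneg_left h.le (by exact_mod_cast hc0 a)
  · intro ω a q hq
    have h0 : (0 : ℝ) ≤ c a := by exact_mod_cast hc0 a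
    -- Dividing the gap by `c a + 1` rather than `c a` also covers `c a = 0`.
    obtain ⟨n, h1, h2⟩ := exists_ratCode_btwn
      (show f ω a - (c a * f ω a - q) / (c a + 1) < f ω a by
        have : 0 < (c a * f ω a - q) / (c a + 1) := div_pos (by linarith) (by linarith)
        linarith)
    refine ⟨n, h2, ?_⟩
    push_cast
    have h3 : (c a : ℝ) * ((c a * f ω a - q) / (c a + 1)) < c a * f ω a - q := by
      rw [← mul_div_assoc, div_lt_iff₀ (by linarith)]
      nlinarith
    nlinarith [mul_le_mul_of_nonneg_left h1.le h0]

theorem CompReal.neg (hf : CompReal o f) : CompReal o fun ω a => - f ω a :=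
  ⟨hf.2, hf.1.congr fun _ _ => neg_neg _⟩

theorem CompReal.add (hf : CompReal o f) (hg : CompReal o g) :
    CompReal o fun ω a => f ω a + g ω a :=
  ⟨hf.1.add hg.1, (hf.2.add hg.2).congr fun _ _ => neg_add _ _⟩

theorem CompReal.sub (hf : CompReal o f) (hg : CompReal o g) :
    CompReal o fun ω a => f ω a - g ω a :=
  (hf.add hg.neg).congr fun _ _ => sub_eq_add_neg _ _

theorem CompReal.max (hf : CompReal o f) (hg : CompReal o g) :
    CompReal o fun ω a => max (f ω a) (g ω a) :=
  ⟨hf.1.max hg.1, (hf.2.min hg.2).congr fun _ _ => (min_neg_neg _ _).symm⟩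

theorem CompReal.min (hf : CompReal o f) (hg : CompReal o g) :
    CompReal o fun ω a => min (f ω a) (g ω a) :=
  ⟨hf.1.min hg.1, (hf.2.max hg.2).congr fun _ _ => (max_neg_neg _ _).symm⟩

theorem CompReal.abs (hf : CompReal o f) : CompReal o fun ω a => |f ω a| :=
  (hf.max hf.neg).congr fun _ _ => abs_eq_max_neg

theorem CompReal.rat_mul (hf : CompReal o f) {c : α → ℚ} (hc : RatComputable c) :
    CompReal o fun ω a => (c a : ℝ) * f ω a := by
  -- Write `c = c⁺ - c⁻`: the positive part multiplies lower bounds of `g`, the negative part lower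
  -- bounds of `-g`.
  have key : ∀ {g : Ω → α → ℝ}, CompReal o g → LowerReal o fun ω a => (c a : ℝ) * g ω a := by
    intro g hg
    refine ((hg.1.rat_mul (c := fun a => Max.max (c a) 0) (by fun_prop) fun a =>
      le_max_right _ _).add (hg.2.rat_mul (c := fun a => Max.max (- c a) 0) (by fun_prop) fun a =>
      le_max_right _ _)).congr fun ω a => ?_
    push_cast
    rcases le_total (c a : ℝ) 0 with h | h
    · rw [max_eq_right h, max_eq_left (by linarith)]; ring
    · rw [max_eq_left h, max_eq_right (by linarith)]; ring
  exact ⟨key hf, (key hf.neg).congr fun _ _ => by ring⟩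

/-- Functions with computable approximations of computable accuracy are computable. -/
theorem CompReal.of_approx {A : Ω → α × ℕ → Prop} {g : Ω → α × ℕ → ℝ} {e : α × ℕ → ℚ}
    (hA : SemiDec o A) (hg : CompReal o g) (he : RatComputable e)
    (h1 : ∀ ω a n, A ω (a, n) → |g ω (a, n) - f ω a| ≤ e (a, n))
    (h2 : ∀ ω a (ε : ℝ), 0 < ε → ∃ n, A ω (a, n) ∧ (e (a, n) : ℝ) < ε) : CompReal o f := by
  have key : ∀ {f : Ω → α → ℝ} {g : Ω → α × ℕ → ℝ}, CompReal o g →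
      (∀ ω a n, A ω (a, n) → |g ω (a, n) - f ω a| ≤ e (a, n)) → LowerReal o f := by
    intro f g hg h1
    refine LowerReal.of_sup hA (hg.sub (CompReal.of_rat o he)).1 ?_ ?_
    · intro ω a n h
      have := (abs_le.1 (h1 ω a n h)).2
      linarith
    · intro ω a q hq
      obtain ⟨n, hn, hlt⟩ := h2 ω a ((f ω a - q) / 2) (by linarith)
      refine ⟨n, hn, ?_⟩
      have := (abs_le.1 (h1 ω a n hn)).1
      linarith
  refine ⟨key hg h1, key hg.neg fun ω a n h => ?_⟩
  rw [← abs_neg]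
  convert h1 ω a n h using 2
  ring

/-- A lower bound of the sum is a list of rational lower bounds of its terms; one natural number
codes the list, so it can be searched for. -/
theorem LowerReal.sum_range {f : Ω → α × ℕ → ℝ} (hf : LowerReal o f) :
    LowerReal o fun ω (p : α × ℕ) => ∑ i ∈ Finset.range p.2, f ω (p.1, i) := by
  have hA : SemiDec o fun ω (p : (α × ℕ) × ℕ) => ∀ i < p.1.2,
      (ratCode ((Denumerable.ofNat (List ℕ) p.2).getD i 0) : ℝ) < f ω (p.1.1, i) :=
    (SemiDec.comp hf (f := fun p : ((α × ℕ) × ℕ) × ℕ => ((p.1.1.1, p.2),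
      (Denumerable.ofNat (List ℕ) p.1.2).getD p.2 0)) (by fun_prop)).ball
      (f := fun p : (α × ℕ) × ℕ => p.1.2) (by fun_prop)
  have hg : RatComputable fun p : (α × ℕ) × ℕ => ∑ i ∈ Finset.range p.1.2,
      ratCode ((Denumerable.ofNat (List ℕ) p.2).getD i 0) :=
    RatComputable.sum_range (f := fun x : ((α × ℕ) × ℕ) × ℕ =>
      ratCode ((Denumerable.ofNat (List ℕ) x.1.2).getD x.2 0)) (by fun_prop) (by fun_prop)
  refine LowerReal.of_sup hA (LowerReal.of_rat o hg) ?_ ?_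
  · rintro ω ⟨a, n⟩ L h
    push_cast
    exact Finset.sum_le_sum fun i hi => (h i (Finset.mem_range.1 hi)).le
  · rintro ω ⟨a, n⟩ q hq
    simp only at hq ⊢
    -- Losing `δ` in each of `n` terms must cost less than the gap; the divisor `n + 1` ensures this
    -- and covers `n = 0`.
    set δ := (∑ i ∈ Finset.range n, f ω (a, i) - q) / (n + 1) with hδ
    have hδ0 : 0 < δ := div_pos (by linarith) (by positivity)
    have : ∀ i, ∃ m, f ω (a, i) - δ < (ratCode m : ℝ) ∧ (ratCode m : ℝ) < f ω (a, i) := fun i =>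
      exists_ratCode_btwn (by linarith)
    choose m hm1 hm2 using this
    have hget : ∀ i < n, (Denumerable.ofNat (List ℕ)
        (Encodable.encode (initSeg m n))).getD i 0 = m i := fun i hi => by
      rw [Denumerable.ofNat_encode, getD_initSeg _ hi]
    refine ⟨Encodable.encode (initSeg m n), fun i hi => by rw [hget i hi]; exact hm2 i, ?_⟩
    push_cast
    rw [Finset.sum_congr rfl fun i hi => by rw [hget i (Finset.mem_range.1 hi)]]
    have h3 : ∑ i ∈ Finset.range n, (f ω (a, i) - δ) ≤ ∑ i ∈ Finset.range n, (ratCode (m i) : ℝ) :=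
      Finset.sum_le_sum fun i _ => (hm1 i).le
    rw [Finset.sum_sub_distrib, Finset.sum_const, Finset.card_range, nsmul_eq_mul] at h3
    have h4 : n * δ < ∑ i ∈ Finset.range n, f ω (a, i) - q := by
      rw [hδ, ← mul_div_assoc, div_lt_iff₀ (by positivity)]
      nlinarith
    linarith

theorem CompReal.sum_range {f : Ω → α × ℕ → ℝ} (hf : CompReal o f) :
    CompReal o fun ω (p : α × ℕ) => ∑ i ∈ Finset.range p.2, f ω (p.1, i) :=
  ⟨hf.1.sum_range, hf.2.sum_range.congr fun _ _ => (Finset.sum_neg_distrib _).symm⟩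

theorem exists_mul_half_pow_lt (c : ℝ) {ε : ℝ} (hε : 0 < ε) : ∃ n : ℕ, c * (2 : ℝ)⁻¹ ^ n < ε := by
  rcases le_or_gt c 0 with hc | hc
  · exact ⟨0, lt_of_le_of_lt (by simpa using hc) hε⟩
  · obtain ⟨n, hn⟩ := exists_pow_lt_of_lt_one (div_pos hε hc) (by norm_num : (2 : ℝ)⁻¹ < 1)
    exact ⟨n, by rwa [lt_div_iff₀' hc] at hn⟩

/-- Sums of computable series with geometrically decreasing terms. -/
theorem CompReal.hasSum {g : Ω → α × ℕ → ℝ} (hg : CompReal o g) (c : ℚ)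
    (hb : ∀ ω a i, |g ω (a, i)| ≤ c * (2 : ℝ)⁻¹ ^ i)
    (hs : ∀ ω a, HasSum (fun i => g ω (a, i)) (f ω a)) : CompReal o f := by
  -- The error after `n` terms is the geometric tail `∑_{i ≥ n} c 2^{-i} = 2 c 2^{-n}`.
  refine CompReal.of_approx (A := fun _ _ => True) (e := fun p => 2 * c * (2 : ℚ)⁻¹ ^ p.2)
    ((SemiDec.of_computable o (d := fun _ => true) (by fun_prop)).congr (by simp))
    hg.sum_range (by fun_prop) ?_ ?_
  · intro ω a n _
    have := norm_sub_le_of_geometric_bound_of_hasSum (r := (2 : ℝ)⁻¹) (by norm_num)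
      (fun i => hb ω a i) (hs ω a) n
    rw [Real.norm_eq_abs] at this
    push_cast
    refine this.trans (le_of_eq ?_)
    norm_num
    ring
  · intro ω a ε hε
    obtain ⟨n, hn⟩ := exists_mul_half_pow_lt (2 * c) hε
    exact ⟨n, trivial, by push_cast; exact hn⟩

end CompReal

/-! ## Names -/

section Names

variable {S T : Type*} {α : Type*} [Primcodable α]

/-- The points of `D` together with their Cauchy names. -/
structure NamesOn (P : MetricData S) (D : Set S) where
  /-- the name -/
  name : ℕ → ℕ
  /-- the point -/
  pt : S
  mem : pt ∈ D
  isName : IsCauchyName P name pt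

/-- An index `⟨⟨k, i⟩, v⟩` records a run: the prefix of length `k` is the first on which the machine
answers query `i`, and the answer is `v`. Since the output is a Cauchy name, `ratCode v` is within
`2^{-i}` of the value. -/
theorem CompReal.of_computableMapOn {P : MetricData S} {D : Set S} {f : S → ℝ}
    (hf : ComputableMapOn P realData D f) :
    CompReal (NamesOn.name (P := P) (D := D)) fun ω (_ : Unit) => f ω.pt := by
  obtain ⟨φ, hφ, H⟩ := hf
  have hφ' : Computable fun p : List ℕ × ℕ => φ p.1 p.2 := hφ
  have hφ'' : ∀ {β : Type} [Primcodable β] {u : β → List ℕ} {v : β → ℕ}, Computable u →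
    Computable v → Computable fun b => φ (u b) (v b) := fun hu hv => hφ.comp hu hv
  have hR : Computable fun x : List ℕ × (Unit × ℕ) =>
      decide (φ (x.1.take x.2.2.unpair.1.unpair.1) x.2.2.unpair.1.unpair.2 = some x.2.2.unpair.2) &&
      forallBelow (fun j => decide (φ (x.1.take j) x.2.2.unpair.1.unpair.2 = none))
        x.2.2.unpair.1.unpair.1 := by
    have h1 := computable_forallBelow (f := fun x : List ℕ × (Unit × ℕ) => x.2.2.unpair.1.unpair.1)
      (p := fun y => decide (φ (y.1.1.take y.2) y.1.2.2.unpair.1.unpair.2 = none)) (by fun_prop)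
      (computable_decide_eq_option (hφ'' (by fun_prop) (by fun_prop)) (by fun_prop))
    exact computable_and
      (computable_decide_eq_option (hφ'' (by fun_prop) (by fun_prop)) (by fun_prop)) h1
  have hA := SemiDec.of_initSeg (NamesOn.name (P := P) (D := D)) hR
    (k := fun p : Unit × ℕ => p.2.unpair.1.unpair.1) (by fun_prop)
  refine CompReal.of_approx (g := fun _ p => (ratCode p.2.unpair.2 : ℝ))
    (e := fun p => (2 : ℚ)⁻¹ ^ p.2.unpair.1.unpair.2) hA
    (CompReal.of_rat _ (q := fun p : Unit × ℕ => ratCode p.2.unpair.2) (by fun_prop))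
    (by fun_prop) ?_ ?_
  · rintro ω a n hn
    simp only [Bool.and_eq_true, decide_eq_true_iff, forallBelow_iff] at hn
    obtain ⟨h1, h2⟩ := hn
    rw [take_initSeg _ le_rfl] at h1
    obtain ⟨g, hg, hname⟩ := H ω.pt ω.mem ω.name ω.isName
    obtain ⟨k, hk1, hk2⟩ := hg n.unpair.1.unpair.2
    -- Both runs stop at the first prefix that produces an answer to the same query, so they
    -- coincide.
    have hkn : k = n.unpair.1.unpair.1 := by
      rcases lt_trichotomy k n.unpair.1.unpair.1 with hlt | heq | hlt
      · have := h2 k hlt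
        rw [take_initSeg _ hlt.le, hk1] at this
        simp at this
      · exact heq
      · have := hk2 _ hlt
        rw [h1] at this
        simp at this
    subst hkn
    have hgn : g n.unpair.1.unpair.2 = n.unpair.2 := by
      rw [h1] at hk1
      exact (Option.some.inj hk1).symm
    have hlim : Tendsto (fun j => (ratCode (g j) : ℝ)) atTop (𝓝 (f ω.pt)) := by
      rw [tendsto_iff_dist_tendsto_zero]
      exact hname.2
    have : Tendsto (fun j => |(ratCode (g j) : ℝ) - ratCode n.unpair.2|) atTop
      (𝓝 |f ω.pt - ratCode n.unpair.2|) := (hlim.sub_const _).abs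
    rw [abs_sub_comm]
    push_cast
    refine le_of_tendsto this (eventually_atTop.2 ⟨n.unpair.1.unpair.2, fun j hj => ?_⟩)
    rw [← hgn]
    exact hname.1 _ _ hj
  · intro ω a ε hε
    obtain ⟨i, hi⟩ := exists_mul_half_pow_lt 1 hε
    obtain ⟨g, hg, hname⟩ := H ω.pt ω.mem ω.name ω.isName
    obtain ⟨k, hk1, hk2⟩ := hg i
    refine ⟨Nat.pair (Nat.pair k i) (g i), ?_, ?_⟩
    · simp only [Nat.unpair_pair, Bool.and_eq_true, decide_eq_true_iff, forallBelow_iff]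
      refine ⟨by rwa [take_initSeg _ le_rfl], fun j hj => ?_⟩
      rw [take_initSeg _ hj.le]
      exact hk2 j hj
    · simp only [Nat.unpair_pair]
      push_cast
      linarith

/-- On query `i` the machine reads the prefix length as a search stage and waits for the selector to
accept a rational within `2^{-(i+1)}` of the value. Two such errors sum to `2^{-i}`, which gives the
Cauchy condition. -/
theorem CompReal.computableMapOn {P : MetricData S} {D : Set S} {f : S → ℝ}
    (hf : CompReal (NamesOn.name (P := P) (D := D)) fun ω (_ : Unit) => f ω.pt) :
    ComputableMapOn P realData D f := by
  have hf' := hf.comp (c := fun _ : ℕ × ℕ => ()) (by fun_prop)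
  have hA : SemiDec (NamesOn.name (P := P) (D := D)) fun ω (p : ℕ × ℕ) =>
      f ω.pt < ((ratCode p.2 + (2 : ℚ)⁻¹ ^ (p.1 + 1) : ℚ) : ℝ) ∧
        ((ratCode p.2 - (2 : ℚ)⁻¹ ^ (p.1 + 1) : ℚ) : ℝ) < f ω.pt :=
    (hf'.2.lt_rat (q := fun p : ℕ × ℕ => ratCode p.2 + (2 : ℚ)⁻¹ ^ (p.1 + 1)) (by fun_prop)).and
      (hf'.1.rat_lt (q := fun p : ℕ × ℕ => ratCode p.2 - (2 : ℚ)⁻¹ ^ (p.1 + 1)) (by fun_prop))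
  obtain ⟨R, hR, h1, h2⟩ := hA.exists_selector
  refine ⟨fun σ i => bif R (σ, i, σ.length) then some σ.length.unpair.2 else none, ?_,
    fun x hx h hh => ?_⟩
  · exact (by fun_prop : Computable fun p : List ℕ × ℕ =>
      bif R (p.1, p.2, p.1.length) then some p.1.length.unpair.2 else none)
  · have h3 : ∀ i, ∃ T, FirstHit R h i T := fun i => by
      refine exists_firstHit (h2 ⟨h, x, hx, hh⟩ i ?_)
      obtain ⟨n, hn1, hn2⟩ := exists_ratCode_btwn (show f x - (2 : ℝ)⁻¹ ^ (i + 1) <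
        f x + (2 : ℝ)⁻¹ ^ (i + 1) by
          have : (0 : ℝ) < (2 : ℝ)⁻¹ ^ (i + 1) := by positivity
          linarith)
      refine ⟨n, ?_, ?_⟩ <;> push_cast <;> linarith
    choose T hT using h3
    have h4 : ∀ i, |(ratCode (T i).unpair.2 : ℝ) - f x| ≤ (2 : ℝ)⁻¹ ^ (i + 1) := fun i => by
      obtain ⟨h5, h6⟩ := h1 ⟨h, x, hx, hh⟩ i (T i) (hT i).1
      push_cast at h5 h6
      rw [abs_le]
      constructor <;> linarith
    refine ⟨fun i => (T i).unpair.2, fun i => ⟨T i, ?_, fun j hj => ?_⟩, fun i j hij => ?_, ?_⟩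
    · simp only [length_initSeg, (hT i).1, cond_true]
    · simp only [length_initSeg, (hT i).2 j hj, cond_false]
    · have h5 : (2 : ℝ)⁻¹ ^ (j + 1) ≤ (2 : ℝ)⁻¹ ^ (i + 1) :=
        pow_le_pow_of_le_one (by norm_num) (by norm_num) (by omega)
      have h6 := abs_sub_le (ratCode (T j).unpair.2 : ℝ) (f x) (ratCode (T i).unpair.2)
      have h7 := h4 i
      rw [abs_sub_comm] at h7
      have h8 : (2 : ℝ)⁻¹ ^ (i + 1) + (2 : ℝ)⁻¹ ^ (i + 1) = (2 : ℝ)⁻¹ ^ i := by rw [pow_succ]; ring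
      exact h6.trans (by linarith [h4 j])
    · refine squeeze_zero (fun _ => abs_nonneg _) h4 ?_
      exact (tendsto_pow_atTop_nhds_zero_of_lt_one (by norm_num) (by norm_num)).comp
        (tendsto_add_atTop_nat 1)

end Names

/-! ## Effective metrics -/

section Effective

variable {S T : Type*} {Ω Ω' : Type*} {α β γ : Type*} [Primcodable α] [Primcodable β] [Primcodable γ]

/-- The oracle of the trivial computation. -/
def noOracle : Unit → ℕ → ℕ := fun _ _ => 0

theorem Reduces.noOracle (o : Ω → ℕ → ℕ) :
    Reduces o noOracle fun _ (_ : Unit) => () := ⟨fun _ => 0, by fun_prop, fun _ _ _ => rfl⟩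

theorem CompReal.of_noOracle (o : Ω → ℕ → ℕ) {f : α → ℝ}
    (hf : CompReal noOracle fun _ a => f a) : CompReal o fun _ a => f a :=
  hf.pullback (Reduces.noOracle o)

/-- A (pseudo-)metric with a dense sequence of basic points of uniformly computable distances. -/
structure MetricData.Effective (P : MetricData S) : Prop where
  dist_self : ∀ x, P.dist x x = 0
  dist_comm : ∀ x y, P.dist x y = P.dist y x
  dist_triangle : ∀ x y z, P.dist x z ≤ P.dist x y + P.dist y z
  dense : ∀ x ε, 0 < ε → ∃ n, P.dist (P.pt n) x < ε
  comp_dist : CompReal noOracle fun _ (p : ℕ × ℕ) => P.dist (P.pt p.1) (P.pt p.2)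

namespace MetricData.Effective

variable {P : MetricData S} {Q : MetricData T}

theorem dist_nonneg (hP : P.Effective) (x y : S) : 0 ≤ P.dist x y := by
  have h1 := hP.dist_triangle x y x
  rw [hP.dist_self, hP.dist_comm y x] at h1
  linarith

/-- Let `j` tend to infinity in the Cauchy condition. -/
theorem dist_le_of_isCauchyName (hP : P.Effective) {h : ℕ → ℕ} {y : S}
    (hh : IsCauchyName P h y) (i : ℕ) : P.dist (P.pt (h i)) y ≤ (2 : ℝ)⁻¹ ^ i := by
  have h1 : Tendsto (fun j => (2 : ℝ)⁻¹ ^ i + P.dist (P.pt (h j)) y) atTop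
      (𝓝 ((2 : ℝ)⁻¹ ^ i + 0)) := hh.2.const_add _
  rw [add_zero] at h1
  refine ge_of_tendsto h1 (eventually_atTop.2 ⟨i, fun j hj => ?_⟩)
  have h2 := hP.dist_triangle (P.pt (h i)) (P.pt (h j)) y
  have h3 := hh.1 i j hj
  rw [hP.dist_comm] at h3
  linarith

theorem half_pow_tendsto : Tendsto (fun i : ℕ => (2 : ℝ)⁻¹ ^ i) atTop (𝓝 0) :=
  tendsto_pow_atTop_nhds_zero_of_lt_one (by norm_num) (by norm_num)

theorem half_pow_anti {i j : ℕ} (h : i ≤ j) : (2 : ℝ)⁻¹ ^ j ≤ (2 : ℝ)⁻¹ ^ i :=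
  pow_le_pow_of_le_one (by norm_num) (by norm_num) h

theorem isCauchyName_of_dist_le (hP : P.Effective) {h : ℕ → ℕ} {y : S}
    (hh : ∀ i, P.dist (P.pt (h i)) y ≤ (2 : ℝ)⁻¹ ^ (i + 1)) : IsCauchyName P h y := by
  refine ⟨fun i j hij => ?_, squeeze_zero (fun _ => hP.dist_nonneg _ _) hh
    (half_pow_tendsto.comp (tendsto_add_atTop_nat 1))⟩
  have h1 := hP.dist_triangle (P.pt (h j)) y (P.pt (h i))
  have h2 := hh i
  rw [hP.dist_comm] at h2
  have h3 := hh j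
  have h4 : (2 : ℝ)⁻¹ ^ (j + 1) ≤ (2 : ℝ)⁻¹ ^ (i + 1) := half_pow_anti (by omega)
  have h5 : (2 : ℝ)⁻¹ ^ (i + 1) + (2 : ℝ)⁻¹ ^ (i + 1) = (2 : ℝ)⁻¹ ^ i := by rw [pow_succ]; ring
  linarith

theorem exists_isCauchyName (hP : P.Effective) (y : S) : ∃ h, IsCauchyName P h y := by
  choose h hh using fun i : ℕ => hP.dense y ((2 : ℝ)⁻¹ ^ (i + 1)) (by positivity)
  exact ⟨h, hP.isCauchyName_of_dist_le fun i => (hh i).le⟩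

/-- Distances from basic points are computable from names. -/
theorem comp_dist_name (hP : P.Effective) (D : Set S) :
    CompReal (NamesOn.name (P := P) (D := D)) fun ω c => P.dist (P.pt c) ω.pt := by
  have hd := CompReal.of_noOracle (NamesOn.name (P := P) (D := D)) hP.comp_dist
  refine CompReal.of_approx (A := fun ω (p : ℕ × ℕ) => ω.name p.2.unpair.1 = p.2.unpair.2)
    (e := fun p => (2 : ℚ)⁻¹ ^ p.2.unpair.1) (SemiDec.oracle _ (by fun_prop) (by fun_prop))
    (hd.comp (c := fun p : ℕ × ℕ => (p.1, p.2.unpair.2)) (by fun_prop)) (by fun_prop) ?_ ?_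
  · intro ω c n hn
    dsimp only at hn ⊢
    rw [← hn]
    have h1 := hP.dist_le_of_isCauchyName ω.isName n.unpair.1
    have h2 := hP.dist_triangle (P.pt c) ω.pt (P.pt (ω.name n.unpair.1))
    have h3 := hP.dist_triangle (P.pt c) (P.pt (ω.name n.unpair.1)) ω.pt
    rw [hP.dist_comm ω.pt] at h2
    push_cast
    rw [abs_le]
    constructor <;> linarith
  · intro ω c ε hε
    obtain ⟨i, hi⟩ := exists_mul_half_pow_lt 1 hε
    refine ⟨Nat.pair i (ω.name i), by simp, ?_⟩
    simp only [Nat.unpair_pair]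
    push_cast
    linarith

theorem prod (hP : P.Effective) (hQ : Q.Effective) : (P.prod Q).Effective where
  dist_self x := by simp [MetricData.prod, hP.dist_self, hQ.dist_self]
  dist_comm x y := by simp [MetricData.prod, hP.dist_comm x.1, hQ.dist_comm x.2]
  dist_triangle x y z := by
    refine max_le ((hP.dist_triangle _ y.1 _).trans ?_) ((hQ.dist_triangle _ y.2 _).trans ?_)
    · exact add_le_add (le_max_left _ _) (le_max_left _ _)
    · exact add_le_add (le_max_right _ _) (le_max_right _ _)
  dense x ε hε := by
    obtain ⟨m, hm⟩ := hP.dense x.1 ε hε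
    obtain ⟨n, hn⟩ := hQ.dense x.2 ε hε
    exact ⟨Nat.pair m n, by simpa [MetricData.prod] using ⟨hm, hn⟩⟩
  comp_dist :=
    (hP.comp_dist.comp (c := fun p : ℕ × ℕ => (p.1.unpair.1, p.2.unpair.1)) (by fun_prop)).max
      (hQ.comp_dist.comp (c := fun p : ℕ × ℕ => (p.1.unpair.2, p.2.unpair.2)) (by fun_prop))

end MetricData.Effective

variable {P : MetricData S} {Q : MetricData T}

theorem IsCauchyName.prodMk {g h : ℕ → ℕ} {x : S} {y : T} (hg : IsCauchyName P g x)
    (hh : IsCauchyName Q h y) :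
    IsCauchyName (P.prod Q) (fun i => Nat.pair (g i) (h i)) (x, y) := by
  refine ⟨fun i j hij => ?_, ?_⟩
  · simp only [MetricData.prod, Nat.unpair_pair]
    exact max_le (hg.1 i j hij) (hh.1 i j hij)
  · simpa [MetricData.prod] using hg.2.max hh.2

theorem IsCauchyName.fst (hP : P.Effective) {h : ℕ → ℕ} {z : S × T}
    (hh : IsCauchyName (P.prod Q) h z) : IsCauchyName P (fun i => (h i).unpair.1) z.1 :=
  ⟨fun i j hij => (le_max_left _ _).trans (hh.1 i j hij),
    squeeze_zero (fun _ => hP.dist_nonneg _ _) (fun _ => le_max_left _ _) hh.2⟩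

theorem IsCauchyName.snd (hQ : Q.Effective) {h : ℕ → ℕ} {z : S × T}
    (hh : IsCauchyName (P.prod Q) h z) : IsCauchyName Q (fun i => (h i).unpair.2) z.2 :=
  ⟨fun i j hij => (le_max_right _ _).trans (hh.1 i j hij),
    squeeze_zero (fun _ => hQ.dist_nonneg _ _) (fun _ => le_max_right _ _) hh.2⟩

/-- A pair of oracles as one oracle. -/
def joinOracle (o : Ω → ℕ → ℕ) (o' : Ω' → ℕ → ℕ) (ω : Ω × Ω') (i : ℕ) : ℕ :=
  Nat.pair (o ω.1 i) (o' ω.2 i)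

theorem Reduces.of_pointwise {o : Ω → ℕ → ℕ} {o' : Ω' → ℕ → ℕ} {e : Ω' → γ → Ω}
    {F : γ × ℕ → ℕ} (hF : Computable F) (H : ∀ ω' c i, o (e ω' c) i = F (c, o' ω' i)) :
    Reduces o' o e :=
  ⟨fun x => F (x.1, x.2.2.getD x.2.1 0), by fun_prop, fun ω' c i => by
    rw [H]; dsimp only; rw [getD_initSeg _ (by omega)]⟩

theorem Reduces.joinFst (o : Ω → ℕ → ℕ) (o' : Ω' → ℕ → ℕ) :
    Reduces (joinOracle o o') o fun z (_ : Unit) => z.1 :=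
  Reduces.of_pointwise (F := fun x => x.2.unpair.1) (by fun_prop) (by simp [joinOracle])

theorem Reduces.joinSnd (o : Ω → ℕ → ℕ) (o' : Ω' → ℕ → ℕ) :
    Reduces (joinOracle o o') o' fun z (_ : Unit) => z.2 :=
  Reduces.of_pointwise (F := fun x => x.2.unpair.2) (by fun_prop) (by simp [joinOracle])

/-- A semidecidable family of subsets is the family of unions of a semidecidable family of
basic balls. -/
theorem SemiDec.exists_balls (hP : P.Effective) {o : Ω → ℕ → ℕ} {V : Ω → S → α → Prop}
    (hV : SemiDec (joinOracle o (NamesOn.name (P := P) (D := Set.univ)))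
      fun z a => V z.1 z.2.pt a) :
    ∃ B : Ω → α × (ℕ × ℕ) → Prop, SemiDec o B ∧
      ∀ ω y a, V ω y a ↔ ∃ c M, B ω (a, (c, M)) ∧ P.dist (P.pt c) y < ((M : ℝ) + 1)⁻¹ := by
  obtain ⟨R, hR, HR⟩ := hV
  let σ : ℕ → ℕ → ℕ := fun L i => (Denumerable.ofNat (List ℕ) L).getD i 0
  have hσ : ∀ {δ : Type _} [Primcodable δ] {f g : δ → ℕ}, Computable f → Computable g →
      Computable fun d => σ (f d) (g d) := fun hf hg => by
    show Computable fun d => (Denumerable.ofNat (List ℕ) _).getD _ 0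
    fun_prop
  have hd := CompReal.of_noOracle o hP.comp_dist
  -- the parameters are `((a, (c, M)), L), w`
  have h1 : SemiDec o fun ω (p : ((α × (ℕ × ℕ)) × ℕ) × ℕ) =>
      R ((List.range p.2).map (fun i => Nat.pair (o ω i) (σ p.1.2 i)), p.1.1.1, p.2) = true := by
    have hc : Computable fun x : List ℕ × (((α × (ℕ × ℕ)) × ℕ) × ℕ) =>
        R ((List.range x.2.2).map (fun i => Nat.pair (x.1.getD i 0) (σ x.2.1.2 i)),
          x.2.1.1.1, x.2.2) := by
      have h2 : Computable fun y : (List ℕ × (((α × (ℕ × ℕ)) × ℕ) × ℕ)) × ℕ =>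
        σ y.1.2.1.2 y.2 := hσ (by fun_prop) (by fun_prop)
      have := computable_rangeMap (f := fun x : List ℕ × (((α × (ℕ × ℕ)) × ℕ) × ℕ) => x.2.2)
        (g := fun y => Nat.pair (y.1.1.getD y.2 0) (σ y.1.2.1.2 y.2)) (by fun_prop) (by fun_prop)
      fun_prop
    refine (SemiDec.of_initSeg o hc (k := fun p => p.2) (by fun_prop)).congr fun ω p => ?_
    have key : (List.range p.2).map (fun i => Nat.pair ((initSeg (o ω) p.2).getD i 0) (σ p.1.2 i)) =
        (List.range p.2).map (fun i => Nat.pair (o ω i) (σ p.1.2 i)) :=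
      List.map_congr_left fun i hi => by rw [getD_initSeg _ (List.mem_range.1 hi)]
    dsimp only
    rw [key]
  -- The list coded by `L` satisfies the Cauchy condition strictly; strictness makes this
  -- semidecidable.
  have h2 : SemiDec o fun _ (p : ((α × (ℕ × ℕ)) × ℕ) × ℕ) => ∀ j < p.2, ∀ i < j,
      P.dist (P.pt (σ p.1.2 j)) (P.pt (σ p.1.2 i)) < (((2 : ℚ)⁻¹ ^ i : ℚ) : ℝ) := by
    have hc : Computable fun p : ((((α × (ℕ × ℕ)) × ℕ) × ℕ) × ℕ) × ℕ =>
        (σ p.1.1.1.2 p.1.2, σ p.1.1.1.2 p.2) :=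
      (hσ (by fun_prop) (by fun_prop)).pair (hσ (by fun_prop) (by fun_prop))
    exact (((hd.comp hc).2.lt_rat (q := fun p => (2 : ℚ)⁻¹ ^ p.2) (by fun_prop)).ball
      (f := fun p : (((α × (ℕ × ℕ)) × ℕ) × ℕ) × ℕ => p.2) (by fun_prop)).ball
      (f := fun p : ((α × (ℕ × ℕ)) × ℕ) × ℕ => p.2) (by fun_prop)
  -- Every point closer than `1/(M+1)` to the basic point `c` is then within `2^{-i}` of the `i`-th
  -- listed point, so the accepted list can be extended to a name of it.
  have h3 : SemiDec o fun _ (p : ((α × (ℕ × ℕ)) × ℕ) × ℕ) => ∀ i < p.2,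
      P.dist (P.pt p.1.1.2.1) (P.pt (σ p.1.2 i)) <
        (((2 : ℚ)⁻¹ ^ i - ((p.1.1.2.2 : ℚ) + 1)⁻¹ : ℚ) : ℝ) := by
    have hc : Computable fun p : (((α × (ℕ × ℕ)) × ℕ) × ℕ) × ℕ =>
        (p.1.1.1.2.1, σ p.1.1.2 p.2) :=
      Computable.pair (by fun_prop) (hσ (by fun_prop) (by fun_prop))
    exact ((hd.comp hc).2.lt_rat (q := fun p : (((α × (ℕ × ℕ)) × ℕ) × ℕ) × ℕ =>
      (2 : ℚ)⁻¹ ^ p.2 - ((p.1.1.1.2.2 : ℚ) + 1)⁻¹) (by fun_prop)).ball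
      (f := fun p : ((α × (ℕ × ℕ)) × ℕ) × ℕ => p.2) (by fun_prop)
  refine ⟨_, (h1.and (h2.and h3)).ex.ex, fun ω y a => ⟨fun hy => ?_, ?_⟩⟩
  -- Precision `2^{-(i+2)}`, better than a name needs, makes the inequalities of `h2` and `h3`
  -- strict.
  · choose p hp using fun i : ℕ => hP.dense y ((2 : ℝ)⁻¹ ^ (i + 2)) (by positivity)
    have hname : IsCauchyName P p y := hP.isCauchyName_of_dist_le fun i =>
      (hp i).le.trans (MetricData.Effective.half_pow_anti (by omega))
    obtain ⟨w, hw⟩ := (HR (ω, ⟨p, y, trivial, hname⟩) a).1 hy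
    obtain ⟨M, hM⟩ := exists_nat_one_div_lt (show (0 : ℝ) < (2 : ℝ)⁻¹ ^ (w + 2) by positivity)
    rw [one_div] at hM
    obtain ⟨c, hc⟩ := hP.dense y ((M : ℝ) + 1)⁻¹ (by positivity)
    have hσp : ∀ i < w, σ (Encodable.encode (initSeg p w)) i = p i := fun i hi => by
      show (Denumerable.ofNat (List ℕ) _).getD i 0 = _
      rw [Denumerable.ofNat_encode, getD_initSeg _ hi]
    have hpow : ∀ i : ℕ, (2 : ℝ)⁻¹ ^ i = 4 * (2 : ℝ)⁻¹ ^ (i + 2) := fun i => by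
      rw [pow_succ, pow_succ]; ring
    refine ⟨c, M, ⟨Encodable.encode (initSeg p w), w, ?_, fun j hj i hi => ?_, fun i hi => ?_⟩, hc⟩
    · have key : (List.range w).map (fun i => Nat.pair (o ω i)
          (σ (Encodable.encode (initSeg p w)) i)) =
          (List.range w).map (fun i => Nat.pair (o ω i) (p i)) :=
        List.map_congr_left fun i hi => by rw [hσp i (List.mem_range.1 hi)]
      dsimp only
      rw [key]
      exact hw
    · dsimp only at hj ⊢
      rw [hσp j hj, hσp i (hi.trans hj)]
      have h4 := hP.dist_triangle (P.pt (p j)) y (P.pt (p i))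
      rw [hP.dist_comm y] at h4
      have h5 : (2 : ℝ)⁻¹ ^ (j + 2) ≤ (2 : ℝ)⁻¹ ^ (i + 2) :=
        MetricData.Effective.half_pow_anti (by omega)
      have h6 : (0 : ℝ) < (2 : ℝ)⁻¹ ^ (i + 2) := by positivity
      push_cast
      rw [hpow i]
      linarith [hp i, hp j]
    · dsimp only at hi ⊢
      rw [hσp i hi]
      have h4 := hP.dist_triangle (P.pt c) y (P.pt (p i))
      rw [hP.dist_comm y] at h4
      have h5 : (2 : ℝ)⁻¹ ^ (w + 2) ≤ (2 : ℝ)⁻¹ ^ (i + 2) :=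
        MetricData.Effective.half_pow_anti (by omega)
      have h6 : (0 : ℝ) < (2 : ℝ)⁻¹ ^ (i + 2) := by positivity
      push_cast
      rw [hpow i]
      linarith [hp i]
  · rintro ⟨c, M, ⟨L, w, hw, hL, hc⟩, hy⟩
    dsimp only at hw hL hc
    -- The accepted list is continued by approximations `q` of `y`. The second entry of the minimum,
    -- together with `hc`, keeps them within the Cauchy bound of the listed points.
    choose q hq using fun i : ℕ => hP.dense y (min ((2 : ℝ)⁻¹ ^ (i + 1))
      (((M : ℝ) + 1)⁻¹ - P.dist (P.pt c) y)) (lt_min (by positivity) (by linarith))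
    let p : ℕ → ℕ := fun i => if i < w then σ L i else q i
    have hp1 : ∀ i < w, p i = σ L i := fun i hi => if_pos hi
    have hp2 : ∀ i, w ≤ i → p i = q i := fun i hi => if_neg (not_lt.2 hi)
    have hq1 : ∀ i, P.dist (P.pt (q i)) y < (2 : ℝ)⁻¹ ^ (i + 1) := fun i =>
      (hq i).trans_le (min_le_left _ _)
    have hname : IsCauchyName P p y := by
      refine ⟨fun i j hij => ?_, ?_⟩
      · rcases lt_or_ge j w with hj | hj
        · rw [hp1 i (by omega), hp1 j hj]
          rcases hij.lt_or_eq with hij | rfl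
          · have := hL j hj i hij
            push_cast at this
            exact this.le
          · rw [hP.dist_self]; positivity
        · rw [hp2 j hj]
          rcases lt_or_ge i w with hi | hi
          · rw [hp1 i hi]
            have h4 := hP.dist_triangle (P.pt (q j)) y (P.pt (σ L i))
            have h5 := hP.dist_triangle y (P.pt c) (P.pt (σ L i))
            have h6 := (hq j).trans_le (min_le_right _ _)
            have h7 := hc i hi
            rw [hP.dist_comm y (P.pt c)] at h5
            push_cast at h7
            linarith
          · rw [hp2 i hi]
            have h4 := hP.dist_triangle (P.pt (q j)) y (P.pt (q i))
            rw [hP.dist_comm y] at h4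
            have h5 : (2 : ℝ)⁻¹ ^ (j + 1) ≤ (2 : ℝ)⁻¹ ^ (i + 1) :=
              MetricData.Effective.half_pow_anti (by omega)
            have h6 : (2 : ℝ)⁻¹ ^ (i + 1) + (2 : ℝ)⁻¹ ^ (i + 1) = (2 : ℝ)⁻¹ ^ i := by
              rw [pow_succ]; ring
            linarith [hq1 i, hq1 j]
      · refine squeeze_zero' (.of_forall fun _ => hP.dist_nonneg _ _)
          (eventually_atTop.2 ⟨w, fun j hj => ?_⟩)
          (MetricData.Effective.half_pow_tendsto.comp (tendsto_add_atTop_nat 1))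
        rw [hp2 j hj]
        exact (hq1 j).le
    refine (HR (ω, ⟨p, y, trivial, hname⟩) a).2 ⟨w, ?_⟩
    have key : (List.range w).map (fun i => Nat.pair (o ω i) (p i)) =
        (List.range w).map (fun i => Nat.pair (o ω i) (σ L i)) :=
      List.map_congr_left fun i hi => by rw [hp1 i (List.mem_range.1 hi)]
    rw [← hw, ← key]
    rfl

/-- The index set has to be decidable although the balls are only enumerable. A radius has many
codes, so a certificate `u` is hidden in the code by writing `1/(M+1)` as `(u+1)/((u+1)(M+1))`. -/
theorem isEffectivelyOpen_of_semiDec (hP : P.Effective) {V : Set S}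
    (hV : SemiDec (NamesOn.name (P := P) (D := Set.univ)) fun ω (_ : Unit) => ω.pt ∈ V) :
    IsEffectivelyOpen P V := by
  obtain ⟨B, ⟨R, hR, HR⟩, H⟩ := SemiDec.exists_balls hP (V := fun _ y _ => y ∈ V)
    (hV.pullback (Reduces.joinSnd noOracle NamesOn.name))
  -- Divisibility recovers `M` from the code, and the certificate `u` is then checked; the oracle is
  -- trivial, so its prefix is a list of zeros.
  let d : ℕ → Bool := fun n => Nat.beq ((n.unpair.2.unpair.2 + 1) %
      (n.unpair.2.unpair.1 + 1)) 0 &&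
      R ((List.range n.unpair.2.unpair.1).map (fun _ => 0), ((), (n.unpair.1,
        (n.unpair.2.unpair.2 + 1) / (n.unpair.2.unpair.1 + 1) - 1)), n.unpair.2.unpair.1)
  have hI : Computable d := by
    have := computable_rangeMap (f := fun n : ℕ => n.unpair.2.unpair.1) (g := fun _ => 0)
      (by fun_prop) (by fun_prop)
    fun_prop
  refine ⟨{n | d n = true}, ⟨inferInstanceAs (DecidablePred fun n => d n = true),
    hI.of_eq fun n => by simp⟩, ?_⟩
  ext y
  rw [H () y ()]
  simp only [d, Set.mem_ofPred_eq, Set.mem_iUnion, basicBall, Bool.and_eq_true, Nat.beq_eq,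
    posRatCode, exists_prop]
  constructor
  · rintro ⟨c, M, hB, hy⟩
    obtain ⟨u, hu⟩ := (HR () _).1 hB
    obtain ⟨v, hv⟩ : ∃ v, v + 1 = (u + 1) * (M + 1) :=
      ⟨_, Nat.sub_add_cancel (Nat.mul_pos u.succ_pos M.succ_pos)⟩
    refine ⟨Nat.pair c (Nat.pair u v), ?_, ?_⟩
    · simp only [Nat.unpair_pair, hv]
      refine ⟨Nat.mul_mod_right _ _, ?_⟩
      rw [Nat.mul_div_cancel_left _ u.succ_pos]
      exact hu
    · have h1 : (v : ℝ) + 1 = (u + 1) * (M + 1) := by exact_mod_cast hv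
      simp only [Nat.unpair_pair]
      push_cast
      rw [h1, div_mul_cancel_left₀ (by positivity)]
      exact hy
  · rintro ⟨n, ⟨h1, h2⟩, h3⟩
    obtain ⟨k, hk⟩ := Nat.dvd_of_mod_eq_zero h1
    have hk0 : 0 < k := Nat.pos_of_ne_zero (by rintro rfl; simp at hk)
    rw [hk, Nat.mul_div_cancel_left _ (Nat.succ_pos _)] at h2
    refine ⟨n.unpair.1, k - 1, (HR () _).2 ⟨_, h2⟩, ?_⟩
    have h4 : ((k - 1 : ℕ) : ℝ) + 1 = k := by
      rw [← Nat.cast_succ, Nat.succ_eq_add_one, Nat.sub_add_cancel hk0]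
    have h5 : ((n.unpair.2.unpair.2 : ℕ) : ℝ) + 1 = (n.unpair.2.unpair.1 + 1) * k := by
      exact_mod_cast hk
    push_cast at h3
    rw [h5, div_mul_cancel_left₀ (by positivity)] at h3
    rwa [h4]

theorem IsEffectivelyOpen.semiDec (hP : P.Effective) {V : Set S} (hV : IsEffectivelyOpen P V)
    (D : Set S) :
    SemiDec (NamesOn.name (P := P) (D := D)) fun ω (_ : Unit) => ω.pt ∈ V := by
  obtain ⟨I, ⟨_, hI⟩, rfl⟩ := hV
  have h1 := SemiDec.of_computable (NamesOn.name (P := P) (D := D))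
    (d := fun p : Unit × ℕ => decide (p.2 ∈ I)) (hI.comp Computable.snd)
  have h2 := ((hP.comp_dist_name D).comp (c := fun p : Unit × ℕ => p.2.unpair.1) (by fun_prop)).2.lt_rat
    (q := fun p => posRatCode p.2.unpair.2) (by fun_prop)
  refine (h1.and h2).ex.congr fun ω _ => ?_
  simp [basicBall]

/-- An effectively closed set is the zero set of a nonnegative computable function. -/
theorem IsEffectivelyClosed.exists_compReal (hP : P.Effective) {C : Set S}
    (hC : IsEffectivelyClosed P C) :
    ∃ κ : S → ℝ, (∀ D, CompReal (NamesOn.name (P := P) (D := D)) fun ω (_ : Unit) => κ ω.pt) ∧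
      (∀ y, 0 ≤ κ y) ∧ ∀ y, κ y = 0 ↔ y ∈ C := by
  classical
  obtain ⟨I, ⟨hdec, hI⟩, hCI⟩ := hC
  let c : ℕ → ℚ := fun i => bif decide (i ∈ I) then (2 : ℚ)⁻¹ ^ i else 0
  have hc : RatComputable c := by
    have hI' : Computable fun a => decide (a ∈ I) := hI
    exact RatComputable.bif (c := fun a => decide (a ∈ I)) hI' (by fun_prop) (by fun_prop)
  have hc0 : ∀ i, (0 : ℝ) ≤ c i := fun i => by
    simp only [c]
    cases decide (i ∈ I) <;> simp
  have hc1 : ∀ i, (c i : ℝ) ≤ (2 : ℝ)⁻¹ ^ i := fun i => by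
    simp only [c]
    cases decide (i ∈ I) <;> simp
  -- `t y i` is positive exactly when `y` lies in the `i`-th ball, so the weighted sum over `I`
  -- vanishes exactly off the union of the balls.
  let t : S → ℕ → ℝ := fun y i =>
    max 0 (min 1 ((posRatCode i.unpair.2 : ℝ) - P.dist (P.pt i.unpair.1) y))
  have ht0 : ∀ y i, 0 ≤ t y i := fun y i => le_max_left _ _
  have ht1 : ∀ y i, t y i ≤ 1 := fun y i => max_le zero_le_one (min_le_left _ _)
  have hct : ∀ y i, |c i * t y i| ≤ (2 : ℝ)⁻¹ ^ i := fun y i => by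
    rw [abs_of_nonneg (mul_nonneg (hc0 i) (ht0 y i))]
    exact (mul_le_of_le_one_right (hc0 i) (ht1 y i)).trans (hc1 i)
  have hs : ∀ y, Summable fun i => c i * t y i := fun y =>
    Summable.of_norm_bounded (summable_geometric_of_lt_one (by norm_num) (by norm_num)) (hct y)
  refine ⟨fun y => ∑' i, c i * t y i, fun D => ?_, fun y => tsum_nonneg fun i =>
    mul_nonneg (hc0 i) (ht0 y i), fun y => ?_⟩
  · have h0 := CompReal.of_rat (NamesOn.name (P := P) (D := D)) (q := fun _ : Unit × ℕ => 0)
      (by fun_prop)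
    have h1 := CompReal.of_rat (NamesOn.name (P := P) (D := D)) (q := fun _ : Unit × ℕ => 1)
      (by fun_prop)
    have h2 := CompReal.of_rat (NamesOn.name (P := P) (D := D))
      (q := fun p : Unit × ℕ => (posRatCode p.2.unpair.2 : ℚ)) (by fun_prop)
    have h3 := (hP.comp_dist_name D).comp (c := fun p : Unit × ℕ => p.2.unpair.1) (by fun_prop)
    refine CompReal.hasSum (g := fun ω (p : Unit × ℕ) => c p.2 * t ω.pt p.2) ?_ 1
      (fun ω a i => by simpa using hct ω.pt i) (fun ω a => (hs ω.pt).hasSum)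
    refine ((h0.max (h1.min (h2.sub h3))).rat_mul (c := fun p : Unit × ℕ => c p.2)
      (hc.comp (by fun_prop))).congr fun ω a => ?_
    simp [t]
  · rw [← (hs y).hasSum_iff, hasSum_zero_iff_of_nonneg fun i => mul_nonneg (hc0 i) (ht0 y i),
      funext_iff]
    have hy : y ∈ C ↔ ¬ ∃ i ∈ I, y ∈ basicBall P i := by
      rw [← not_iff_not, not_not, ← Set.mem_compl_iff, hCI]
      simp
    rw [hy]
    push Not
    refine forall_congr' fun i => ?_
    by_cases hi : i ∈ I
    · simp [c, t, hi, basicBall]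
    · simp [c, hi]

end Effective

/-! ## The standard spaces -/

section Standard

theorem natData_effective : natData.Effective where
  dist_self x := by simp [natData]
  dist_comm x y := abs_sub_comm _ _
  dist_triangle x y z := abs_sub_le _ _ _
  dense x ε hε := ⟨x, by simpa [natData] using hε⟩
  comp_dist := (CompReal.of_rat noOracle (q := fun p : ℕ × ℕ => |(p.1 : ℚ) - p.2|)
    (by fun_prop)).congr fun _ p => by simp [natData]

theorem baireData_dist (g h : ℕ → ℕ) :
    baireData.dist g h = (PiNat.dist (E := fun _ => ℕ)).dist g h := by
  by_cases hgh : g = h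
  · rw [hgh, PiNat.dist_self (E := fun _ => ℕ)]
    simp [baireData]
  · rw [PiNat.dist_eq_of_ne (E := fun _ => ℕ) hgh, one_div]
    simp [baireData, hgh]

theorem baireData_dist_le_iff {g h : ℕ → ℕ} {n : ℕ} :
    baireData.dist g h ≤ (2 : ℝ)⁻¹ ^ n ↔ ∀ i < n, g i = h i := by
  rw [baireData_dist, ← one_div, ← PiNat.mem_cylinder_iff_dist_le, PiNat.mem_cylinder_iff]

theorem baireData_le_dist {g h : ℕ → ℕ} {n : ℕ} (hn : g n ≠ h n) :
    (2 : ℝ)⁻¹ ^ n ≤ baireData.dist g h := by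
  have hgh : g ≠ h := fun H => hn (by rw [H])
  simp only [baireData, hgh, if_false]
  refine MetricData.Effective.half_pow_anti (le_of_not_gt fun hlt => hn ?_)
  exact PiNat.apply_eq_of_lt_firstDiff (E := fun _ => ℕ) hlt

theorem baireData_effective : baireData.Effective where
  dist_self x := by simp [baireData]
  dist_comm x y := by simp only [baireData_dist]; exact PiNat.dist_comm _ _
  dist_triangle x y z := by simp only [baireData_dist]; exact PiNat.dist_triangle _ _ _
  dense x ε hε := by
    obtain ⟨n, hn⟩ := exists_mul_half_pow_lt 1 hε
    rw [one_mul] at hn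
    refine ⟨Encodable.encode (initSeg x n), (baireData_dist_le_iff.2 fun i hi => ?_).trans_lt hn⟩
    simp only [baireData, Denumerable.ofNat_encode]
    exact getD_initSeg _ hi 0
  comp_dist := by
    constructor
    -- A rational is below the distance iff it is negative or the sequences differ at some `m` with
    -- the rational below `2^{-m}`.
    · have h1 : SemiDec noOracle fun _ (p : (ℕ × ℕ) × ℕ) => ratCode p.2 < 0 :=
        SemiDec.of_lt _ (by fun_prop) (by fun_prop)
      have h2 : SemiDec noOracle fun _ (p : ((ℕ × ℕ) × ℕ) × ℕ) => ratCode p.1.2 < (2 : ℚ)⁻¹ ^ p.2 :=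
        SemiDec.of_lt _ (by fun_prop) (by fun_prop)
      have h3 : SemiDec noOracle fun _ (p : ((ℕ × ℕ) × ℕ) × ℕ) =>
          (!Nat.beq ((Denumerable.ofNat (List ℕ) p.1.1.1).getD p.2 0)
            ((Denumerable.ofNat (List ℕ) p.1.1.2).getD p.2 0)) = true :=
        SemiDec.of_computable _ (by fun_prop)
      refine (h1.or (h3.and h2).ex).congr fun _ p => ?_
      simp only [Bool.not_eq_true', ← Bool.not_eq_true, Nat.beq_eq]
      constructor
      · intro h
        rcases lt_or_ge (ratCode p.2) 0 with h0 | h0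
        · exact Or.inl h0
        · right
          have h0' : (0 : ℝ) ≤ ratCode p.2 := by exact_mod_cast h0
          have hne : baireData.pt p.1.1 ≠ baireData.pt p.1.2 := fun heq => by
            rw [heq] at h
            simp only [baireData, if_true] at h
            linarith
          refine ⟨PiNat.firstDiff (E := fun _ => ℕ) (baireData.pt p.1.1) (baireData.pt p.1.2),
            PiNat.apply_firstDiff_ne (E := fun _ => ℕ) hne, ?_⟩
          rw [← Rat.cast_lt (K := ℝ)]
          push_cast
          refine h.trans_eq ?_
          rw [baireData] at hne ⊢
          simp only [hne, if_false]
      · rintro (h | ⟨m, hm, h⟩)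
        · exact lt_of_lt_of_le (by exact_mod_cast h)
            ((by simp only [baireData_dist]; exact PiNat.dist_nonneg _ _) :
              0 ≤ baireData.dist (baireData.pt p.1.1) (baireData.pt p.1.2))
        · rw [← Rat.cast_lt (K := ℝ)] at h
          push_cast at h
          exact h.trans_le (baireData_le_dist hm)
    -- For the other cut, an upper bound `2^{-m}` of the distance is certified by agreement on the
    -- first `m` coordinates.
    · have h2 : SemiDec noOracle fun _ (p : ((ℕ × ℕ) × ℕ) × ℕ) =>
          (2 : ℚ)⁻¹ ^ p.2 < - ratCode p.1.2 :=
        SemiDec.of_lt _ (by fun_prop) (by fun_prop)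
      have h3 : SemiDec noOracle fun _ (p : ((ℕ × ℕ) × ℕ) × ℕ) => ∀ i < p.2,
          (Nat.beq ((Denumerable.ofNat (List ℕ) p.1.1.1).getD i 0)
            ((Denumerable.ofNat (List ℕ) p.1.1.2).getD i 0)) = true :=
        SemiDec.ball (P := fun _ (q : (((ℕ × ℕ) × ℕ) × ℕ) × ℕ) =>
          (Nat.beq ((Denumerable.ofNat (List ℕ) q.1.1.1.1).getD q.2 0)
            ((Denumerable.ofNat (List ℕ) q.1.1.1.2).getD q.2 0)) = true)
          (SemiDec.of_computable _ (by fun_prop)) (by fun_prop)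
      refine (h3.and h2).ex.congr fun _ p => ?_
      simp only [Nat.beq_eq]
      have key : ∀ m, (∀ i < m, (Denumerable.ofNat (List ℕ) p.1.1).getD i 0 =
          (Denumerable.ofNat (List ℕ) p.1.2).getD i 0) ↔
          baireData.dist (baireData.pt p.1.1) (baireData.pt p.1.2) ≤ (2 : ℝ)⁻¹ ^ m := fun m =>
        baireData_dist_le_iff.symm
      simp only [key, ← Rat.cast_lt (K := ℝ)]
      push_cast
      constructor
      · intro h
        by_cases heq : baireData.pt p.1.1 = baireData.pt p.1.2
        · rw [heq] at h ⊢
          simp only [baireData, if_true] at h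
          obtain ⟨m, hm⟩ := exists_mul_half_pow_lt 1 (show (0 : ℝ) < - ratCode p.2 by linarith)
          refine ⟨m, ?_, by linarith⟩
          simp only [baireData, if_true]
          positivity
        · rw [baireData] at heq h ⊢
          simp only [heq, if_false] at h ⊢
          exact ⟨_, le_rfl, by linarith⟩
      · rintro ⟨m, h1, h4⟩
        linarith

variable {X : Type*} [MetricSpace X] [CompleteSpace X]

theorem ComputableRealSeq.compReal {u : ℕ → ℝ} (hu : ComputableRealSeq u) :
    CompReal noOracle fun _ n => u n := by
  obtain ⟨g, hg, h⟩ := hu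
  have hg' : Computable fun p : ℕ × ℕ => g p.1 p.2 := hg
  refine CompReal.of_approx (A := fun _ _ => True) (e := fun p => (2 : ℚ)⁻¹ ^ p.2)
    ((SemiDec.of_computable noOracle (d := fun _ => true) (by fun_prop)).congr (by simp))
    (CompReal.of_rat _ (q := fun p : ℕ × ℕ => ratCode (g p.1 p.2)) (by fun_prop)) (by fun_prop)
    (fun _ n i _ => ?_) fun _ _ ε hε => ?_
  · have hlim : Tendsto (fun j => (ratCode (g n j) : ℝ)) atTop (𝓝 (u n)) := by
      rw [tendsto_iff_dist_tendsto_zero]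
      exact (h n).2
    have : Tendsto (fun j => |(ratCode (g n j) : ℝ) - ratCode (g n i)|) atTop
      (𝓝 |u n - ratCode (g n i)|) := (hlim.sub_const _).abs
    rw [abs_sub_comm]
    push_cast
    exact le_of_tendsto this (eventually_atTop.2 ⟨i, fun j hj => (h n).1 _ _ hj⟩)
  · obtain ⟨n, hn⟩ := exists_mul_half_pow_lt 1 hε
    exact ⟨n, trivial, by push_cast; linarith⟩

theorem ComputableMetricSpace.data_effective (𝕏 : ComputableMetricSpace X) :
    𝕏.data.Effective where
  dist_self x := dist_self x
  dist_comm x y := dist_comm x y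
  dist_triangle x y z := dist_triangle x y z
  dense x ε hε := by
    obtain ⟨n, hn⟩ := 𝕏.dense.exists_dist_lt x hε
    exact ⟨n, by rw [dist_comm] at hn; exact hn⟩
  comp_dist := (𝕏.computable_dist.compReal.comp (c := fun p : ℕ × ℕ => Nat.pair p.1 p.2)
    (by fun_prop)).congr fun _ p => by simp [ComputableMetricSpace.data]

end Standard

/-! ## Basic functions -/

section BasicFun

variable {X : Type*} [MetricSpace X] [CompleteSpace X] (𝕏 : ComputableMetricSpace X)

/-- In clamped form, continuity, error bounds and computability follow from those of `max` and
`min`, without case distinctions on the distance. -/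
theorem bump_eq {Y : Type*} [MetricSpace Y] (x y : Y) {r s : ℝ} (hrs : r < s) :
    bump x r s y = max 0 (min 1 ((s - dist x y) / (s - r))) := by
  have h0 : 0 < s - r := by linarith
  rw [bump]
  split_ifs with h1 h2
  · rw [min_eq_left, max_eq_right zero_le_one]
    rw [le_div_iff₀ h0]; linarith
  · rw [min_eq_right, max_eq_right]
    · exact div_nonneg (by linarith) h0.le
    · rw [div_le_iff₀ h0]; linarith
  · rw [max_eq_left]
    exact (min_le_right _ _).trans (div_nonpos_of_nonpos_of_nonneg (by linarith) h0.le)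

theorem posRatCode_pos (n : ℕ) : (0 : ℝ) < posRatCode n := by
  rw [posRatCode]; push_cast; positivity

theorem basicFun_zero (x : X) : basicFun 𝕏 0 x = 1 := by rw [basicFun]

theorem basicFun_bump (m : ℕ) (x : X) : basicFun 𝕏 (4 * m + 1) x =
    max 0 (min 1 (((posRatCode m.unpair.2.unpair.1 : ℝ) + posRatCode m.unpair.2.unpair.2 -
      dist (𝕏.pt m.unpair.1) x) / posRatCode m.unpair.2.unpair.2)) := by
  have h1 : 4 * m % 4 = 0 := by omega
  have h2 : 4 * m / 4 = m := by omega
  rw [basicFun, h1, h2]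
  simp only
  rw [bump_eq _ _ (by linarith [posRatCode_pos m.unpair.2.unpair.2]), add_sub_cancel_left]

theorem basicFun_max (m : ℕ) (x : X) : basicFun 𝕏 (4 * m + 2) x =
    max (basicFun 𝕏 m.unpair.1 x) (basicFun 𝕏 m.unpair.2 x) := by
  have h1 : (4 * m + 1) % 4 = 1 := by omega
  have h2 : (4 * m + 1) / 4 = m := by omega
  rw [basicFun, h1, h2]
  rfl

theorem basicFun_min (m : ℕ) (x : X) : basicFun 𝕏 (4 * m + 3) x =
    min (basicFun 𝕏 m.unpair.1 x) (basicFun 𝕏 m.unpair.2 x) := by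
  have h1 : (4 * m + 2) % 4 = 2 := by omega
  have h2 : (4 * m + 2) / 4 = m := by omega
  rw [basicFun, h1, h2]
  rfl

theorem basicFun_lin (m : ℕ) (x : X) : basicFun 𝕏 (4 * m + 4) x =
    ratCode m.unpair.1.unpair.1 * basicFun 𝕏 m.unpair.2.unpair.1 x +
      ratCode m.unpair.1.unpair.2 * basicFun 𝕏 m.unpair.2.unpair.2 x := by
  have h1 : (4 * m + 3) % 4 = 3 := by omega
  have h2 : (4 * m + 3) / 4 = m := by omega
  rw [basicFun, h1, h2]
  rfl

/-- Induction along the codes of basic functions. -/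
theorem basicFun_induction {C : ℕ → Prop} (h0 : C 0) (h1 : ∀ m, C (4 * m + 1))
    (h2 : ∀ m, C m.unpair.1 → C m.unpair.2 → C (4 * m + 2))
    (h3 : ∀ m, C m.unpair.1 → C m.unpair.2 → C (4 * m + 3))
    (h4 : ∀ m, C m.unpair.2.unpair.1 → C m.unpair.2.unpair.2 → C (4 * m + 4)) (n : ℕ) : C n := by
  induction n using Nat.strong_induction_on with
  | _ n ih =>
    have hl : ∀ m : ℕ, m.unpair.1 ≤ m := Nat.unpair_left_le
    have hr : ∀ m : ℕ, m.unpair.2 ≤ m := Nat.unpair_right_le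
    rcases Nat.eq_zero_or_pos n with rfl | hn
    · exact h0
    obtain ⟨m, hm | hm | hm | hm⟩ : ∃ m, n = 4 * m + 1 ∨ n = 4 * m + 2 ∨ n = 4 * m + 3 ∨
        n = 4 * m + 4 := ⟨(n - 1) / 4, by omega⟩
    · exact hm ▸ h1 m
    · exact hm ▸ h2 m (ih _ (by have := hl m; omega)) (ih _ (by have := hr m; omega))
    · exact hm ▸ h3 m (ih _ (by have := hl m; omega)) (ih _ (by have := hr m; omega))
    · exact hm ▸ h4 m (ih _ (by have := hl m.unpair.2; have := hr m; omega))
        (ih _ (by have := hr m.unpair.2; have := hr m; omega))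

theorem continuous_basicFun (i : ℕ) : Continuous (basicFun 𝕏 i) := by
  induction i using basicFun_induction with
  | h0 => exact continuous_const.congr fun x => (basicFun_zero 𝕏 x).symm
  | h1 m =>
    refine Continuous.congr ?_ fun x => (basicFun_bump 𝕏 m x).symm
    fun_prop
  | h2 m ih1 ih2 => exact (ih1.max ih2).congr fun x => (basicFun_max 𝕏 m x).symm
  | h3 m ih1 ih2 => exact (ih1.min ih2).congr fun x => (basicFun_min 𝕏 m x).symm
  | h4 m ih1 ih2 =>
    refine Continuous.congr ?_ fun x => (basicFun_lin 𝕏 m x).symm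
    fun_prop

theorem exists_bound_basicFun (i : ℕ) : ∃ C, ∀ x, |basicFun 𝕏 i x| ≤ C := by
  induction i using basicFun_induction with
  | h0 => exact ⟨1, fun x => by simp [basicFun_zero]⟩
  | h1 m =>
    refine ⟨1, fun x => ?_⟩
    rw [basicFun_bump, abs_of_nonneg (le_max_left _ _)]
    exact max_le zero_le_one (min_le_left _ _)
  | h2 m ih1 ih2 =>
    obtain ⟨C, hC⟩ := ih1
    obtain ⟨D, hD⟩ := ih2
    exact ⟨max C D, fun x => by
      rw [basicFun_max]; exact abs_max_le_max_abs_abs.trans (max_le_max (hC x) (hD x))⟩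
  | h3 m ih1 ih2 =>
    obtain ⟨C, hC⟩ := ih1
    obtain ⟨D, hD⟩ := ih2
    exact ⟨max C D, fun x => by
      rw [basicFun_min]; exact abs_min_le_max_abs_abs.trans (max_le_max (hC x) (hD x))⟩
  | h4 m ih1 ih2 =>
    obtain ⟨C, hC⟩ := ih1
    obtain ⟨D, hD⟩ := ih2
    refine ⟨|(ratCode m.unpair.1.unpair.1 : ℝ)| * C + |(ratCode m.unpair.1.unpair.2 : ℝ)| * D,
      fun x => ?_⟩
    rw [basicFun_lin]
    refine (abs_add_le _ _).trans ?_
    rw [abs_mul, abs_mul]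
    gcongr
    exacts [hC x, hD x]

theorem integrable_basicFun [MeasurableSpace X] [BorelSpace X] (i : ℕ) (μ : Measure X)
    [IsFiniteMeasure μ] : Integrable (basicFun 𝕏 i) μ := by
  obtain ⟨C, hC⟩ := exists_bound_basicFun 𝕏 i
  exact Integrable.of_bound (continuous_basicFun 𝕏 i).aestronglyMeasurable C
    (.of_forall fun x => hC x)

/-- Definitions by course-of-values recursion are computable. -/
theorem exists_courseOfValues {α : Type*} [Primcodable α] {st : α × List ℕ → ℚ}
    (hst : RatComputable st) : ∃ c : α → ℕ → ℕ, (Computable fun p : α × ℕ => c p.1 p.2) ∧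
      ∀ a n, ratCode (c a n) = st (a, initSeg (c a) n) := by
  obtain ⟨d, hd, h⟩ := hst
  let l : α → ℕ → List ℕ := fun a n => Nat.rec [] (fun _ L => L ++ [d (a, L)]) n
  have hl : Computable fun p : α × ℕ => l p.1 p.2 :=
    computable_natRec (f := fun p : α × ℕ => p.2) (g := fun _ => ([] : List ℕ))
      (h := fun x => x.2.2 ++ [d (x.1.1, x.2.2)]) (by fun_prop) (by fun_prop) (by fun_prop)
  have hlc : ∀ a n, l a n = initSeg (fun i => d (a, l a i)) n := fun a n => by
    induction n with
    | zero => rfl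
    | succ n ih =>
      rw [initSeg_succ, ← ih]
  exact ⟨fun a n => d (a, l a n), by fun_prop, fun a n => by rw [h, ← hlc]⟩

theorem abs_clamp_sub_clamp_le (a b : ℝ) :
    |max 0 (min 1 a) - max 0 (min 1 b)| ≤ |a - b| := by
  refine (abs_max_sub_max_le_max 0 (min 1 a) 0 (min 1 b)).trans ?_
  rw [sub_self, abs_zero, max_eq_right (abs_nonneg _)]
  refine (abs_min_sub_min_le_max 1 a 1 b).trans ?_
  rw [sub_self, abs_zero, max_eq_right (abs_nonneg _)]

/-- Basic functions are uniformly computable. -/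
theorem compReal_basicFun (D : Set X) :
    CompReal (NamesOn.name (P := 𝕏.data) (D := D)) fun ω i => basicFun 𝕏 i ω.pt := by
  obtain ⟨G, hG, hG'⟩ := 𝕏.computable_dist
  have hGc : ∀ {δ : Type} [Primcodable δ] {f g : δ → ℕ}, Computable f → Computable g →
      Computable fun d => G (f d) (g d) := fun hf hg => hG.comp hf hg
  -- parameters `(N, z)`: precision and index of a nearby basic point
  obtain ⟨c, hc, hcs⟩ := exists_courseOfValues (α := ℕ × ℕ) (st := fun x =>
    bif Nat.beq x.2.length 0 then 1 else
    bif Nat.beq ((x.2.length - 1) % 4) 0 then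
      max 0 (min 1 (((posRatCode ((x.2.length - 1) / 4).unpair.2.unpair.1 : ℚ) +
        posRatCode ((x.2.length - 1) / 4).unpair.2.unpair.2 -
        ratCode (G (Nat.pair ((x.2.length - 1) / 4).unpair.1 x.1.2) x.1.1)) /
        posRatCode ((x.2.length - 1) / 4).unpair.2.unpair.2)) else
    bif Nat.beq ((x.2.length - 1) % 4) 1 then
      max (ratCode (x.2.getD ((x.2.length - 1) / 4).unpair.1 0))
        (ratCode (x.2.getD ((x.2.length - 1) / 4).unpair.2 0)) else
    bif Nat.beq ((x.2.length - 1) % 4) 2 then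
      min (ratCode (x.2.getD ((x.2.length - 1) / 4).unpair.1 0))
        (ratCode (x.2.getD ((x.2.length - 1) / 4).unpair.2 0)) else
      ratCode ((x.2.length - 1) / 4).unpair.1.unpair.1 *
        ratCode (x.2.getD ((x.2.length - 1) / 4).unpair.2.unpair.1 0) +
      ratCode ((x.2.length - 1) / 4).unpair.1.unpair.2 *
        ratCode (x.2.getD ((x.2.length - 1) / 4).unpair.2.unpair.2 0)) (by
    have : Computable fun x : (ℕ × ℕ) × List ℕ =>
      G (Nat.pair ((x.2.length - 1) / 4).unpair.1 x.1.2) x.1.1 := hGc (by fun_prop) (by fun_prop)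
    fun_prop)
  -- `l` codes Lipschitz constants by the same recursion; for `max` and `min` the sum of the two
  -- constants is a convenient upper bound.
  obtain ⟨l, hl, hls⟩ := exists_courseOfValues (α := Unit) (st := fun x =>
    bif Nat.beq x.2.length 0 then 0 else
    bif Nat.beq ((x.2.length - 1) % 4) 0 then
      (posRatCode ((x.2.length - 1) / 4).unpair.2.unpair.2 : ℚ)⁻¹ else
    bif Nat.beq ((x.2.length - 1) % 4) 1 then
      ratCode (x.2.getD ((x.2.length - 1) / 4).unpair.1 0) +
        ratCode (x.2.getD ((x.2.length - 1) / 4).unpair.2 0) else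
    bif Nat.beq ((x.2.length - 1) % 4) 2 then
      ratCode (x.2.getD ((x.2.length - 1) / 4).unpair.1 0) +
        ratCode (x.2.getD ((x.2.length - 1) / 4).unpair.2 0) else
      |ratCode ((x.2.length - 1) / 4).unpair.1.unpair.1| *
        ratCode (x.2.getD ((x.2.length - 1) / 4).unpair.2.unpair.1 0) +
      |ratCode ((x.2.length - 1) / 4).unpair.1.unpair.2| *
        ratCode (x.2.getD ((x.2.length - 1) / 4).unpair.2.unpair.2 0)) (by fun_prop)
  -- The factor `2` collects two errors of size `2^{-N}`: from replacing `x` by the basic point `z`,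
  -- and from replacing a distance of basic points by its `N`-th rational approximation.
  have hlp : ∀ i, (0 : ℝ) ≤ ratCode (l () i) ∧ ∀ N z (x : X),
      dist (𝕏.pt z) x ≤ (2 : ℝ)⁻¹ ^ N →
      |(ratCode (c (N, z) i) : ℝ) - basicFun 𝕏 i x| ≤ ratCode (l () i) * (2 * (2 : ℝ)⁻¹ ^ N) := by
    have hlt1 : ∀ m, m.unpair.1 < 4 * m + 2 := fun m => by have := Nat.unpair_left_le m; omega
    have hlt2 : ∀ m, m.unpair.2 < 4 * m + 2 := fun m => by have := Nat.unpair_right_le m; omega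
    have hlt1' : ∀ m, m.unpair.1 < 4 * m + 3 := fun m => by have := Nat.unpair_left_le m; omega
    have hlt2' : ∀ m, m.unpair.2 < 4 * m + 3 := fun m => by have := Nat.unpair_right_le m; omega
    have hlt3 : ∀ m, m.unpair.2.unpair.1 < 4 * m + 4 := fun m => by
      have := Nat.unpair_left_le m.unpair.2; have := Nat.unpair_right_le m; omega
    have hlt4 : ∀ m, m.unpair.2.unpair.2 < 4 * m + 4 := fun m => by
      have := Nat.unpair_right_le m.unpair.2; have := Nat.unpair_right_le m; omega
    have e0 : Nat.beq 0 0 = true := rfl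
    have e1 : ∀ n, Nat.beq (n + 1) 0 = false := fun n => rfl
    have e2 : Nat.beq 2 1 = false := rfl
    have e3 : Nat.beq 3 1 = false := rfl
    have e4 : Nat.beq 3 2 = false := rfl
    have e5 : Nat.beq 1 1 = true := rfl
    have e6 : Nat.beq 2 2 = true := rfl
    intro i
    induction i using basicFun_induction with
    | h0 =>
      rw [hls]
      simp only [length_initSeg, e0, cond_true]
      refine ⟨by simp, fun N z x hx => ?_⟩
      rw [hcs]
      simp only [length_initSeg, e0, cond_true, basicFun_zero]
      simp
    | h1 m =>
      have m1 : (4 * m + 1 - 1) % 4 = 0 := by omega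
      have m2 : (4 * m + 1 - 1) / 4 = m := by omega
      have hp := posRatCode_pos m.unpair.2.unpair.2
      rw [hls]
      simp only [length_initSeg, e0, e1, m1, m2, cond_true, cond_false]
      push_cast
      refine ⟨by positivity, fun N z x hx => ?_⟩
      rw [hcs]
      simp only [length_initSeg, e0, e1, m1, m2, cond_true, cond_false, basicFun_bump]
      push_cast
      refine (abs_clamp_sub_clamp_le _ _).trans ?_
      rw [← sub_div, abs_div, abs_of_pos hp, inv_mul_eq_div]
      gcongr
      rw [sub_sub_sub_cancel_left]
      have hname := hG' (Nat.pair m.unpair.1 z)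
      have hlim : Tendsto (fun j => (ratCode (G (Nat.pair m.unpair.1 z) j) : ℝ)) atTop
          (𝓝 (dist (𝕏.pt m.unpair.1) (𝕏.pt z))) := by
        rw [tendsto_iff_dist_tendsto_zero]
        have h2 := hname.2
        simp only [Nat.unpair_pair] at h2
        exact h2
      have h3 : |dist (𝕏.pt m.unpair.1) (𝕏.pt z) - ratCode (G (Nat.pair m.unpair.1 z) N)|
          ≤ (2 : ℝ)⁻¹ ^ N :=
        le_of_tendsto (hlim.sub_const _).abs
          (eventually_atTop.2 ⟨N, fun j hj => hname.1 _ _ hj⟩)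
      have h4 : |dist (𝕏.pt m.unpair.1) x - dist (𝕏.pt m.unpair.1) (𝕏.pt z)| ≤ (2 : ℝ)⁻¹ ^ N := by
        refine le_trans ?_ hx
        rw [dist_comm _ x, dist_comm _ (𝕏.pt z), dist_comm (𝕏.pt z) x]
        exact abs_dist_sub_le _ _ _
      have := abs_sub_le (dist (𝕏.pt m.unpair.1) x) (dist (𝕏.pt m.unpair.1) (𝕏.pt z))
        (ratCode (G (Nat.pair m.unpair.1 z) N))
      linarith
    | h2 m ih1 ih2 =>
      have m1 : (4 * m + 2 - 1) % 4 = 1 := by omega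
      have m2 : (4 * m + 2 - 1) / 4 = m := by omega
      rw [hls]
      simp only [length_initSeg, e1, e5, m1, m2, cond_true, cond_false,
        getD_initSeg _ (hlt1 m), getD_initSeg _ (hlt2 m)]
      push_cast
      refine ⟨add_nonneg ih1.1 ih2.1, fun N z x hx => ?_⟩
      rw [hcs]
      simp only [length_initSeg, e1, e5, m1, m2, cond_true, cond_false, basicFun_max,
        getD_initSeg _ (hlt1 m), getD_initSeg _ (hlt2 m)]
      push_cast
      refine (abs_max_sub_max_le_max _ _ _ _).trans ?_
      have h1 := ih1.2 N z x hx
      have h2 := ih2.2 N z x hx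
      have hp : (0 : ℝ) ≤ 2 * (2 : ℝ)⁻¹ ^ N := by positivity
      have := mul_nonneg ih1.1 hp
      have := mul_nonneg ih2.1 hp
      rw [add_mul]
      exact max_le (by linarith) (by linarith)
    | h3 m ih1 ih2 =>
      have m1 : (4 * m + 3 - 1) % 4 = 2 := by omega
      have m2 : (4 * m + 3 - 1) / 4 = m := by omega
      rw [hls]
      simp only [length_initSeg, e1, e2, e6, m1, m2, cond_true, cond_false,
        getD_initSeg _ (hlt1' m), getD_initSeg _ (hlt2' m)]
      push_cast
      refine ⟨add_nonneg ih1.1 ih2.1, fun N z x hx => ?_⟩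
      rw [hcs]
      simp only [length_initSeg, e1, e2, e6, m1, m2, cond_true, cond_false, basicFun_min,
        getD_initSeg _ (hlt1' m), getD_initSeg _ (hlt2' m)]
      push_cast
      refine (abs_min_sub_min_le_max _ _ _ _).trans ?_
      have h1 := ih1.2 N z x hx
      have h2 := ih2.2 N z x hx
      have hp : (0 : ℝ) ≤ 2 * (2 : ℝ)⁻¹ ^ N := by positivity
      have := mul_nonneg ih1.1 hp
      have := mul_nonneg ih2.1 hp
      rw [add_mul]
      exact max_le (by linarith) (by linarith)
    | h4 m ih1 ih2 =>
      have m1 : (4 * m + 4 - 1) % 4 = 3 := by omega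
      have m2 : (4 * m + 4 - 1) / 4 = m := by omega
      rw [hls]
      simp only [length_initSeg, e1, e3, e4, m1, m2, cond_false,
        getD_initSeg _ (hlt3 m), getD_initSeg _ (hlt4 m)]
      push_cast
      refine ⟨add_nonneg (mul_nonneg (abs_nonneg _) ih1.1) (mul_nonneg (abs_nonneg _) ih2.1),
        fun N z x hx => ?_⟩
      rw [hcs]
      simp only [length_initSeg, e1, e3, e4, m1, m2, cond_false, basicFun_lin,
        getD_initSeg _ (hlt3 m), getD_initSeg _ (hlt4 m)]
      push_cast
      rw [add_sub_add_comm, ← mul_sub, ← mul_sub, add_mul, mul_assoc, mul_assoc]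
      refine (abs_add_le _ _).trans ?_
      rw [abs_mul, abs_mul]
      exact add_le_add (mul_le_mul_of_nonneg_left (ih1.2 N z x hx) (abs_nonneg _))
        (mul_le_mul_of_nonneg_left (ih2.2 N z x hx) (abs_nonneg _))
  refine CompReal.of_approx (A := fun ω (p : ℕ × ℕ) => ω.name p.2.unpair.1 = p.2.unpair.2)
    (g := fun _ p => (ratCode (c p.2.unpair p.1) : ℝ))
    (e := fun p => ratCode (l () p.1) * (2 * (2 : ℚ)⁻¹ ^ p.2.unpair.1))
    (SemiDec.oracle _ (by fun_prop) (by fun_prop)) (CompReal.of_rat _ (RatComputable.ratCode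
      (hc.comp (by fun_prop : Computable fun p : ℕ × ℕ => (p.2.unpair, p.1))))) ?_ ?_ ?_
  · exact (RatComputable.ratCode (hl.comp (by fun_prop : Computable fun p : ℕ × ℕ =>
      ((), p.1)))).mul (by fun_prop)
  · intro ω i n hn
    dsimp only at hn ⊢
    push_cast
    refine (hlp i).2 n.unpair.1 n.unpair.2 ω.pt ?_
    rw [← hn]
    exact 𝕏.data_effective.dist_le_of_isCauchyName ω.isName _
  · intro ω i ε hε
    obtain ⟨N, hN⟩ := exists_mul_half_pow_lt (ratCode (l () i) * 2) hε
    refine ⟨Nat.pair N (ω.name N), by simp, ?_⟩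
    simp only [Nat.unpair_pair]
    push_cast
    linarith

end BasicFun

/-! ## The space of finite measures -/

/-- Both cuts come from compound interest. For `r < f`, `1 - (1 + r⁺/k)^{-k}` is a lower bound of `1
- e^{-f}`; for `f < r < k`, `1 - (1 - r/k)^k` is an upper bound. Letting `r` tend to `f` and `k` to
infinity makes them sharp. -/
theorem compReal_one_sub_exp_neg {Ω α : Type*} [Primcodable α] {o : Ω → ℕ → ℕ} {f : Ω → α → ℝ}
    (hf : CompReal o f) (h0 : ∀ ω a, 0 ≤ f ω a) :
    CompReal o fun ω a => 1 - Real.exp (-f ω a) := by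
  constructor
  · refine LowerReal.of_sup (A := fun ω (p : α × ℕ) => (ratCode p.2.unpair.1 : ℝ) < f ω p.1)
      (SemiDec.comp hf.1 (f := fun p : α × ℕ => (p.1, p.2.unpair.1)) (by fun_prop))
      (LowerReal.of_rat o (q := fun p : α × ℕ =>
        1 - ((1 + max (ratCode p.2.unpair.1) 0 / ((p.2.unpair.2 + 1 : ℕ) : ℚ)) ^ (p.2.unpair.2 + 1))⁻¹)
        (by fun_prop)) ?_ ?_
    · intro ω a n hn
      dsimp only at hn ⊢
      generalize n.unpair.2 + 1 = k
      have hr : max (ratCode n.unpair.1 : ℝ) 0 ≤ f ω a := max_le hn.le (h0 ω a)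
      have hr0 : 0 ≤ max (ratCode n.unpair.1 : ℝ) 0 := le_max_right _ _
      have h2 : (1 + max (ratCode n.unpair.1 : ℝ) 0 / k) ^ k ≤ Real.exp (f ω a) := by
        refine le_trans ?_ (Real.exp_le_exp.2 hr)
        rcases Nat.eq_zero_or_pos k with rfl | hk
        · simp
        · have h3 : Real.exp (max (ratCode n.unpair.1 : ℝ) 0) =
              Real.exp (max (ratCode n.unpair.1 : ℝ) 0 / k) ^ k := by
            rw [← Real.exp_nat_mul]; congr 1; field_simp
          rw [h3]
          refine pow_le_pow_left₀ (by positivity) ?_ k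
          linarith [Real.add_one_le_exp (max (ratCode n.unpair.1 : ℝ) 0 / k)]
      push_cast
      rw [Real.exp_neg]
      have h4 : (0 : ℝ) < (1 + max (ratCode n.unpair.1 : ℝ) 0 / k) ^ k := by positivity
      linarith [inv_anti₀ h4 h2]
    · intro ω a q hq
      have hcont : ContinuousAt (fun u : ℝ => 1 - (Real.exp (max u 0))⁻¹) (f ω a) := by
        have : ∀ u : ℝ, Real.exp u ≠ 0 := fun u => (Real.exp_pos u).ne'
        fun_prop (disch := simp)
      have h1 : q < 1 - (Real.exp (max (f ω a) 0))⁻¹ := by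
        rwa [max_eq_left (h0 ω a), ← Real.exp_neg]
      obtain ⟨u, hu, hu'⟩ := (((hcont.eventually (lt_mem_nhds h1)).filter_mono
        (nhdsWithin_le_nhds (s := Set.Iio (f ω a)))).and self_mem_nhdsWithin).exists
      obtain ⟨m, hm1, hm2⟩ := exists_ratCode_btwn hu'
      have hmu : q < 1 - (Real.exp (max (ratCode m : ℝ) 0))⁻¹ := by
        refine hu.trans_le ?_
        have h2 := Real.exp_le_exp.2 (max_le_max hm1.le (le_refl (0 : ℝ)))
        linarith [inv_anti₀ (Real.exp_pos _) h2]
      have hlim : Tendsto (fun k : ℕ => 1 - ((1 + max (ratCode m : ℝ) 0 / k) ^ k)⁻¹) atTop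
          (𝓝 (1 - (Real.exp (max (ratCode m : ℝ) 0))⁻¹)) :=
        ((Real.tendsto_one_add_div_pow_exp _).inv₀ (Real.exp_pos _).ne').const_sub _
      obtain ⟨k, hk⟩ := ((hlim.comp (tendsto_add_atTop_nat 1)).eventually
        (lt_mem_nhds hmu)).exists
      refine ⟨Nat.pair m k, by simpa using hm2, ?_⟩
      simp only [Nat.unpair_pair]
      simp only [Function.comp_apply] at hk
      push_cast at hk ⊢
      exact hk
  · have hA : SemiDec o fun ω (p : α × ℕ) => f ω p.1 < (ratCode p.2.unpair.1 : ℝ) ∧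
        ratCode p.2.unpair.1 < ((p.2.unpair.2 + 1 : ℕ) : ℚ) :=
      ((hf.comp (c := fun p : α × ℕ => p.1) (by fun_prop)).2.lt_rat
        (q := fun p => ratCode p.2.unpair.1) (by fun_prop)).and
        (SemiDec.of_lt _ (by fun_prop) (by fun_prop))
    refine LowerReal.of_sup hA (LowerReal.of_rat o (q := fun p : α × ℕ =>
        (1 - ratCode p.2.unpair.1 / ((p.2.unpair.2 + 1 : ℕ) : ℚ)) ^ (p.2.unpair.2 + 1) - 1)
        (by fun_prop)) ?_ ?_
    · rintro ω a n ⟨h1, h2⟩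
      dsimp only at h1 h2 ⊢
      generalize n.unpair.2 + 1 = k at *
      rw [← Rat.cast_lt (K := ℝ)] at h2
      push_cast at h2 ⊢
      have h3 := Real.one_sub_div_pow_le_exp_neg h2.le
      have h4 := Real.exp_le_exp.2 (neg_le_neg h1.le)
      linarith
    · intro ω a q hq
      have hcont : ContinuousAt (fun u : ℝ => Real.exp (-u) - 1) (f ω a) := by fun_prop
      have h1 : q < Real.exp (-f ω a) - 1 := by linarith
      obtain ⟨u, hu, hu'⟩ := (((hcont.eventually (lt_mem_nhds h1)).filter_mono
        (nhdsWithin_le_nhds (s := Set.Ioi (f ω a)))).and self_mem_nhdsWithin).exists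
      obtain ⟨m, hm1, hm2⟩ := exists_ratCode_btwn hu'
      have hmu : q < Real.exp (-(ratCode m : ℝ)) - 1 := by
        refine hu.trans_le ?_
        linarith [Real.exp_le_exp.2 (neg_le_neg hm2.le)]
      have hlim : Tendsto (fun k : ℕ => (1 + -(ratCode m : ℝ) / k) ^ k - 1) atTop
          (𝓝 (Real.exp (-(ratCode m : ℝ)) - 1)) :=
        (Real.tendsto_one_add_div_pow_exp _).sub_const _
      obtain ⟨k, hk, hk'⟩ := (((hlim.comp (tendsto_add_atTop_nat 1)).eventually
        (lt_mem_nhds hmu)).and (eventually_gt_atTop ⌈ratCode m⌉₊)).exists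
      refine ⟨Nat.pair m k, ⟨by simpa using hm1, ?_⟩, ?_⟩
      · simp only [Nat.unpair_pair]
        refine (Nat.le_ceil _).trans_lt ?_
        exact_mod_cast hk'.trans (Nat.lt_succ_self k)
      · simp only [Nat.unpair_pair]
        simp only [Function.comp_apply] at hk
        push_cast at hk ⊢
        rw [neg_div, ← sub_eq_add_neg] at hk
        exact hk

section MeasureSpace

variable {X : Type*} [MetricSpace X] [CompleteSpace X] [MeasurableSpace X]
  (𝕏 : ComputableMetricSpace X)

theorem one_sub_exp_neg_nonneg {x : ℝ} (hx : 0 ≤ x) : 0 ≤ 1 - Real.exp (-x) := by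
  have := Real.exp_le_one_iff.2 (neg_nonpos.2 hx)
  linarith

theorem one_sub_exp_neg_le_one (x : ℝ) : 1 - Real.exp (-x) ≤ 1 := by
  have := Real.exp_pos (-x)
  linarith

theorem measureData_term_nonneg (i : ℕ) (x : ℝ) :
    0 ≤ (2 : ℝ)⁻¹ ^ i * (1 - Real.exp (-|x|)) :=
  mul_nonneg (by positivity) (one_sub_exp_neg_nonneg (abs_nonneg x))

theorem measureData_term_le (i : ℕ) (x : ℝ) :
    (2 : ℝ)⁻¹ ^ i * (1 - Real.exp (-|x|)) ≤ (2 : ℝ)⁻¹ ^ i :=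
  mul_le_of_le_one_right (by positivity) (one_sub_exp_neg_le_one _)

theorem measureData_summable (u : ℕ → ℝ) :
    Summable fun i => (2 : ℝ)⁻¹ ^ i * (1 - Real.exp (-|u i|)) :=
  Summable.of_nonneg_of_le (fun i => measureData_term_nonneg i _)
    (fun i => measureData_term_le i _) (summable_geometric_of_lt_one (by norm_num) (by norm_num))

/-- With `a = e^{-|x|}` and `b = e^{-|y|}` this combines `a b ≤ e^{-|x + y|}` with `(1 - a) (1 - b)
≥ 0`. -/
theorem one_sub_exp_neg_abs_add_le (x y : ℝ) : 1 - Real.exp (-|x + y|) ≤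
    (1 - Real.exp (-|x|)) + (1 - Real.exp (-|y|)) := by
  have h1 : Real.exp (-|x|) * Real.exp (-|y|) ≤ Real.exp (-|x + y|) := by
    rw [← Real.exp_add]
    exact Real.exp_le_exp.2 (by linarith [abs_add_le x y])
  nlinarith [one_sub_exp_neg_nonneg (abs_nonneg x), one_sub_exp_neg_nonneg (abs_nonneg y)]

/-- The first `N` terms are bounded by `1 - e^{-u} ≤ u`, the remaining ones by their weights alone.
This reduces density of the basic measures to finitely many integrals. -/
theorem measureData_dist_le (μ ν : FiniteMeasure X) {η : ℝ} {N : ℕ} (hη : 0 ≤ η)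
    (h : ∀ i < N, |∫ y, basicFun 𝕏 i y ∂(μ : Measure X) - ∫ y, basicFun 𝕏 i y ∂(ν : Measure X)| ≤ η) :
    𝕏.measureData.dist μ ν ≤ 2 * η + 2 * (2 : ℝ)⁻¹ ^ N := by
  rw [ComputableMetricSpace.measureData]
  simp only
  set u : ℕ → ℝ := fun i =>
    ∫ y, basicFun 𝕏 i y ∂(μ : Measure X) - ∫ y, basicFun 𝕏 i y ∂(ν : Measure X) with hu
  have hs := measureData_summable u
  have hg : HasSum (fun i : ℕ => (2 : ℝ)⁻¹ ^ i) 2 := by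
    have := hasSum_geometric_of_lt_one (r := (2 : ℝ)⁻¹) (by norm_num) (by norm_num)
    norm_num at this ⊢
    exact this
  rw [← hs.sum_add_tsum_nat_add N]
  refine add_le_add ?_ ?_
  · calc ∑ i ∈ Finset.range N, (2 : ℝ)⁻¹ ^ i * (1 - Real.exp (-|u i|))
        ≤ ∑ i ∈ Finset.range N, (2 : ℝ)⁻¹ ^ i * η := by
          refine Finset.sum_le_sum fun i hi => ?_
          have h1 := Real.add_one_le_exp (-|u i|)
          have h2 := h i (Finset.mem_range.1 hi)
          exact mul_le_mul_of_nonneg_left (by linarith) (by positivity)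
      _ = (∑ i ∈ Finset.range N, (2 : ℝ)⁻¹ ^ i) * η := by rw [Finset.sum_mul]
      _ ≤ 2 * η := by
          refine mul_le_mul_of_nonneg_right ?_ hη
          exact sum_le_hasSum _ (fun i _ => by positivity) hg
  · have h1 : HasSum (fun i : ℕ => (2 : ℝ)⁻¹ ^ (i + N)) (2 * (2 : ℝ)⁻¹ ^ N) := by
      simpa only [pow_add] using hg.mul_right ((2 : ℝ)⁻¹ ^ N)
    exact hasSum_le (fun i => measureData_term_le _ _)
      ((summable_nat_add_iff N).2 hs).hasSum h1

theorem exists_posRatCode {q : ℚ≥0} (hq : 0 < q) : ∃ n, posRatCode n = q := by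
  refine ⟨Nat.pair (q.num - 1) (q.den - 1), ?_⟩
  have h1 : ((q.num - 1 : ℕ) : ℚ≥0) + 1 = q.num := by
    have := NNRat.num_pos.2 hq
    rw [← Nat.cast_succ, Nat.succ_eq_add_one, Nat.sub_add_cancel this]
  have h2 : ((q.den - 1 : ℕ) : ℚ≥0) + 1 = q.den := by
    have := q.den_pos
    rw [← Nat.cast_succ, Nat.succ_eq_add_one, Nat.sub_add_cancel this]
  rw [posRatCode, Nat.unpair_pair]
  simp only [h1, h2]
  exact NNRat.num_div_den q

theorem exists_pt_add (m n : ℕ) : ∃ k, 𝕏.measureData.pt k = 𝕏.measureData.pt m + 𝕏.measureData.pt n :=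
  ⟨Encodable.encode (Denumerable.ofNat (List ℕ) m ++ Denumerable.ofNat (List ℕ) n), by
    simp [ComputableMetricSpace.measureData]⟩

theorem exists_pt_smul (n : ℕ) {q : ℚ≥0} (hq : 0 < q) :
    ∃ k, 𝕏.measureData.pt k = (q : ℝ≥0) • 𝕏.measureData.pt n := by
  suffices H : ∀ L : List ℕ, ∃ L' : List ℕ,
      (L'.map fun c => (posRatCode c.unpair.1 : ℝ≥0) • diracMeasure (𝕏.pt c.unpair.2)).sum =
      (q : ℝ≥0) • (L.map fun c => (posRatCode c.unpair.1 : ℝ≥0) •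
        diracMeasure (𝕏.pt c.unpair.2)).sum by
    obtain ⟨L', hL'⟩ := H (Denumerable.ofNat (List ℕ) n)
    exact ⟨Encodable.encode L', by simpa [ComputableMetricSpace.measureData] using hL'⟩
  intro L
  induction L with
  | nil => exact ⟨[], by simp⟩
  | cons c L ih =>
    obtain ⟨L', hL'⟩ := ih
    obtain ⟨d, hd⟩ := exists_posRatCode (q := q * posRatCode c.unpair.1)
      (mul_pos hq (by rw [posRatCode]; positivity))
    refine ⟨Nat.pair d c.unpair.2 :: L', ?_⟩
    rw [List.map_cons, List.sum_cons, List.map_cons, List.sum_cons, hL', smul_add, Nat.unpair_pair]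
    simp only [hd, smul_smul]
    push_cast
    rfl

variable [BorelSpace X]

theorem integral_basicFun_pt (n i : ℕ) :
    ∫ y, basicFun 𝕏 i y ∂(𝕏.measureData.pt n : Measure X) =
      ∑ j ∈ Finset.range (Denumerable.ofNat (List ℕ) n).length,
        (posRatCode ((Denumerable.ofNat (List ℕ) n).getD j 0).unpair.1 : ℝ) *
          basicFun 𝕏 i (𝕏.pt ((Denumerable.ofNat (List ℕ) n).getD j 0).unpair.2) := by
  simp only [ComputableMetricSpace.measureData]
  induction Denumerable.ofNat (List ℕ) n with
  | nil => simp
  | cons c L ih =>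
    rw [List.map_cons, List.sum_cons, FiniteMeasure.toMeasure_add, integral_add_measure
      (integrable_basicFun 𝕏 i _) (integrable_basicFun 𝕏 i _), ih, List.length_cons,
      Finset.sum_range_succ', add_comm]
    congr 1
    rw [FiniteMeasure.toMeasure_smul, integral_smul_nnreal_measure]
    simp only [diracMeasure, FiniteMeasure.toMeasure_mk, List.getD_cons_zero]
    rw [integral_dirac' _ _ (continuous_basicFun 𝕏 i).stronglyMeasurable]
    rw [NNReal.smul_def, smul_eq_mul]
    congr 1

theorem compReal_integral_pt : CompReal noOracle fun _ (p : ℕ × ℕ) =>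
    ∫ y, basicFun 𝕏 p.2 y ∂(𝕏.measureData.pt p.1 : Measure X) := by
  -- The constant sequence `z` is a name of the `z`-th basic point, so evaluation at basic points
  -- needs no oracle.
  let e : Unit → ℕ → NamesOn 𝕏.data Set.univ := fun _ z =>
    ⟨fun _ => z, 𝕏.pt z, trivial, fun i j _ => by
      rw [𝕏.data_effective.dist_self]; positivity, by
      simp [ComputableMetricSpace.data]⟩
  have he : Reduces noOracle NamesOn.name e := ⟨fun x => x.1, by fun_prop, fun _ _ _ => rfl⟩
  have h1 := (compReal_basicFun 𝕏 Set.univ).subst he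
  have h2 := ((h1.comp (c := fun p : (ℕ × ℕ) × ℕ =>
    (((Denumerable.ofNat (List ℕ) p.1.1).getD p.2 0).unpair.2, p.1.2)) (by fun_prop)).rat_mul
    (c := fun p => (posRatCode ((Denumerable.ofNat (List ℕ) p.1.1).getD p.2 0).unpair.1 : ℚ))
    (by fun_prop)).sum_range.comp
    (c := fun p : ℕ × ℕ => (p, (Denumerable.ofNat (List ℕ) p.1).length)) (by fun_prop)
  refine h2.congr fun _ p => ?_
  rw [integral_basicFun_pt]
  simp [e]

/-- The integral vectors of basic measures are closed under addition and positive rational scaling,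
so their closure is a closed convex cone. It contains the vectors of all Dirac measures, because the
basic points are dense and basic functions are continuous. The vector of `μ` is the mass of `μ`
times an average of Dirac vectors, and averages remain in a closed convex set. -/
theorem integral_mem_closure_pt (N : ℕ) (μ : FiniteMeasure X) :
    (fun i : Fin N => ∫ y, basicFun 𝕏 i y ∂(μ : Measure X)) ∈
      closure (Set.range fun n => fun i : Fin N =>
        ∫ y, basicFun 𝕏 i y ∂(𝕏.measureData.pt n : Measure X)) := by
  set Φ : FiniteMeasure X → Fin N → ℝ := fun ν i => ∫ y, basicFun 𝕏 i y ∂(ν : Measure X) with hΦ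
  have hΦadd : ∀ ν ρ, Φ (ν + ρ) = Φ ν + Φ ρ := fun ν ρ => by
    funext i
    exact integral_add_measure (integrable_basicFun 𝕏 i _) (integrable_basicFun 𝕏 i _)
  have hΦsmul : ∀ (c : ℝ≥0) ν, Φ (c • ν) = (c : ℝ) • Φ ν := fun c ν => by
    funext i
    exact integral_smul_nnreal_measure _ _
  set A : Set (Fin N → ℝ) := Set.range fun n => Φ (𝕏.measureData.pt n) with hA
  show Φ μ ∈ closure A
  have hadd : ∀ x ∈ closure A, ∀ y ∈ closure A, x + y ∈ closure A := fun x hx y hy =>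
    map_mem_closure₂ continuous_add hx hy (by
      rintro _ ⟨m, rfl⟩ _ ⟨n, rfl⟩
      obtain ⟨k, hk⟩ := exists_pt_add 𝕏 m n
      exact ⟨k, by simp only [hk, hΦadd]⟩)
  have hsmulq : ∀ q : ℚ≥0, 0 < q → ∀ x ∈ closure A, (q : ℝ) • x ∈ closure A := fun q hq x hx =>
    map_mem_closure (f := fun x : Fin N → ℝ => (q : ℝ) • x) (continuous_const_smul _) hx (by
      rintro _ ⟨n, rfl⟩
      obtain ⟨k, hk⟩ := exists_pt_smul 𝕏 n hq
      exact ⟨k, by simp only [hk, hΦsmul]; rfl⟩)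
  have hsmul : ∀ c : ℝ, 0 ≤ c → ∀ x ∈ closure A, c • x ∈ closure A := by
    intro c hc x hx
    have h1 : c ∈ closure {r : ℝ | ∃ q : ℚ≥0, 0 < q ∧ (q : ℝ) = r} := by
      rw [Metric.mem_closure_iff]
      intro ε hε
      obtain ⟨q, hq1, hq2⟩ := exists_rat_btwn (show c < c + ε by linarith)
      have hq0 : (0 : ℝ) < q := hc.trans_lt hq1
      have hq0' : (0 : ℚ) < q := by exact_mod_cast hq0
      refine ⟨q, ⟨⟨q, hq0'.le⟩, by exact_mod_cast hq0', rfl⟩, ?_⟩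
      rw [Real.dist_eq, abs_sub_lt_iff]
      constructor <;> linarith
    have := map_mem_closure (f := fun r : ℝ => r • x) (t := closure A) (by fun_prop) h1 (by
      rintro _ ⟨q, hq, rfl⟩
      exact hsmulq q hq x hx)
    rwa [closure_closure] at this
  have hconv : Convex ℝ (closure A) := fun x hx y hy a b ha hb _ =>
    hadd _ (hsmul a ha x hx) _ (hsmul b hb y hy)
  have hdirac : ∀ x : X, (fun i : Fin N => basicFun 𝕏 i x) ∈ closure A := by
    intro x
    have hx : x ∈ closure (Set.range 𝕏.pt) := 𝕏.dense x
    refine map_mem_closure (f := fun x => fun i : Fin N => basicFun 𝕏 i x)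
      (continuous_pi fun i => continuous_basicFun 𝕏 i) hx ?_
    rintro _ ⟨j, rfl⟩
    obtain ⟨c, hc⟩ := exists_posRatCode (q := 1) one_pos
    refine ⟨Encodable.encode [Nat.pair c j], ?_⟩
    funext i
    simp only [hΦ, integral_basicFun_pt]
    simp [hc]
  -- Averages are convex means only for a nonzero measure; the zero measure is the basic point of
  -- code `0`, the empty sum.
  by_cases hμ : (μ : Measure X) = 0
  · refine subset_closure ⟨0, ?_⟩
    funext i
    simp only [hΦ, integral_basicFun_pt, hμ, integral_zero_measure]
    simp
  · have : NeZero (μ : Measure X) := ⟨hμ⟩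
    have hint : Integrable (fun x => fun i : Fin N => basicFun 𝕏 (i : ℕ) x) (μ : Measure X) :=
      Integrable.of_eval fun i => integrable_basicFun 𝕏 i _
    have hav := hconv.average_mem isClosed_closure (.of_forall hdirac) hint
    have h2 := hsmul ((μ : Measure X).real Set.univ) measureReal_nonneg _ hav
    rw [measure_smul_average] at h2
    convert h2 using 1
    funext i
    exact (eval_integral (f := fun x => fun i : Fin N => basicFun 𝕏 (i : ℕ) x)
      (fun i => integrable_basicFun 𝕏 i _) i).symm

theorem ComputableMetricSpace.measureData_effective : 𝕏.measureData.Effective where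
  dist_self μ := by simp [ComputableMetricSpace.measureData]
  dist_comm μ ν := by simp only [ComputableMetricSpace.measureData, abs_sub_comm]
  dist_triangle μ ν ρ := by
    simp only [ComputableMetricSpace.measureData]
    rw [← (measureData_summable _).tsum_add (measureData_summable _)]
    refine (measureData_summable _).tsum_le_tsum (fun i => ?_)
      ((measureData_summable _).add (measureData_summable _))
    rw [← mul_add]
    refine mul_le_mul_of_nonneg_left ?_ (by positivity)
    refine le_trans (le_of_eq ?_) (one_sub_exp_neg_abs_add_le _ _)
    congr 4
    ring
  dense μ ε hε := by
    obtain ⟨N, hN⟩ := exists_mul_half_pow_lt 2 (half_pos hε)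
    obtain ⟨_, ⟨n, rfl⟩, hn⟩ := Metric.mem_closure_iff.1 (integral_mem_closure_pt 𝕏 N μ) (ε / 4)
      (by linarith)
    refine ⟨n, (measureData_dist_le 𝕏 _ _ (η := ε / 4) (N := N) (by linarith)
      fun i hi => ?_).trans_lt (by linarith)⟩
    rw [dist_comm] at hn
    have h1 := (dist_le_pi_dist _ _ (⟨i, hi⟩ : Fin N)).trans hn.le
    rwa [Real.dist_eq] at h1
  comp_dist := by
    have h1 := compReal_integral_pt 𝕏
    have h2 := (compReal_one_sub_exp_neg ((h1.comp (c := fun p : (ℕ × ℕ) × ℕ => (p.1.1, p.2))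
      (by fun_prop)).sub (h1.comp (c := fun p : (ℕ × ℕ) × ℕ => (p.1.2, p.2)) (by fun_prop))).abs
      (fun _ _ => abs_nonneg _)).rat_mul (c := fun p => (2 : ℚ)⁻¹ ^ p.2) (by fun_prop)
    refine h2.hasSum 1 (fun _ p i => ?_) fun _ p => ?_
    · push_cast
      rw [one_mul, abs_of_nonneg (measureData_term_nonneg i _)]
      exact measureData_term_le i _
    · push_cast
      exact (measureData_summable _).hasSum

/-- Integrals of basic functions are computable from names of the measure. -/
theorem compReal_integral_basicFun (D : Set (FiniteMeasure X)) :
    CompReal (NamesOn.name (P := 𝕏.measureData) (D := D)) fun ω i =>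
      ∫ y, basicFun 𝕏 i y ∂(ω.pt : Measure X) := by
  -- The `i`-th integral enters the metric with weight `2^{-i}`, so precision `2^{-e}` for it
  -- requires reading the name at `i + e + 1`.
  refine CompReal.of_approx (A := fun ω (p : ℕ × ℕ) =>
    ω.name (p.1 + p.2.unpair.1 + 1) = p.2.unpair.2) (e := fun p => (2 : ℚ)⁻¹ ^ p.2.unpair.1)
    (SemiDec.oracle _ (by fun_prop) (by fun_prop))
    ((CompReal.of_noOracle _ (compReal_integral_pt 𝕏)).comp
      (c := fun p : ℕ × ℕ => (p.2.unpair.2, p.1)) (by fun_prop)) (by fun_prop) ?_ ?_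
  · intro ω i n hn
    dsimp only at hn ⊢
    rw [← hn]
    have h1 := 𝕏.measureData_effective.dist_le_of_isCauchyName ω.isName (i + n.unpair.1 + 1)
    generalize n.unpair.1 = e at *
    change (∑' i : ℕ, (2 : ℝ)⁻¹ ^ i * (1 - Real.exp (-|_|))) ≤ _ at h1
    have h2 := ((measureData_summable _).le_tsum i fun j _ => measureData_term_nonneg j _).trans h1
    rw [add_assoc, pow_add] at h2
    have h3 := le_of_mul_le_mul_left h2 (by positivity)
    push_cast
    set x : ℝ := (2 : ℝ)⁻¹ ^ e with hx
    have hx0 : 0 < x := by positivity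
    have hx1 : x ≤ 1 := pow_le_one₀ (by norm_num) (by norm_num)
    rw [pow_succ] at h3
    by_contra hlt
    push Not at hlt
    rw [add_assoc i e 1] at hlt
    have h4 := Real.exp_lt_exp.2 (neg_lt_neg hlt)
    -- Valid for `0 < x ≤ 1`. It turns a bound `x / 2` on `1 - e^{-|u|}` into the bound `x` on
    -- `|u|`; this is the purpose of the extra `+ 1` in the position read.
    have h5 : Real.exp (-x) ≤ 1 - x / 2 := by
      rw [Real.exp_neg]
      have h6 := Real.add_one_le_exp x
      have h7 : (Real.exp x)⁻¹ ≤ (x + 1)⁻¹ := inv_anti₀ (by linarith) h6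
      refine h7.trans ?_
      rw [inv_le_iff_one_le_mul₀ (by linarith)]
      nlinarith
    linarith
  · intro ω i ε hε
    obtain ⟨e, he⟩ := exists_mul_half_pow_lt 1 hε
    refine ⟨Nat.pair e (ω.name (i + e + 1)), by simp, ?_⟩
    simp only [Nat.unpair_pair]
    push_cast
    linarith

end MeasureSpace

/-! ## Lower semicomputable functions with values in `[0, ∞]` -/

section LowerENNReal

variable {Ω Ω' : Type*} {α β : Type*} [Primcodable α] [Primcodable β] {o : Ω → ℕ → ℕ}

/-- `F` is lower semicomputable relative to the oracles `o`. -/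
def LowerENNReal (o : Ω → ℕ → ℕ) (F : Ω → α → ℝ≥0∞) : Prop :=
  SemiDec o fun ω (p : α × ℕ) => ENNReal.ofReal (ratCode p.2) < F ω p.1

theorem LowerENNReal.congr {F G : Ω → α → ℝ≥0∞} (hF : LowerENNReal o F)
    (h : ∀ ω a, G ω a = F ω a) : LowerENNReal o G :=
  SemiDec.congr hF fun ω p => by rw [h]

theorem LowerENNReal.comp {F : Ω → α → ℝ≥0∞} (hF : LowerENNReal o F) {c : β → α}
    (hc : Computable c) : LowerENNReal o fun ω b => F ω (c b) :=
  SemiDec.comp hF (f := fun p : β × ℕ => (c p.1, p.2)) (by fun_prop)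

theorem LowerENNReal.pullback {F : Ω → α → ℝ≥0∞} (hF : LowerENNReal o F) {o' : Ω' → ℕ → ℕ}
    {e : Ω' → Ω} (he : Reduces o' o fun ω' (_ : Unit) => e ω') :
    LowerENNReal o' fun ω' a => F (e ω') a :=
  SemiDec.pullback hF he

theorem lowerENNReal_ofReal {f : Ω → α → ℝ} (hf : LowerReal o f) :
    LowerENNReal o fun ω a => ENNReal.ofReal (f ω a) := by
  refine ((hf.comp (c := Prod.fst) (by fun_prop)).rat_lt
    (q := fun p : α × ℕ => max (ratCode p.2) 0) (by fun_prop)).congr fun ω p => ?_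
  rw [ENNReal.ofReal_lt_ofReal_iff']
  push_cast
  exact max_lt_iff.symm

theorem LowerENNReal.iSup {F : Ω → α × ℕ → ℝ≥0∞} (hF : LowerENNReal o F) :
    LowerENNReal o fun ω a => ⨆ n, F ω (a, n) :=
  (SemiDec.ex (SemiDec.comp hF (f := fun p : (α × ℕ) × ℕ => ((p.1.1, p.2), p.1.2))
    (by fun_prop))).congr fun ω p => lt_iSup_iff

theorem LowerENNReal.exists_lt {F : Ω → α → ℝ≥0∞} (hF : LowerENNReal o F) {q : α → ℚ}
    (hq : RatComputable q) : SemiDec o fun ω a => ENNReal.ofReal (q a) < F ω a := by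
  obtain ⟨k, hk, hqk⟩ := hq
  exact (SemiDec.comp hF (f := fun a => (a, k a)) (by fun_prop)).congr fun ω a => by simp [hqk]

theorem SemiDec.val_initSeg (o : Ω → ℕ → ℕ) {code : List ℕ × α → ℕ} (hcode : Computable code) :
    SemiDec o fun ω (p : (α × ℕ) × ℕ) => code (initSeg (o ω) p.1.2, p.1.1) = p.2 :=
  (SemiDec.of_initSeg o (R := fun x => Nat.beq (code (x.1, x.2.1.1)) x.2.2) (k := fun p => p.1.2)
    (by fun_prop) (by fun_prop)).congr fun ω a => by rw [Nat.beq_eq]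

end LowerENNReal

-- Approximation of lower semicomputable functions by basic functions, and their integrals

section Approximation

variable {X : Type*} [MetricSpace X] [CompleteSpace X] (𝕏 : ComputableMetricSpace X)
variable {Ω : Type*} {α β : Type*} [Primcodable α] [Primcodable β] {o : Ω → ℕ → ℕ}

/-- Codes of maxima of `0` and rational multiples of bump functions. -/
theorem exists_maxCode {d : β × ℕ → Bool} (hd : Computable d) :
    ∃ code : β × ℕ → ℕ, Computable code ∧ ∀ b n x B, basicFun 𝕏 (code (b, n)) x ≤ B ↔
      0 ≤ B ∧ ∀ v < n, d (b, v) = true →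
        ratCode v.unpair.1 * basicFun 𝕏 (4 * v.unpair.2 + 1) x ≤ B := by
  -- A multiple of a bump function is coded as a linear combination whose second coefficient is
  -- `ratCode 0 = 0`.
  let step : ℕ → ℕ → ℕ := fun c v => 4 * Nat.pair c (4 * Nat.pair (Nat.pair v.unpair.1 0)
    (Nat.pair (4 * v.unpair.2 + 1) 0) + 4) + 2
  -- Code `4` is the linear combination with both coefficients `ratCode 0 = 0`, that is, the zero
  -- function.
  let code : β × ℕ → ℕ := fun p => Nat.rec 4 (fun v c => bif d (p.1, v) then step c v else c) p.2
  refine ⟨code, ?_, fun b n x B => ?_⟩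
  · refine computable_natRec (f := fun p : β × ℕ => p.2) (g := fun _ => 4)
      (h := fun y : (β × ℕ) × ℕ × ℕ => bif d (y.1.1, y.2.1) then step y.2.2 y.2.1 else y.2.2) ?_ ?_ ?_
    · fun_prop
    · fun_prop
    · show Computable fun y : (β × ℕ) × ℕ × ℕ => bif d (y.1.1, y.2.1) then 4 * Nat.pair _ _ + 2 else _
      fun_prop
  · have h0 : (ratCode 0 : ℝ) = 0 := by simp [ratCode]
    have hstep : ∀ c v, basicFun 𝕏 (step c v) x = max (basicFun 𝕏 c x)
        (ratCode v.unpair.1 * basicFun 𝕏 (4 * v.unpair.2 + 1) x) := fun c v => by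
      simp only [step, basicFun_max, Nat.unpair_pair, basicFun_lin, h0, zero_mul, add_zero]
    induction n with
    | zero =>
      have : basicFun 𝕏 4 x = 0 := by
        have := basicFun_lin 𝕏 0 x
        simpa [h0] using this
      simp [code, this]
    | succ n ih =>
      have hs : code (b, n + 1) = bif d (b, n) then step (code (b, n)) n else code (b, n) := rfl
      rw [hs]
      simp only [Nat.lt_succ_iff_lt_or_eq, or_imp, forall_and, forall_eq]
      cases hdn : d (b, n) with
      | false => simp [ih]
      | true =>
        rw [cond_true, hstep]
        refine (max_le_iff.trans (and_congr_left' ih)).trans ?_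
        rw [and_assoc]
        simp

/-- Lower semicomputable functions are suprema of increasing sequences of basic functions, computed
from longer and longer initial segments of the oracle. -/
theorem LowerENNReal.exists_basicFun {F : Ω → X → α → ℝ≥0∞}
    (hF : LowerENNReal (joinOracle o (NamesOn.name (P := 𝕏.data) (D := Set.univ)))
      fun z a => F z.1 z.2.pt a) :
    ∃ code : List ℕ × α → ℕ, Computable code ∧
      (∀ σ a x, 0 ≤ basicFun 𝕏 (code (σ, a)) x) ∧
      (∀ h a x, Monotone fun s => basicFun 𝕏 (code (initSeg h s, a)) x) ∧
      ∀ ω a x, ⨆ s, ENNReal.ofReal (basicFun 𝕏 (code (initSeg (o ω) s, a)) x) = F ω x a := by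
  obtain ⟨B, hB, HB⟩ := SemiDec.exists_balls 𝕏.data_effective
    (V := fun ω y (p : α × ℕ) => ENNReal.ofReal (ratCode p.2) < F ω y p.1) hF
  -- `p.2 = ⟨n, c, i, j⟩` proposes `ratCode n` times the bump at `c` with inner radius coded by `i`
  -- and width by `j`. It is admissible when it is supported in a ball on which `F` is certified to
  -- exceed `ratCode n`.
  have h1 : SemiDec o fun ω (p : α × ℕ) => ∃ M, B ω ((p.1, p.2.unpair.1), (p.2.unpair.2.unpair.1, M)) ∧
      (posRatCode p.2.unpair.2.unpair.2.unpair.1 : ℚ) + posRatCode p.2.unpair.2.unpair.2.unpair.2 <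
        ((M : ℚ) + 1)⁻¹ :=
    SemiDec.ex (P := fun ω (p : (α × ℕ) × ℕ) =>
      B ω ((p.1.1, p.1.2.unpair.1), (p.1.2.unpair.2.unpair.1, p.2)) ∧
      (posRatCode p.1.2.unpair.2.unpair.2.unpair.1 : ℚ) +
        posRatCode p.1.2.unpair.2.unpair.2.unpair.2 < ((p.2 : ℚ) + 1)⁻¹)
      ((hB.comp (f := fun p : (α × ℕ) × ℕ =>
        ((p.1.1, p.1.2.unpair.1), (p.1.2.unpair.2.unpair.1, p.2))) (by fun_prop)).and
        (SemiDec.of_lt _ (by fun_prop) (by fun_prop)))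
  obtain ⟨R, hR, HR, mono⟩ := h1.exists_monotone
  obtain ⟨code, hcode, Hcode⟩ := exists_maxCode 𝕏
    (d := fun p : (List ℕ × α) × ℕ => R (p.1.1, (p.1.2, p.2), p.1.1.length)) (by fun_prop)
  refine ⟨fun p => code (p, p.1.length), by fun_prop, fun σ a x => ?_, fun h a x s s' hss' => ?_,
    fun ω a x => le_antisymm (iSup_le fun s => ?_) (le_of_forall_lt fun b hb => ?_)⟩
  · exact ((Hcode (σ, a) σ.length x _).1 le_rfl).1
  · refine (Hcode _ _ x _).2 ⟨((Hcode _ _ x _).1 le_rfl).1, fun v hv hd => ?_⟩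
    simp only [length_initSeg] at hv hd ⊢
    refine ((Hcode _ _ x _).1 le_rfl).2 v (hv.trans_le hss') ?_
    simp only [length_initSeg]
    exact mono _ _ _ _ hss' hd
  · rcases eq_or_ne (F ω x a) ∞ with hF | hF
    · rw [hF]; exact le_top
    refine ENNReal.ofReal_le_of_le_toReal ((Hcode _ _ x _).2 ⟨ENNReal.toReal_nonneg,
      fun v hv hd => ?_⟩)
    simp only [length_initSeg] at hv hd
    obtain ⟨M, hM, hrs⟩ := (HR _ _).2 ⟨s, hd⟩
    rw [basicFun_bump]
    rw [← Rat.cast_lt (K := ℝ)] at hrs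
    push_cast at hrs
    by_cases hx : dist (𝕏.pt v.unpair.2.unpair.1) x < ((M : ℝ) + 1)⁻¹
    · have h2 := (HB ω x (a, v.unpair.1)).2 ⟨_, M, hM, hx⟩
      have h3 : (ratCode v.unpair.1 : ℝ) ≤ (F ω x a).toReal := by
        by_contra hlt
        push Not at hlt
        have := ENNReal.ofReal_le_ofReal hlt.le
        rw [ENNReal.ofReal_toReal hF] at this
        exact absurd h2 (not_lt.2 this)
      have h4 := le_max_left (0 : ℝ) (min 1 (((posRatCode v.unpair.2.unpair.2.unpair.1 : ℝ) +
        posRatCode v.unpair.2.unpair.2.unpair.2 - dist (𝕏.pt v.unpair.2.unpair.1) x) /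
          posRatCode v.unpair.2.unpair.2.unpair.2))
      have h5 := max_le zero_le_one (min_le_left (1 : ℝ)
        (((posRatCode v.unpair.2.unpair.2.unpair.1 : ℝ) +
        posRatCode v.unpair.2.unpair.2.unpair.2 - dist (𝕏.pt v.unpair.2.unpair.1) x) /
          posRatCode v.unpair.2.unpair.2.unpair.2))
      refine (mul_le_mul_of_nonneg_right h3 h4).trans (mul_le_of_le_one_right ENNReal.toReal_nonneg h5)
    · rw [max_eq_left, mul_zero]
      · exact ENNReal.toReal_nonneg
      · refine (min_le_right _ _).trans (div_nonpos_of_nonpos_of_nonneg ?_ (posRatCode_pos _).le)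
        linarith
  · obtain ⟨q, -, hq1, hq2⟩ := ENNReal.lt_iff_exists_rat_btwn.1 hb
    obtain ⟨n, rfl⟩ := ratCode_surjective q
    obtain ⟨c, M, hM, hx⟩ := (HB ω x (a, n)).1 hq2
    change dist (𝕏.pt c) x < _ at hx
    obtain ⟨r, hr1, hr2⟩ := exists_rat_btwn hx
    obtain ⟨s, hs1, hs2⟩ := exists_rat_btwn (show (0 : ℝ) < ((M : ℝ) + 1)⁻¹ - r by linarith)
    have hr0 : (0 : ℚ) < r := by exact_mod_cast dist_nonneg.trans_lt hr1
    have hs0 : (0 : ℚ) < s := by exact_mod_cast hs1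
    obtain ⟨i, hi⟩ := exists_posRatCode (q := ⟨r, hr0.le⟩) hr0
    obtain ⟨j, hj⟩ := exists_posRatCode (q := ⟨s, hs0.le⟩) hs0
    have hi' : (posRatCode i : ℚ) = r := by rw [hi]; rfl
    have hj' : (posRatCode j : ℚ) = s := by rw [hj]; rfl
    have hi'' : (posRatCode i : ℝ) = r := by rw [← hi']; norm_cast
    have hj'' : (posRatCode j : ℝ) = s := by rw [← hj']; norm_cast
    obtain ⟨w, hw⟩ := (HR ω (a, Nat.pair n (Nat.pair c (Nat.pair i j)))).1 ⟨M, by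
      simp only [Nat.unpair_pair, hi', hj']
      refine ⟨hM, ?_⟩
      rw [← Rat.cast_lt (K := ℝ)]
      push_cast
      linarith⟩
    -- The stage must reach the certificate `w` and also exceed the code of the bump, because only
    -- codes below the stage enter the maximum.
    refine hq1.trans_le (le_trans ?_ (le_iSup _ (max w (Nat.pair n (Nat.pair c (Nat.pair i j)) + 1))))
    have h2 := ((Hcode (initSeg (o ω) (max w (Nat.pair n (Nat.pair c (Nat.pair i j)) + 1)), a)
      (max w (Nat.pair n (Nat.pair c (Nat.pair i j)) + 1)) x _).1 le_rfl).2
      (Nat.pair n (Nat.pair c (Nat.pair i j))) (by omega) (by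
        simp only [length_initSeg]
        exact mono _ _ _ _ (le_max_left _ _) hw)
    rw [basicFun_bump] at h2
    simp only [Nat.unpair_pair, hi'', hj''] at h2
    rw [min_eq_left, max_eq_right zero_le_one, mul_one] at h2
    · simp only [length_initSeg]
      exact ENNReal.ofReal_le_ofReal h2
    · rw [one_le_div (by linarith)]
      linarith

theorem measurable_of_iSup_basicFun [MeasurableSpace X] [BorelSpace X] {c : ℕ → ℕ} {F : X → ℝ≥0∞}
    (hc : ∀ x, ⨆ s, ENNReal.ofReal (basicFun 𝕏 (c s) x) = F x) : Measurable F := by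
  have : F = fun x => ⨆ s, ENNReal.ofReal (basicFun 𝕏 (c s) x) := funext fun x => (hc x).symm
  rw [this]
  exact Measurable.iSup fun s => (continuous_basicFun 𝕏 _).measurable.ennreal_ofReal

theorem iSup_ofReal_integral_basicFun [MeasurableSpace X] [BorelSpace X] {c : ℕ → ℕ} {F : X → ℝ≥0∞}
    (hc0 : ∀ s x, 0 ≤ basicFun 𝕏 (c s) x) (hmono : ∀ x, Monotone fun s => basicFun 𝕏 (c s) x)
    (hc : ∀ x, ⨆ s, ENNReal.ofReal (basicFun 𝕏 (c s) x) = F x) (μ : Measure X) [IsFiniteMeasure μ] :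
    ⨆ s, ENNReal.ofReal (∫ x, basicFun 𝕏 (c s) x ∂μ) = ∫⁻ x, F x ∂μ := by
  have h1 : ∀ s, ENNReal.ofReal (∫ x, basicFun 𝕏 (c s) x ∂μ) =
      ∫⁻ x, ENNReal.ofReal (basicFun 𝕏 (c s) x) ∂μ := fun s =>
    ofReal_integral_eq_lintegral_ofReal (integrable_basicFun 𝕏 _ _) (.of_forall (hc0 s))
  simp only [h1, ← hc]
  exact (lintegral_iSup (fun s => (continuous_basicFun 𝕏 _).measurable.ennreal_ofReal)
    fun s s' hss' x => ENNReal.ofReal_le_ofReal (hmono x hss')).symm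

/-- Integrals of lower semicomputable functions are lower semicomputable. -/
theorem LowerENNReal.lintegral [MeasurableSpace X] [BorelSpace X] {μ : Ω → FiniteMeasure X}
    (hμ : CompReal o fun ω i => ∫ x, basicFun 𝕏 i x ∂(μ ω : Measure X)) {F : Ω → X → α → ℝ≥0∞}
    (hF : LowerENNReal (joinOracle o (NamesOn.name (P := 𝕏.data) (D := Set.univ)))
      fun z a => F z.1 z.2.pt a) :
    (∀ ω a, Measurable fun x => F ω x a) ∧
      LowerENNReal o fun ω a => ∫⁻ x, F ω x a ∂(μ ω : Measure X) := by
  obtain ⟨code, hcode, h0, hmono, hsup⟩ := hF.exists_basicFun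
  refine ⟨fun ω a => measurable_of_iSup_basicFun 𝕏 (hsup ω a), ?_⟩
  have h1 := (hμ.1.comp (c := fun p : (α × ℕ) × ℕ => p.2) (by fun_prop)).subst_val
    (ν := fun ω (p : α × ℕ) => code (initSeg (o ω) p.2, p.1)) (SemiDec.val_initSeg o hcode)
  exact (lowerENNReal_ofReal h1).iSup.congr fun ω a =>
    (iSup_ofReal_integral_basicFun 𝕏 (fun s => h0 _ _) (hmono _ _) (hsup ω a) _).symm

end Approximation

/-! ## Translations between names -/

section Names

variable {S T : Type*} {P : MetricData S} {Q : MetricData T}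

/-- The name of the first component contained in a name of a pair. -/
def NamesOn.fst (hP : P.Effective) {D : Set (S × T)} {D' : Set S} (hD : ∀ p ∈ D, p.1 ∈ D')
    (ω : NamesOn (P.prod Q) D) : NamesOn P D' :=
  ⟨fun i => (ω.name i).unpair.1, ω.pt.1, hD _ ω.mem, ω.isName.fst hP⟩

/-- The name of the second component contained in a name of a pair. -/
def NamesOn.snd (hQ : Q.Effective) {D : Set (S × T)} {D' : Set T} (hD : ∀ p ∈ D, p.2 ∈ D')
    (ω : NamesOn (P.prod Q) D) : NamesOn Q D' :=
  ⟨fun i => (ω.name i).unpair.2, ω.pt.2, hD _ ω.mem, ω.isName.snd hQ⟩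

theorem Reduces.namesFst (hP : P.Effective) {D : Set (S × T)} {D' : Set S} (hD : ∀ p ∈ D, p.1 ∈ D') :
    Reduces (NamesOn.name (P := P.prod Q) (D := D)) NamesOn.name
      fun ω (_ : Unit) => ω.fst hP hD :=
  Reduces.of_pointwise (F := fun x => x.2.unpair.1) (by fun_prop) fun _ _ _ => rfl

theorem Reduces.namesSnd (hQ : Q.Effective) {D : Set (S × T)} {D' : Set T} (hD : ∀ p ∈ D, p.2 ∈ D') :
    Reduces (NamesOn.name (P := P.prod Q) (D := D)) NamesOn.name
      fun ω (_ : Unit) => ω.snd hQ hD :=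
  Reduces.of_pointwise (F := fun x => x.2.unpair.2) (by fun_prop) fun _ _ _ => rfl

/-- A point of Baire space is computable from its names. -/
theorem Reduces.baire (D : Set (ℕ → ℕ)) :
    Reduces (NamesOn.name (P := baireData) (D := D)) (fun h => h) fun ω (_ : Unit) => ω.pt := by
  refine ⟨fun x => (Denumerable.ofNat (List ℕ) (x.2.2.getD (x.2.1 + 1) 0)).getD x.2.1 0,
    by fun_prop, fun ω _ i => ?_⟩
  -- A distance at most `2^{-(i+1)}` gives agreement up to and including coordinate `i`. Reading
  -- entry `i + 1` is why `Reduces` allows prefixes of length `i + 2`.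
  have h1 := baireData_effective.dist_le_of_isCauchyName ω.isName (i + 1)
  have h2 := baireData_dist_le_iff.1 h1 i (Nat.lt_succ_self i)
  dsimp only
  rw [getD_initSeg _ (by omega), ← h2]
  rfl

theorem isCauchyName_baire (h : ℕ → ℕ) :
    IsCauchyName baireData (fun i => Encodable.encode (initSeg h i)) h := by
  have hpt : ∀ i, ∀ k < i, baireData.pt (Encodable.encode (initSeg h i)) k = h k := fun i k hk => by
    show (Denumerable.ofNat (List ℕ) _).getD k 0 = _
    rw [Denumerable.ofNat_encode, getD_initSeg _ hk]
  refine ⟨fun i j hij => baireData_dist_le_iff.2 fun k hk => ?_, ?_⟩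
  · rw [hpt i k hk, hpt j k (hk.trans_le hij)]
  · exact squeeze_zero (fun _ => baireData_effective.dist_nonneg _ _)
      (fun i => baireData_dist_le_iff.2 (hpt i)) MetricData.Effective.half_pow_tendsto

theorem isCauchyName_nat (n : ℕ) : IsCauchyName natData (fun _ => n) n :=
  ⟨fun i j _ => by simp [natData], by simp [natData]⟩

/-- Entry `1` has error at most `1/2`, and distinct natural numbers have distance at least `1`. -/
theorem IsCauchyName.nat_eq {h : ℕ → ℕ} {n : ℕ} (hh : IsCauchyName natData h n) : h 1 = n := by
  have h1 := natData_effective.dist_le_of_isCauchyName hh 1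
  simp only [natData] at h1
  have h2 : |((h 1 : ℤ) : ℝ) - ((n : ℤ) : ℝ)| < 1 := by
    push_cast
    exact h1.trans_lt (by norm_num)
  rw [← Int.cast_sub, ← Int.cast_abs] at h2
  have h3 : |(h 1 : ℤ) - n| < 1 := by exact_mod_cast h2
  rw [Int.abs_lt_one_iff] at h3
  omega

theorem SemiDec.nat_name {D : Set (ℕ × T)} :
    SemiDec (NamesOn.name (P := natData.prod Q) (D := D)) fun ω (p : Unit × ℕ) => ω.pt.1 = p.2 := by
  have h1 := SemiDec.of_initSeg (NamesOn.name (P := natData.prod Q) (D := D))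
    (R := fun x : List ℕ × (Unit × ℕ) => Nat.beq (x.1.getD 1 0).unpair.1 x.2.2) (k := fun _ => 2)
    (by fun_prop) (by fun_prop)
  refine h1.congr fun ω p => ?_
  rw [getD_initSeg _ one_lt_two, Nat.beq_eq, (ω.isName.fst natData_effective).nat_eq]

theorem CompReal.natProd (hQ : Q.Effective) {D : Set T} {D' : Set (ℕ × T)} (hD : ∀ p ∈ D', p.2 ∈ D)
    {f : ℕ → T → ℝ} (hf : CompReal (NamesOn.name (P := Q) (D := D)) fun ω n => f n ω.pt) :
    CompReal (NamesOn.name (P := natData.prod Q) (D := D')) fun ω (_ : Unit) => f ω.pt.1 ω.pt.2 :=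
  CompReal.subst_val (f := fun (ω : NamesOn (natData.prod Q) D') (p : Unit × ℕ) => f p.2 ω.pt.2)
    ((hf.pullback (Reduces.namesSnd (P := natData) hQ hD)).comp (c := fun p : Unit × ℕ => p.2)
      (by fun_prop)) SemiDec.nat_name

end Names

/-! ## The set of pairs of a measure and a name of it -/

section NameSet

variable {X : Type*} [MetricSpace X] [CompleteSpace X] [MeasurableSpace X]
  (𝕏 : ComputableMetricSpace X)

/-- Given the Cauchy condition, convergence to `μ` can be replaced by distance at most `2^{-i}` for
the `i`-th entry. All requirements are then universally quantified weak inequalities between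
computable reals, so a violation is semidecidable. -/
theorem isEffectivelyClosed_nameSet [BorelSpace X] :
    IsEffectivelyClosed (baireData.prod 𝕏.measureData) (nameSet 𝕏) := by
  have hM := 𝕏.measureData_effective
  have hE := baireData_effective.prod hM
  refine isEffectivelyOpen_of_semiDec hE ?_
  set o := NamesOn.name (P := baireData.prod 𝕏.measureData) (D := Set.univ) with ho
  have hval : SemiDec o fun ω (p : ℕ × ℕ) => ω.pt.1 p.1 = p.2 :=
    ((SemiDec.oracle (fun h : ℕ → ℕ => h) (f := fun p : ℕ × ℕ => p.1) (g := fun p => p.2)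
      (by fun_prop) (by fun_prop)).pullback (Reduces.baire Set.univ)).pullback
      (Reduces.namesFst baireData_effective (D' := Set.univ) fun _ _ => trivial)
  have h1 : SemiDec o fun ω (p : ℕ × ℕ) => (((2 : ℚ)⁻¹ ^ p.2 : ℚ) : ℝ) <
      𝕏.measureData.dist (𝕏.measureData.pt (ω.pt.1 p.1)) (𝕏.measureData.pt (ω.pt.1 p.2)) := by
    have h2 := (CompReal.of_noOracle o hM.comp_dist).comp
      (c := fun p : ((ℕ × ℕ) × ℕ) × ℕ => (p.2, p.1.2)) (by fun_prop)
    have h3 := h2.subst_val (ν := fun ω p => ω.pt.1 p.1.1)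
      (hval.comp (f := fun p : ((ℕ × ℕ) × ℕ) × ℕ => (p.1.1.1, p.2)) (by fun_prop))
    have h4 := h3.subst_val (ν := fun ω p => ω.pt.1 p.2)
      (hval.comp (f := fun p : (ℕ × ℕ) × ℕ => (p.1.2, p.2)) (by fun_prop))
    exact h4.1.rat_lt (by fun_prop)
  have h5 : SemiDec o fun ω (i : ℕ) => (((2 : ℚ)⁻¹ ^ i : ℚ) : ℝ) <
      𝕏.measureData.dist (𝕏.measureData.pt (ω.pt.1 i)) ω.pt.2 := by
    have h6 := ((hM.comp_dist_name Set.univ).pullback (Reduces.namesSnd (P := baireData) hM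
      (D := Set.univ) (D' := Set.univ) fun _ _ => trivial)).comp (c := fun p : ℕ × ℕ => p.2)
      (by fun_prop)
    exact (h6.subst_val (ν := fun ω p => ω.pt.1 p) hval).1.rat_lt (by fun_prop)
  have h7 := ((SemiDec.of_computable o (d := fun p : (Unit × ℕ) × ℕ => Nat.ble p.1.2 p.2)
    (by fun_prop)).and
    (h1.comp (f := fun p : (Unit × ℕ) × ℕ => (p.2, p.1.2)) (by fun_prop))).ex.ex
  refine (h7.or (SemiDec.ex (h5.comp (f := fun p : Unit × ℕ => p.2) (by fun_prop)))).congr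
    fun ω _ => ?_
  rw [Set.mem_compl_iff, ← not_iff_not, not_not, nameSet, Set.mem_ofPred_eq]
  simp only [Nat.ble_eq]
  push Not
  constructor
  · refine fun h => ⟨fun i j hij => ?_, fun i => ?_⟩
    · push_cast; exact h.1 i j hij
    · push_cast; exact hM.dist_le_of_isCauchyName h i
  · rintro ⟨ha, hb⟩
    push_cast at ha hb
    exact ⟨ha, squeeze_zero (fun _ => hM.dist_nonneg _ _) hb MetricData.Effective.half_pow_tendsto⟩

/-- The pairs in `nameSet 𝕏`, with the name as oracle. -/
def nameOracle (ω : nameSet 𝕏) : ℕ → ℕ := ω.1.1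

/-- The oracle `h` plays both roles: its initial segments name `h` in Baire space, and its values
name `μ`. -/
theorem isCauchyName_of_nameSet (ω : nameSet 𝕏) :
    IsCauchyName (baireData.prod 𝕏.measureData)
      (fun i => Nat.pair (Encodable.encode (initSeg ω.1.1 i)) (ω.1.1 i)) ω.1 :=
  (isCauchyName_baire ω.1.1).prodMk ω.2

end NameSet

/-! ## Computable dependent choice -/

section DependentChoice

variable {Ω : Type*} {α : Type*} [Primcodable α] {o : Ω → ℕ → ℕ}

/-- Taking the first hit of a selector at each step makes the choices canonical for the given
oracle. The graph is semidecidable because a code of the whole list of values up to `i` can be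
guessed and each step of it verified. -/
theorem SemiDec.exists_seq {Step : Ω → (α × ℕ × ℕ) × ℕ → Prop} (hS : SemiDec o Step)
    (hnext : ∀ ω p, ∃ w, Step ω (p, w)) :
    ∃ seq : Ω → α → ℕ → ℕ, (∀ ω a i, Step ω ((a, i, seq ω a i), seq ω a (i + 1))) ∧
      SemiDec o fun ω (p : (α × ℕ) × ℕ) => seq ω p.1.1 p.1.2 = p.2 := by
  obtain ⟨R, hR, h1, h2⟩ := hS.exists_selector
  choose T hT using fun ω p => exists_firstHit (h2 ω p (hnext ω p))
  let seq : Ω → α → ℕ → ℕ := fun ω a i => Nat.rec 0 (fun i v => (T ω (a, i, v)).unpair.2) i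
  have hseq : ∀ ω a i, seq ω a (i + 1) = (T ω (a, i, seq ω a i)).unpair.2 := fun _ _ _ => rfl
  refine ⟨seq, fun ω a i => h1 _ _ _ (hT _ _).1, ?_⟩
  let σ : ℕ → ℕ → ℕ := fun L i => (Denumerable.ofNat (List ℕ) L).getD i 0
  have hσ : ∀ {δ : Type _} [Primcodable δ] {f g : δ → ℕ}, Computable f → Computable g →
      Computable fun d => σ (f d) (g d) := fun hf hg => by
    show Computable fun d => (Denumerable.ofNat (List ℕ) _).getD _ 0
    fun_prop
  have h3 : SemiDec o fun ω (p : ((α × ℕ) × ℕ) × ℕ) => (Nat.beq (σ p.2 0) 0 &&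
      Nat.beq (σ p.2 p.1.1.2) p.1.2) = true :=
    SemiDec.of_computable o (computable_and
      (computable_beq (hσ (by fun_prop) (by fun_prop)) (by fun_prop))
      (computable_beq (hσ (by fun_prop) (by fun_prop)) (by fun_prop)))
  have h4 : SemiDec o fun ω (p : ((α × ℕ) × ℕ) × ℕ) => ∀ j < p.1.1.2, ∃ T,
      FirstHit R (o ω) (p.1.1.1, j, σ p.2 j) T ∧ Nat.beq T.unpair.2 (σ p.2 (j + 1)) = true := by
    have hc : Computable fun q : ((((α × ℕ) × ℕ) × ℕ) × ℕ) × ℕ =>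
        ((q.1.1.1.1.1, q.1.2, σ q.1.1.2 q.1.2), q.2) :=
      Computable.pair (Computable.pair (by fun_prop) (Computable.pair (by fun_prop)
        (hσ (by fun_prop) (by fun_prop)))) (by fun_prop)
    have hd : Computable fun q : ((((α × ℕ) × ℕ) × ℕ) × ℕ) × ℕ =>
        Nat.beq q.2.unpair.2 (σ q.1.1.2 (q.1.2 + 1)) :=
      computable_beq (by fun_prop) (hσ (by fun_prop) (by fun_prop))
    exact (((SemiDec.firstHit o hR).comp hc).and (SemiDec.of_computable o hd)).ex.ball
      (f := fun p : ((α × ℕ) × ℕ) × ℕ => p.1.1.2) (by fun_prop)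
  refine (h3.and h4).ex.congr fun ω p => ?_
  simp only [Bool.and_eq_true, Nat.beq_eq]
  constructor
  · intro hp
    refine ⟨Encodable.encode (initSeg (seq ω p.1.1) (p.1.2 + 1)), ?_⟩
    have hσ' : ∀ j ≤ p.1.2, σ (Encodable.encode (initSeg (seq ω p.1.1) (p.1.2 + 1))) j =
        seq ω p.1.1 j := fun j hj => by
      simp only [σ]
      rw [Denumerable.ofNat_encode, getD_initSeg _ (Nat.lt_succ_of_le hj)]
    refine ⟨⟨hσ' 0 (Nat.zero_le _), (hσ' _ le_rfl).trans hp⟩, fun j hj => ?_⟩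
    rw [hσ' j hj.le, hσ' (j + 1) hj]
    exact ⟨_, hT _ _, (hseq _ _ _).symm⟩
  · rintro ⟨L, ⟨h5, h6⟩, h7⟩
    have h8 : ∀ j ≤ p.1.2, seq ω p.1.1 j = σ L j := fun j hj => by
      induction j with
      | zero => exact h5.symm
      | succ j ih =>
        obtain ⟨T', hT', h9⟩ := h7 j hj
        rw [hseq, ih (by omega), ← h9, (hT _ _).unique hT']
    rw [h8 _ le_rfl, h6]

end DependentChoice

/-! ## Families of open sets and functions on spaces of names -/

section Families

variable {S T : Type*} {P : MetricData S} {Q : MetricData T} {Ω : Type*} {α : Type*} [Primcodable α]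
  {o : Ω → ℕ → ℕ}

/-- The test on prefixes makes sense for every sequence, not only for the oracles attached to `Ω`.
-/
theorem SemiDec.exists_extension {V : Ω → α → Prop} (hV : SemiDec o V) :
    ∃ V' : (ℕ → ℕ) → α → Prop, SemiDec (fun h => h) V' ∧ ∀ ω a, V' (o ω) a ↔ V ω a := by
  obtain ⟨R, hR, H⟩ := hV
  exact ⟨fun h a => ∃ w, R (initSeg h w, a, w) = true, ⟨R, hR, fun _ _ => Iff.rfl⟩,
    fun ω a => (H ω a).symm⟩

theorem CompReal.of_natProd {D : Set T} {D' : Set (ℕ × T)}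
    (hD : ∀ n, ∀ q ∈ D, (n, q) ∈ D') {f : ℕ → T → ℝ}
    (hf : CompReal (NamesOn.name (P := natData.prod Q) (D := D')) fun ω (_ : Unit) => f ω.pt.1 ω.pt.2) :
    CompReal (NamesOn.name (P := Q) (D := D)) fun ω n => f n ω.pt := by
  let e : NamesOn Q D → ℕ → NamesOn (natData.prod Q) D' := fun ω n =>
    ⟨_, (n, ω.pt), hD _ _ ω.mem, (isCauchyName_nat n).prodMk ω.isName⟩
  have he : Reduces (NamesOn.name (P := Q) (D := D)) NamesOn.name e :=
    Reduces.of_pointwise (F := fun x => Nat.pair x.1 x.2) (by fun_prop) fun _ _ _ => rfl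
  exact (hf.subst he).comp (c := fun n : ℕ => (n, ())) (by fun_prop)

theorem LowerSemicomputable.lowerENNReal {F : S → ℝ≥0∞}
    (hF : LowerSemicomputable P fun s => ((F s : ℝ≥0∞) : EReal)) :
    LowerENNReal (NamesOn.name (P := P) (D := Set.univ)) fun ω (_ : Unit) => F ω.pt := by
  obtain ⟨g, hg, H⟩ := hF
  have h1 := CompReal.of_natProd (f := fun n q => g (n, q)) (D := Set.univ)
    (D' := Set.univ) (fun _ _ _ => trivial) (CompReal.of_computableMapOn hg)
  refine (SemiDec.ex ((h1.comp (c := fun p : (Unit × ℕ) × ℕ => p.2) (by fun_prop)).1.rat_lt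
    (q := fun p => max (ratCode p.1.2) 0) (by fun_prop))).congr fun ω p => ?_
  have h2 : ((ENNReal.ofReal (ratCode p.2) : ℝ≥0∞) : EReal) =
      ((max (ratCode p.2 : ℝ) 0 : ℝ) : EReal) := EReal.coe_ennreal_ofReal
  have h3 := H ω.pt
  dsimp only at h3 ⊢
  rw [← EReal.coe_ennreal_lt_coe_ennreal_iff, h3, h2, lt_iSup_iff]
  simp only [EReal.coe_lt_coe_iff]
  push_cast
  rfl

end Families

-- Transfer between pairs in `nameSet 𝕏` and their names

section NameOracle

variable {X : Type*} [MetricSpace X] [CompleteSpace X] [MeasurableSpace X]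
  (𝕏 : ComputableMetricSpace X) {α : Type*} [Primcodable α]

/-- A pair in `nameSet 𝕏` as a named point. -/
def nameSetPoint (D : Set ((ℕ → ℕ) × FiniteMeasure X)) (hD : nameSet 𝕏 ⊆ D) (ω : nameSet 𝕏) :
    NamesOn (baireData.prod 𝕏.measureData) D :=
  ⟨_, ω.1, hD ω.2, isCauchyName_of_nameSet 𝕏 ω⟩

theorem Reduces.nameSetPoint (D : Set ((ℕ → ℕ) × FiniteMeasure X)) (hD : nameSet 𝕏 ⊆ D) :
    Reduces (nameOracle 𝕏) NamesOn.name fun ω (_ : Unit) => nameSetPoint 𝕏 D hD ω := by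
  refine ⟨fun x => Nat.pair (Encodable.encode (x.2.2.take x.2.1)) (x.2.2.getD x.2.1 0), by fun_prop,
    fun ω _ i => ?_⟩
  dsimp only
  rw [take_initSeg _ (by omega), getD_initSeg _ (by omega)]
  rfl

/-- The oracle of a named pair in `nameSet 𝕏` is computable from the name. -/
theorem Reduces.toNameSet {D : Set ((ℕ → ℕ) × FiniteMeasure X)} (hD : D ⊆ nameSet 𝕏) :
    Reduces (NamesOn.name (P := baireData.prod 𝕏.measureData) (D := D)) (nameOracle 𝕏)
      fun ω (_ : Unit) => ⟨ω.pt, hD ω.mem⟩ := by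
  refine ⟨fun x => (Denumerable.ofNat (List ℕ) (x.2.2.getD (x.2.1 + 1) 0).unpair.1).getD x.2.1 0,
    by fun_prop, fun ω _ i => ?_⟩
  have h1 := baireData_effective.dist_le_of_isCauchyName (ω.isName.fst baireData_effective) (i + 1)
  have h2 := baireData_dist_le_iff.1 h1 i (Nat.lt_succ_self i)
  dsimp only
  rw [getD_initSeg _ (by omega)]
  exact h2.symm

/-- Families of open sets over `nameSet 𝕏` which are semidecidable relative to the name. -/
theorem isSigmaOneFamilyOn_of_semiDec [BorelSpace X] {U : ℕ → (ℕ → ℕ) → FiniteMeasure X → Set X}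
    (hU : SemiDec (joinOracle (nameOracle 𝕏) (NamesOn.name (P := 𝕏.data) (D := Set.univ)))
      fun z n => z.2.pt ∈ U n z.1.1.1 z.1.1.2) :
    IsSigmaOneFamilyOn (natData.prod (baireData.prod 𝕏.measureData)) 𝕏.data
      {p | p.2 ∈ nameSet 𝕏} fun p => U p.1 p.2.1 p.2.2 := by
  obtain ⟨B, hB, HB⟩ := SemiDec.exists_balls 𝕏.data_effective
    (V := fun (ω : nameSet 𝕏) y n => y ∈ U n ω.1.1 ω.1.2) hU
  obtain ⟨B', hB', HB'⟩ := hB.exists_extension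
  have hbm := baireData_effective.prod 𝕏.measureData_effective
  have hnbm := natData_effective.prod hbm
  -- Membership consults `n`, `h` and the point but never `μ`, and `B'` is defined for every `h`; so
  -- this set is effectively open in the whole product.
  refine ⟨{p | ∃ c M, B' p.1.2.1 (p.1.1, (c, M)) ∧ dist (𝕏.pt c) p.2 < ((M : ℝ) + 1)⁻¹},
    isEffectivelyOpen_of_semiDec (hnbm.prod 𝕏.data_effective) ?_, ?_⟩
  · have h1 := (hB'.pullback (Reduces.baire Set.univ)).pullback
      (Reduces.namesFst (Q := 𝕏.measureData) baireData_effective (D := Set.univ) (D' := Set.univ)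
      fun _ _ => trivial)
    have h2 := (h1.pullback (Reduces.namesSnd (P := natData) hbm (D := Set.univ)
      (D' := Set.univ) fun _ _ => trivial)).comp (f := fun p : (ℕ × ℕ) × ℕ => (p.2, p.1))
      (by fun_prop)
    have h3 := (h2.subst_val (ν := fun ω _ => ω.pt.1) ((SemiDec.nat_name (D := Set.univ)).comp
      (f := fun p : (ℕ × ℕ) × ℕ => ((), p.2)) (by fun_prop))).pullback
      (Reduces.namesFst (Q := 𝕏.data) hnbm (D := Set.univ) (D' := Set.univ) fun _ _ => trivial)
    have h4 := ((𝕏.data_effective.comp_dist_name Set.univ).pullback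
      (Reduces.namesSnd (P := natData.prod (baireData.prod 𝕏.measureData)) 𝕏.data_effective
      (D := Set.univ) (D' := Set.univ) fun _ _ => trivial)).comp
      (c := fun p : ℕ × ℕ => p.1) (by fun_prop)
    have h5 := (h3.and (h4.2.lt_rat (q := fun p : ℕ × ℕ => ((p.2 : ℚ) + 1)⁻¹) (by fun_prop))).comp
      (f := fun p : (Unit × ℕ) × ℕ => (p.1.2, p.2)) (by fun_prop)
    refine h5.ex.ex.congr fun ω _ => ?_
    push_cast
    rfl
  · rintro ⟨n, h, μ⟩ hK
    ext x
    exact HB ⟨(h, μ), hK⟩ x n |>.trans (exists_congr fun c => exists_congr fun M => and_congr_left'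
      (HB' ⟨(h, μ), hK⟩ _).symm)

end NameOracle

/-! ## Levels at which the distribution function of an integral test is computable -/

section Levels

variable {Ω : Type*} {α : Type*} [Primcodable α] {o : Ω → ℕ → ℕ}

theorem CompReal.comp_rat {M : Ω → ℚ → ℝ} (hM : CompReal o fun ω k => M ω (ratCode k)) {q : α → ℚ}
    (hq : RatComputable q) : CompReal o fun ω a => M ω (q a) := by
  obtain ⟨c, hc, h⟩ := hq
  exact (hM.comp hc).congr fun ω a => by rw [h]

/-- An antitone function has only countably many discontinuities, so some real level between `x` and
`y` is a point of continuity; the four rationals are taken close to it on its two sides. -/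
theorem exists_level_near {g : ℝ → ℝ} (hg : Antitone g) {x y : ℚ} (hxy : x < y) {ε : ℝ} (hε : 0 < ε) :
    ∃ a' a b b' : ℚ, x < a' ∧ a' < a ∧ a < b ∧ b < b' ∧ b' < y ∧ g a' - g b' < ε := by
  have h1 : ({c | ¬ ContinuousAt g c}ᶜ ∩ Set.Ioo (x : ℝ) y).Nonempty :=
    (hg.countable_not_continuousAt.dense_compl ℝ).inter_open_nonempty _ isOpen_Ioo
      (Set.nonempty_Ioo.2 (by exact_mod_cast hxy)) |>.mono fun c hc => ⟨hc.2, hc.1⟩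
  obtain ⟨c, hc, hxc, hcy⟩ := h1
  simp only [Set.mem_compl_iff, Set.mem_ofPred_eq, not_not] at hc
  obtain ⟨δ, hδ, hδ'⟩ := Metric.continuousAt_iff.1 hc (ε / 2) (half_pos hε)
  obtain ⟨a', h2, h3⟩ := exists_rat_btwn (max_lt hxc (show c - δ < c by linarith))
  obtain ⟨b', h4, h5⟩ := exists_rat_btwn (lt_min hcy (show c < c + δ by linarith))
  obtain ⟨a, h6, h7⟩ := exists_rat_btwn h3
  obtain ⟨b, h8, h9⟩ := exists_rat_btwn h4
  have h10 := hδ' (x := (a' : ℝ)) (by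
    rw [Real.dist_eq, abs_lt]; constructor <;> linarith [le_max_right (x : ℝ) (c - δ)])
  have h11 := hδ' (x := (b' : ℝ)) (by
    rw [Real.dist_eq, abs_lt]; constructor <;> linarith [min_le_right (y : ℝ) (c + δ)])
  rw [Real.dist_eq, abs_lt] at h10 h11
  refine ⟨a', a, b, b', ?_, ?_, ?_, ?_, ?_, by linarith⟩
  · exact_mod_cast (le_max_left (x : ℝ) (c - δ)).trans_lt h2
  · exact_mod_cast h6
  · exact_mod_cast h7.trans h8
  · exact_mod_cast h9
  · exact_mod_cast h5.trans_le (min_le_left (y : ℝ) (c + δ))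

theorem exists_posRatCode_add {x y : ℚ} (hxy : x < y) : ∃ n, x + (posRatCode n : ℚ) = y := by
  obtain ⟨n, hn⟩ := exists_posRatCode (Rat.toNNRat_pos.2 (sub_pos.2 hxy))
  refine ⟨n, ?_⟩
  rw [hn, Rat.coe_toNNRat _ (sub_nonneg.2 hxy.le)]
  ring

/-- Computable nested intervals around a level at which the antitone function `g` is computable,
where `g` is the derivative of the concave function `M`. -/
theorem exists_nested_levels {M : Ω → ℚ → ℝ} (hM : CompReal o fun ω k => M ω (ratCode k))
    {I : Ω → ℝ} (hI : CompReal o fun ω (_ : Unit) => I ω) {g : Ω → ℝ → ℝ}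
    (hg : ∀ ω, Antitone (g ω)) (hMI : ∀ ω b, 0 ≤ b → M ω b ≤ I ω) (hM0 : ∀ ω, 0 ≤ M ω 0)
    (h1 : ∀ ω (a b : ℚ), 0 ≤ a → a < b → (b - a) * g ω b ≤ M ω b - M ω a)
    (h2 : ∀ ω (a b : ℚ), 0 ≤ a → a < b → M ω b - M ω a ≤ (b - a) * g ω a) :
    ∃ (a b : ℕ → ℚ) (s : Ω → ℕ → ℝ) (seq : Ω → ℕ → ℕ → ℕ), RatComputable b ∧ CompReal o s ∧
      (SemiDec o fun ω (p : (ℕ × ℕ) × ℕ) => seq ω p.1.1 p.1.2 = p.2) ∧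
      (∀ v, 0 < a v ∧ a v < b v) ∧
      (∀ ω n, Monotone fun i => a (seq ω n i)) ∧ (∀ ω n, Antitone fun i => b (seq ω n i)) ∧
      (∀ ω n, g ω (a (seq ω n 0)) ≤ (2 : ℝ)⁻¹ ^ n) ∧
      (∀ ω n i, g ω (a (seq ω n i)) ≤ s ω (seq ω n i)) ∧
      ∀ ω n i, s ω (seq ω n i) - (2 : ℝ)⁻¹ ^ i ≤ g ω (b (seq ω n i)) := by
  -- `v` codes four rationals `0 < a' < a < b < b'` through their successive positive increments.
  let a' : ℕ → ℚ := fun v => posRatCode v.unpair.1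
  let a : ℕ → ℚ := fun v => a' v + posRatCode v.unpair.2.unpair.1
  let b : ℕ → ℚ := fun v => a v + posRatCode v.unpair.2.unpair.2.unpair.1
  let b' : ℕ → ℚ := fun v => b v + posRatCode v.unpair.2.unpair.2.unpair.2
  have hpos : ∀ n, (0 : ℚ) < posRatCode n := fun n => by exact_mod_cast posRatCode_pos n
  have ha'0 : ∀ v, 0 < a' v := fun v => hpos _
  have ha' : ∀ v, a' v < a v := fun v => lt_add_of_pos_right _ (hpos _)
  have hab : ∀ v, a v < b v := fun v => lt_add_of_pos_right _ (hpos _)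
  have hb' : ∀ v, b v < b' v := fun v => lt_add_of_pos_right _ (hpos _)
  have hca' : RatComputable a' := by simp only [a']; fun_prop
  have hca : RatComputable a := by simp only [a, a']; fun_prop
  have hcb : RatComputable b := by simp only [b, a, a']; fun_prop
  have hcb' : RatComputable b' := by simp only [b', b, a, a']; fun_prop
  have hex : ∀ x y z w : ℚ, 0 < x → x < y → y < z → z < w → ∃ v, a' v = x ∧ a v = y ∧ b v = z ∧
      b' v = w := by
    intro x y z w hx hy hz hw
    obtain ⟨n1, hn1⟩ := exists_posRatCode_add hx
    obtain ⟨n2, hn2⟩ := exists_posRatCode_add hy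
    obtain ⟨n3, hn3⟩ := exists_posRatCode_add hz
    obtain ⟨n4, hn4⟩ := exists_posRatCode_add hw
    rw [zero_add] at hn1
    refine ⟨Nat.pair n1 (Nat.pair n2 (Nat.pair n3 n4)), ?_⟩
    simp only [b', b, a, a', Nat.unpair_pair, hn1, hn2, hn3, hn4, and_self]
  -- Slopes of `M` to the left and to the right of the interval: `g a ≤ s ≤ g a'` and `g b' ≤ r ≤ g
  -- b`. Hence `s - r` bounds the variation of `g` between `a` and `b` by computable quantities.
  let s : Ω → ℕ → ℝ := fun ω v => ((a v - a' v)⁻¹ : ℚ) * (M ω (a v) - M ω (a' v))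
  let r : Ω → ℕ → ℝ := fun ω v => ((b' v - b v)⁻¹ : ℚ) * (M ω (b' v) - M ω (b v))
  have hs : CompReal o s := ((hM.comp_rat hca).sub (hM.comp_rat hca')).rat_mul (by fun_prop)
  have hr : CompReal o r := ((hM.comp_rat hcb').sub (hM.comp_rat hcb)).rat_mul (by fun_prop)
  have hcast : ∀ {x y : ℚ}, x < y → (0 : ℝ) < (y : ℝ) - x := fun h => by
    rw [sub_pos]; exact_mod_cast h
  have hs1 : ∀ ω v, g ω (a v) ≤ s ω v := fun ω v => by
    have := h1 ω (a' v) (a v) (ha'0 v).le (ha' v)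
    simp only [s]
    push_cast
    rwa [le_inv_mul_iff₀ (hcast (ha' v))]
  have hs2 : ∀ ω v, s ω v ≤ g ω (a' v) := fun ω v => by
    have := h2 ω (a' v) (a v) (ha'0 v).le (ha' v)
    simp only [s]
    push_cast
    rwa [inv_mul_le_iff₀ (hcast (ha' v))]
  have hb0 : ∀ v, 0 < b v := fun v => (ha'0 v).trans ((ha' v).trans (hab v))
  have hr1 : ∀ ω v, g ω (b' v) ≤ r ω v := fun ω v => by
    have := h1 ω (b v) (b' v) (hb0 v).le (hb' v)
    simp only [r]
    push_cast
    rwa [le_inv_mul_iff₀ (hcast (hb' v))]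
  have hr2 : ∀ ω v, r ω v ≤ g ω (b v) := fun ω v => by
    have := h2 ω (b v) (b' v) (hb0 v).le (hb' v)
    simp only [r]
    push_cast
    rwa [inv_mul_le_iff₀ (hcast (hb' v))]
  -- The first interval lies beyond `2^n I`, later ones are strictly nested, and the slopes at step
  -- `i` differ by less than `2^{-i}`. Strict inequalities keep the search semidecidable.
  have hS : SemiDec o fun ω (p : (ℕ × ℕ × ℕ) × ℕ) =>
      ((p.1.2.1 = 0 ∧ I ω < ((2 : ℚ)⁻¹ ^ p.1.1 * a' p.2 : ℚ)) ∨
        (0 < p.1.2.1 ∧ a p.1.2.2 < a p.2 ∧ b p.2 < b p.1.2.2)) ∧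
      s ω p.2 < r ω p.2 + ((2 : ℚ)⁻¹ ^ (p.1.2.1) : ℚ) := by
    refine SemiDec.and (SemiDec.or (SemiDec.and ?_ ?_) (SemiDec.and ?_ (SemiDec.and ?_ ?_))) ?_
    · exact (SemiDec.of_computable o (d := fun p : (ℕ × ℕ × ℕ) × ℕ => Nat.beq p.1.2.1 0)
        (by fun_prop)).congr fun _ _ => by rw [Nat.beq_eq]
    · exact (hI.comp (c := fun _ => ()) (by fun_prop)).2.lt_rat
        (RatComputable.mul (by fun_prop) (hca'.comp (by fun_prop)))
    · exact (SemiDec.of_computable o (d := fun p : (ℕ × ℕ × ℕ) × ℕ => Nat.blt 0 p.1.2.1)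
        (by fun_prop)).congr fun _ _ => by rw [Nat.blt_eq]
    · exact SemiDec.of_lt o (hca.comp (by fun_prop)) (hca.comp (by fun_prop))
    · exact SemiDec.of_lt o (hcb.comp (by fun_prop)) (hcb.comp (by fun_prop))
    · exact LowerReal.lt (hs.comp (c := fun p : (ℕ × ℕ × ℕ) × ℕ => p.2) (by fun_prop)).2
        ((hr.comp (c := fun p : (ℕ × ℕ × ℕ) × ℕ => p.2) (by fun_prop)).1.add
        (LowerReal.of_rat o (by fun_prop)))
  have hpick : ∀ ω (x y : ℚ) (i : ℕ), 0 < x → x < y → ∃ v, x < a' v ∧ x < a v ∧ b v < y ∧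
      s ω v < r ω v + ((2 : ℚ)⁻¹ ^ i : ℚ) := by
    intro ω x y i hx hxy
    obtain ⟨c', c, d, d', h3, h4, h5, h6, h7, h8⟩ := exists_level_near (hg ω) hxy
      (show (0 : ℝ) < (2 : ℝ)⁻¹ ^ i by positivity)
    obtain ⟨v, rfl, rfl, rfl, rfl⟩ := hex c' c d d' (hx.trans h3) h4 h5 h6
    refine ⟨v, h3, h3.trans h4, h6.trans h7, ?_⟩
    push_cast
    linarith [hs2 ω v, hr1 ω v]
  obtain ⟨seq, hseq, hgraph⟩ := hS.exists_seq fun ω p => by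
    rcases Nat.eq_zero_or_pos p.2.1 with h0 | h0
    · obtain ⟨x, hx⟩ := exists_rat_gt (max 0 (2 ^ p.1 * I ω))
      have hx0 : (0 : ℚ) < x := by exact_mod_cast (le_max_left _ _).trans_lt hx
      obtain ⟨v, h3, -, -, h4⟩ := hpick ω x (x + 1) p.2.1 hx0 (by linarith)
      refine ⟨v, Or.inl ⟨h0, ?_⟩, h4⟩
      have h5 := (le_max_right _ _).trans_lt hx
      have h6 : (x : ℝ) < a' v := by exact_mod_cast h3
      push_cast
      rw [inv_pow, lt_inv_mul_iff₀ (by positivity)]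
      linarith
    · obtain ⟨v, -, h3, h4, h5⟩ := hpick ω (a p.2.2) (b p.2.2) p.2.1
        ((ha'0 _).trans (ha' _)) (hab _)
      exact ⟨v, Or.inr ⟨h0, h3, h4⟩, h5⟩
  -- The step condition constrains only the terms from `1` on, so the sequence of intervals is
  -- shifted by one.
  refine ⟨a, b, s, fun ω n i => seq ω n (i + 1), hcb, hs,
    hgraph.comp (f := fun p : (ℕ × ℕ) × ℕ => ((p.1.1, p.1.2 + 1), p.2)) (by fun_prop),
    fun v => ⟨(ha'0 v).trans (ha' v), hab v⟩, fun ω n => monotone_nat_of_le_succ fun i => ?_,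
    fun ω n => antitone_nat_of_succ_le fun i => ?_, fun ω n => ?_, fun ω n i => hs1 _ _,
    fun ω n i => ?_⟩
  · rcases (hseq ω n (i + 1)).1 with h | h
    · exact absurd h.1 (Nat.succ_ne_zero i)
    · exact h.2.1.le
  · rcases (hseq ω n (i + 1)).1 with h | h
    · exact absurd h.1 (Nat.succ_ne_zero i)
    · exact h.2.2.le
  · rcases (hseq ω n 0).1 with h | h
    · have h3 := h.2
      -- Markov's inequality: `a' g(a') ≤ M a' - M 0 ≤ I < 2^{-n} a'`.
      have h4 := h1 ω 0 (a' (seq ω n 1)) le_rfl (ha'0 _)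
      have h5 : (0 : ℝ) < a' (seq ω n 1) := by exact_mod_cast ha'0 _
      have h6 : g ω (a (seq ω n 1)) ≤ g ω (a' (seq ω n 1)) :=
        hg ω (by exact_mod_cast (ha' _).le)
      have h7 := hMI ω (a' (seq ω n 1)) (ha'0 _).le
      have h8 := hM0 ω
      push_cast at h3 h4
      refine h6.trans (le_of_mul_le_mul_left ?_ h5)
      linarith
    · exact absurd h.1 (lt_irrefl 0)
  · have h3 := (hseq ω n i).2
    push_cast at h3
    have h4 := hr2 ω (seq ω n (i + 1))
    linarith

end Levels

/-! ## From integral tests to sequential tests -/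

section Truncation

variable {X : Type*} [MeasurableSpace X] {μ : Measure X} [IsFiniteMeasure μ] {F : X → ℝ≥0∞}

theorem lintegral_min_ofReal_ne_top (c : ℝ) : ∫⁻ x, min (F x) (ENNReal.ofReal c) ∂μ ≠ ∞ := by
  refine ne_top_of_le_ne_top ?_ (lintegral_mono fun x => min_le_right (F x) _)
  rw [lintegral_const]
  exact ENNReal.mul_ne_top ENNReal.ofReal_ne_top (measure_ne_top _ _)

/-- The comparison function for both slope bounds: with `c = b` it lies below `min F b`, with `c =
a` above it. -/
theorem lintegral_min_add_indicator (hF : Measurable F) (a b c : ℝ) (hab : a < b) :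
    ∫⁻ x, (min (F x) (ENNReal.ofReal a) +
      {x | ENNReal.ofReal c < F x}.indicator (fun _ => ENNReal.ofReal (b - a)) x) ∂μ =
    ENNReal.ofReal ((∫⁻ x, min (F x) (ENNReal.ofReal a) ∂μ).toReal +
      (b - a) * μ.real {x | ENNReal.ofReal c < F x}) := by
  rw [lintegral_add_left (by fun_prop), lintegral_indicator_const
    (measurableSet_lt measurable_const hF), ENNReal.ofReal_add ENNReal.toReal_nonneg
    (mul_nonneg (by linarith) measureReal_nonneg), ENNReal.ofReal_toReal
    (lintegral_min_ofReal_ne_top a), ENNReal.ofReal_mul (by linarith), ofReal_measureReal]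

/-- Integrate `min F a + (b - a) 1_{F > b} ≤ min F b`. -/
theorem mul_measureReal_lt_le (hF : Measurable F) {a b : ℝ} (ha : 0 ≤ a) (hab : a < b) :
    (b - a) * μ.real {x | ENNReal.ofReal b < F x} ≤
      (∫⁻ x, min (F x) (ENNReal.ofReal b) ∂μ).toReal -
        (∫⁻ x, min (F x) (ENNReal.ofReal a) ∂μ).toReal := by
  have h1 := lintegral_min_add_indicator (μ := μ) hF a b b hab
  have h2 : ∫⁻ x, (min (F x) (ENNReal.ofReal a) +
      {x | ENNReal.ofReal b < F x}.indicator (fun _ => ENNReal.ofReal (b - a)) x) ∂μ ≤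
      ∫⁻ x, min (F x) (ENNReal.ofReal b) ∂μ := by
    refine lintegral_mono fun x => ?_
    by_cases hx : ENNReal.ofReal b < F x
    · rw [Set.indicator_of_mem (by exact hx), min_eq_right hx.le]
      refine (add_le_add_left (min_le_right _ _) _).trans ?_
      rw [← ENNReal.ofReal_add ha (by linarith), add_sub_cancel]
    · rw [Set.indicator_of_notMem (by exact hx), add_zero]
      exact min_le_min_left _ (ENNReal.ofReal_le_ofReal hab.le)
  rw [h1, ENNReal.ofReal_le_iff_le_toReal (lintegral_min_ofReal_ne_top b)] at h2
  linarith

/-- Integrate `min F b ≤ min F a + (b - a) 1_{F > a}`. -/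
theorem le_mul_measureReal_lt (hF : Measurable F) {a b : ℝ} (ha : 0 ≤ a) (hab : a < b) :
    (∫⁻ x, min (F x) (ENNReal.ofReal b) ∂μ).toReal -
        (∫⁻ x, min (F x) (ENNReal.ofReal a) ∂μ).toReal ≤
      (b - a) * μ.real {x | ENNReal.ofReal a < F x} := by
  have h1 := lintegral_min_add_indicator (μ := μ) hF a b a hab
  have h2 : ∫⁻ x, min (F x) (ENNReal.ofReal b) ∂μ ≤ ∫⁻ x, (min (F x) (ENNReal.ofReal a) +
      {x | ENNReal.ofReal a < F x}.indicator (fun _ => ENNReal.ofReal (b - a)) x) ∂μ := by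
    refine lintegral_mono fun x => ?_
    by_cases hx : ENNReal.ofReal a < F x
    · rw [Set.indicator_of_mem (by exact hx), min_eq_right hx.le,
        ← ENNReal.ofReal_add ha (by linarith), add_sub_cancel]
      exact min_le_right _ _
    · rw [Set.indicator_of_notMem (by exact hx), add_zero, min_eq_left (not_lt.1 hx)]
      exact min_le_left _ _
  rw [h1] at h2
  have h3 := ENNReal.toReal_le_of_le_ofReal (add_nonneg ENNReal.toReal_nonneg
    (mul_nonneg (by linarith) measureReal_nonneg)) h2
  linarith

end Truncation

-- Finite values, truncation and excess of lower semicomputable functions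

section LowerENNReal

variable {Ω : Type*} {α : Type*} [Primcodable α] {o : Ω → ℕ → ℕ} {F : Ω → α → ℝ≥0∞}

theorem LowerENNReal.toReal (hF : LowerENNReal o F) (h : ∀ ω a, F ω a ≠ ∞) :
    LowerReal o fun ω a => (F ω a).toReal := by
  refine (SemiDec.or (SemiDec.of_lt o (f := fun p : α × ℕ => ratCode p.2) (g := fun _ => 0)
    (by fun_prop) (by fun_prop)) hF).congr fun ω p => ?_
  rcases lt_or_ge (ratCode p.2) 0 with h0 | h0
  · have h1 : (ratCode p.2 : ℝ) < 0 := by exact_mod_cast h0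
    exact iff_of_true (h1.trans_le ENNReal.toReal_nonneg) (Or.inl h0)
  · have h1 : (0 : ℝ) ≤ ratCode p.2 := by exact_mod_cast h0
    rw [ENNReal.ofReal_lt_iff_lt_toReal h1 (h _ _)]
    exact (or_iff_right (not_lt.2 h0)).symm

theorem LowerENNReal.min_rat (hF : LowerENNReal o F) {q : α → ℚ} (hq : RatComputable q) :
    LowerENNReal o fun ω a => min (F ω a) (ENNReal.ofReal (q a)) :=
  (SemiDec.and hF (lowerENNReal_ofReal (CompReal.of_rat o hq).1)).congr fun _ _ => lt_min_iff

theorem LowerENNReal.sub_rat (hF : LowerENNReal o F) {q : α → ℚ} (hq : RatComputable q) :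
    LowerENNReal o fun ω a => F ω a - ENNReal.ofReal (q a) := by
  refine ((hF.comp (c := Prod.fst) (by fun_prop)).exists_lt
    (q := fun p : α × ℕ => max (ratCode p.2) 0 + max (q p.1) 0)
    (RatComputable.add (by fun_prop) (RatComputable.max (hq.comp (by fun_prop)) (by fun_prop)))).congr fun ω p => ?_
  rw [lt_tsub_iff_right]
  push_cast
  rw [ENNReal.ofReal_add (le_max_right _ _) (le_max_right _ _)]
  simp [ENNReal.ofReal_max]

end LowerENNReal

-- The sequential test attached to an integral test

section IntegralToSequential

variable {X : Type*} [MetricSpace X] [CompleteSpace X] [MeasurableSpace X] [BorelSpace X]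
  (𝕏 : ComputableMetricSpace X)

theorem compReal_integral_nameSet : CompReal (nameOracle 𝕏) fun ω i =>
    ∫ x, basicFun 𝕏 i x ∂(ω.1.2 : Measure X) :=
  ((compReal_integral_basicFun 𝕏 Set.univ).pullback (Reduces.namesSnd (P := baireData)
    𝕏.measureData_effective (D := Set.univ) (D' := Set.univ) fun _ _ => trivial)).pullback
    (Reduces.nameSetPoint 𝕏 Set.univ (Set.subset_univ _))

/-- Truncated integrals of a lower semicomputable function of computable integral. -/
theorem compReal_lintegral_min {Ω : Type*} {o : Ω → ℕ → ℕ} {μ : Ω → FiniteMeasure X}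
    (hμ : CompReal o fun ω i => ∫ x, basicFun 𝕏 i x ∂(μ ω : Measure X)) {F : Ω → X → ℝ≥0∞}
    (hF : LowerENNReal (joinOracle o (NamesOn.name (P := 𝕏.data) (D := Set.univ)))
      fun z (_ : Unit) => F z.1 z.2.pt) (hfin : ∀ ω, ∫⁻ x, F ω x ∂(μ ω : Measure X) ≠ ∞)
    (hI : CompReal o fun ω (_ : Unit) => (∫⁻ x, F ω x ∂(μ ω : Measure X)).toReal) :
    CompReal o fun ω k => (∫⁻ x, min (F ω x) (ENNReal.ofReal (ratCode k)) ∂(μ ω : Measure X)).toReal := by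
  have hF' := hF.comp (c := fun _ : ℕ => ()) (by fun_prop)
  have hmeas : ∀ ω, Measurable (F ω) := fun ω => (LowerENNReal.lintegral 𝕏 hμ
    (F := fun ω x (_ : Unit) => F ω x) hF).1 ω ()
  have h1 := (LowerENNReal.lintegral 𝕏 hμ (F := fun ω x k => min (F ω x) (ENNReal.ofReal (ratCode k)))
    (hF'.min_rat (by fun_prop))).2.toReal fun ω k => lintegral_min_ofReal_ne_top _
  have hle : ∀ ω (c : ℝ), ∫⁻ x, F ω x - ENNReal.ofReal c ∂(μ ω : Measure X) ≠ ∞ := fun ω c =>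
    ne_top_of_le_ne_top (hfin ω) (lintegral_mono fun x => tsub_le_self)
  have h2 := (LowerENNReal.lintegral 𝕏 hμ (F := fun ω x k => F ω x - ENNReal.ofReal (ratCode k))
    (hF'.sub_rat (by fun_prop))).2.toReal fun ω k => hle ω _
  refine ⟨h1, (h2.add (hI.comp (c := fun _ : ℕ => ()) (by fun_prop)).2).congr fun ω k => ?_⟩
  have h3 : ∫⁻ x, F ω x ∂(μ ω : Measure X) =
      ∫⁻ x, min (F ω x) (ENNReal.ofReal (ratCode k)) ∂(μ ω : Measure X) +
        ∫⁻ x, F ω x - ENNReal.ofReal (ratCode k) ∂(μ ω : Measure X) := by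
    rw [← lintegral_add_left ((hmeas ω).min measurable_const)]
    refine lintegral_congr fun x => ?_
    rcases le_total (F ω x) (ENNReal.ofReal (ratCode k)) with h | h
    · rw [min_eq_left h, tsub_eq_zero_of_le h, add_zero]
    · rw [min_eq_right h, add_tsub_cancel_of_le h]
  dsimp only
  rw [h3, ENNReal.toReal_add (lintegral_min_ofReal_ne_top _) (hle ω _)]
  ring

/-- The `n`-th set is the superlevel set of `t` at the limit of the right ends of the nested
intervals. The slopes `s` approximate its measure with error `2^{-i}`, and `t = ∞` exceeds every
level. -/
theorem IsUniformSchnorrIntegralTest.exists_sequentialTest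
    {t : (ℕ → ℕ) → FiniteMeasure X → X → ℝ≥0∞} (ht : IsUniformSchnorrIntegralTest 𝕏 baireData t) :
    ∃ U, IsUniformSchnorrSequentialTest 𝕏 baireData (nameSet 𝕏) U ∧
      ∀ h μ x, (h, μ) ∈ nameSet 𝕏 → t h μ x = ∞ → ∀ n, x ∈ U n h μ := by
  have hμ := compReal_integral_nameSet 𝕏
  let F : nameSet 𝕏 → X → ℝ≥0∞ := fun ω x => t ω.1.1 ω.1.2 x
  let μ : nameSet 𝕏 → Measure X := fun ω => ω.1.2
  have hF : LowerENNReal (joinOracle (nameOracle 𝕏) (NamesOn.name (P := 𝕏.data) (D := Set.univ)))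
      fun z (_ : Unit) => F z.1 z.2.pt := by
    have h1 := ht.lower_semicomputable.lowerENNReal
    let e : nameSet 𝕏 × NamesOn 𝕏.data Set.univ →
        NamesOn (baireData.prod (𝕏.measureData.prod 𝕏.data)) Set.univ := fun z =>
      ⟨_, (z.1.1.1, z.1.1.2, z.2.pt), trivial,
        (isCauchyName_baire z.1.1.1).prodMk (z.1.2.prodMk z.2.isName)⟩
    refine h1.pullback (e := e) ⟨fun x => Nat.pair
      (Encodable.encode ((List.range x.2.1).map fun i => (x.2.2.getD i 0).unpair.1))
      (x.2.2.getD x.2.1 0), ?_, fun z _ i => ?_⟩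
    · have := computable_rangeMap (f := fun x : Unit × ℕ × List ℕ => x.2.1)
        (g := fun y => (y.1.2.2.getD y.2 0).unpair.1) (by fun_prop) (by fun_prop)
      fun_prop
    · have key : (List.range i).map (fun j => ((initSeg (joinOracle (nameOracle 𝕏) NamesOn.name z)
          (i + 2)).getD j 0).unpair.1) = initSeg z.1.1.1 i :=
        List.map_congr_left fun j hj => by
          rw [getD_initSeg _ (by have := List.mem_range.1 hj; omega)]
          simp [joinOracle, nameOracle]
      dsimp only
      rw [key, getD_initSeg _ (by omega)]
      rfl
  have hfin : ∀ ω, ∫⁻ x, F ω x ∂(μ ω) ≠ ∞ := fun ω => (ht.lintegral_lt_top _ _).ne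
  have hI : CompReal (nameOracle 𝕏) fun ω (_ : Unit) => (∫⁻ x, F ω x ∂(μ ω)).toReal :=
    (CompReal.of_computableMapOn ht.computable_integral).pullback
      (Reduces.nameSetPoint 𝕏 Set.univ (Set.subset_univ _))
  have hmeas : ∀ ω, Measurable (F ω) := fun ω => (LowerENNReal.lintegral 𝕏 hμ
    (F := fun ω x (_ : Unit) => F ω x) hF).1 ω ()
  obtain ⟨a, b, s, seq, hb, hs, hseq, hab, ha_mono, hb_anti, hn, hs1, hs2⟩ := exists_nested_levels
    (M := fun ω q => (∫⁻ x, min (F ω x) (ENNReal.ofReal q) ∂(μ ω)).toReal)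
    (g := fun ω c => (μ ω).real {x | ENNReal.ofReal c < F ω x})
    (compReal_lintegral_min 𝕏 hμ hF hfin hI) hI
    (fun ω c c' hcc' => measureReal_mono fun x hx => (ENNReal.ofReal_le_ofReal hcc').trans_lt hx)
    (fun ω c _ => ENNReal.toReal_mono (hfin ω) (lintegral_mono fun x => min_le_left _ _))
    (fun ω => ENNReal.toReal_nonneg)
    (fun ω c d hc hcd => mul_measureReal_lt_le (hmeas ω) (by exact_mod_cast hc) (by exact_mod_cast hcd))
    (fun ω c d hc hcd => le_mul_measureReal_lt (hmeas ω) (by exact_mod_cast hc) (by exact_mod_cast hcd))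
  -- Levels are chosen only for pairs in `nameSet 𝕏`; the component `hK` makes the set empty
  -- elsewhere.
  let U : ℕ → (ℕ → ℕ) → FiniteMeasure X → Set X := fun n h μ =>
    {x | ∃ hK : (h, μ) ∈ nameSet 𝕏, ∃ i, ENNReal.ofReal (b (seq ⟨(h, μ), hK⟩ n i)) < t h μ x}
  have hU : ∀ n (ω : nameSet 𝕏) x, x ∈ U n ω.1.1 ω.1.2 ↔
      ∃ i, ENNReal.ofReal (b (seq ω n i)) < F ω x := fun n ω x =>
    ⟨fun ⟨_, h⟩ => h, fun h => ⟨ω.2, h⟩⟩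
  have hlow : ∀ n ω i, (μ ω).real {x | ENNReal.ofReal (b (seq ω n i)) < F ω x} ≤
      (μ ω).real (U n ω.1.1 ω.1.2) := fun n ω i =>
    measureReal_mono fun x hx => (hU n ω x).2 ⟨i, hx⟩
  -- Nesting puts every left end `a` below every right end `b`, so all the sets `{F > b}` lie in
  -- each `{F > a}`.
  have hup : ∀ n ω i, (μ ω).real (U n ω.1.1 ω.1.2) ≤
      (μ ω).real {x | ENNReal.ofReal (a (seq ω n i)) < F ω x} := fun n ω i => by
    refine measureReal_mono fun x hx => ?_
    obtain ⟨j, hj⟩ := (hU n ω x).1 hx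
    refine (ENNReal.ofReal_le_ofReal ?_).trans_lt hj
    have h1 := ha_mono ω n (le_max_left i j)
    have h2 := hb_anti ω n (le_max_right i j)
    exact_mod_cast h1.trans ((hab _).2.le.trans h2)
  refine ⟨U, ⟨isSigmaOneFamilyOn_of_semiDec 𝕏 ?_, fun n h ν hK => ?_, ?_⟩, fun h ν x hK hx n =>
    ⟨hK, 0, by rw [hx]; exact ENNReal.ofReal_lt_top⟩⟩
  · have h1 := hseq.pullback (Reduces.joinFst (nameOracle 𝕏)
      (NamesOn.name (P := 𝕏.data) (D := Set.univ)))
    have h2 := (hF.comp (c := fun _ : (ℕ × ℕ) × ℕ => ()) (by fun_prop)).exists_lt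
      (q := fun p : (ℕ × ℕ) × ℕ => b p.2) (hb.comp (by fun_prop))
    exact (h1.and h2).ex.ex.congr fun z n => (hU n z.1 z.2.pt).trans (by simp)
  · have h1 := (hup n ⟨(h, ν), hK⟩ 0).trans (hn ⟨(h, ν), hK⟩ n)
    have h2 := ENNReal.ofReal_le_ofReal h1
    rwa [ofReal_measureReal, ENNReal.ofReal_pow (by norm_num), ENNReal.ofReal_inv_of_pos two_pos,
      ENNReal.ofReal_ofNat] at h2
  · have h1 : CompReal (nameOracle 𝕏) fun ω n => (μ ω).real (U n ω.1.1 ω.1.2) := by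
      refine CompReal.of_approx (A := fun ω (p : ℕ × ℕ) =>
        seq ω p.1 p.2.unpair.1 = p.2.unpair.2) (e := fun p => (2 : ℚ)⁻¹ ^ p.2.unpair.1)
        (hseq.comp (f := fun p : ℕ × ℕ => ((p.1, p.2.unpair.1), p.2.unpair.2)) (by fun_prop))
        (hs.comp (c := fun p : ℕ × ℕ => p.2.unpair.2) (by fun_prop)) (by fun_prop) ?_ ?_
      · intro ω n m hm
        dsimp only at hm ⊢
        rw [← hm]
        have h2 := hs1 ω n m.unpair.1
        have h3 := hs2 ω n m.unpair.1
        have h4 := hlow n ω m.unpair.1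
        have h5 := hup n ω m.unpair.1
        push_cast
        rw [abs_le]
        have h6 : (0 : ℝ) < (2 : ℝ)⁻¹ ^ m.unpair.1 := by positivity
        constructor <;> linarith
      · intro ω n ε hε
        obtain ⟨i, hi⟩ := exists_mul_half_pow_lt 1 hε
        refine ⟨Nat.pair i (seq ω n i), by simp, ?_⟩
        simp only [Nat.unpair_pair]
        push_cast
        linarith
    exact CompReal.computableMapOn (CompReal.natProd (D := nameSet 𝕏)
      (baireData_effective.prod 𝕏.measureData_effective) (fun _ hp => hp)
      (f := fun n q => (q.2 : Measure X).real (U n q.1 q.2))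
      (h1.pullback (Reduces.toNameSet 𝕏 (D := nameSet 𝕏) subset_rfl)))

end IntegralToSequential

/-! ## Basic functions extracted from a sequential test -/

section Increments

/-- If the sum were finite, the clamped increments would eventually be below `1`. From then on they
dominate the true increments, and telescoping would bound `G`. -/
theorem tsum_increments_eq_top {G : ℕ → ℝ} (hG : Tendsto G atTop atTop) :
    ∑' k, ENNReal.ofReal (max 0 (min 1 (G (k + 1) - G k))) = ∞ := by
  by_contra hsum
  set e : ℕ → ℝ := fun k => max 0 (min 1 (G (k + 1) - G k)) with he
  have he0 : ∀ k, 0 ≤ e k := fun k => le_max_left _ _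
  obtain ⟨N, hN⟩ := eventually_atTop.1 ((ENNReal.tendsto_atTop_zero_of_tsum_ne_top hsum).eventually
    (gt_mem_nhds (show (0 : ℝ≥0∞) < 1 from one_pos)))
  have h1 : ∀ k ≥ N, G (k + 1) ≤ G k + e k := fun k hk => by
    have h2 := hN k hk
    rw [ENNReal.ofReal_lt_one] at h2
    have h3 : G (k + 1) - G k < 1 := by
      by_contra h4
      rw [min_eq_left (not_lt.1 h4), max_eq_right zero_le_one] at h2
      exact lt_irrefl _ h2
    have h5 : G (k + 1) - G k ≤ e k := by
      simp only [he]
      rw [min_eq_right h3.le]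
      exact le_max_right _ _
    linarith
  have hs : Summable e := by
    have := ENNReal.summable_toReal hsum
    exact this.congr fun k => ENNReal.toReal_ofReal (he0 k)
  have h2 : ∀ m, G (N + m) ≤ G N + ∑ k ∈ Finset.range m, e (N + k) := fun m => by
    induction m with
    | zero => simp
    | succ m ih =>
      rw [Finset.sum_range_succ]
      have := h1 (N + m) (Nat.le_add_right _ _)
      rw [← add_assoc N m 1]
      linarith
  have h3 : ∀ m, G (N + m) ≤ G N + ∑' k, e k := fun m => by
    refine (h2 m).trans (add_le_add_right ?_ _)
    have h4 : Summable fun k => e (N + k) := by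
      simpa only [add_comm N] using (summable_nat_add_iff N).2 hs
    refine (h4.sum_le_tsum _ fun k _ => he0 _).trans ?_
    exact tsum_comp_le_tsum_of_inj hs he0 (add_right_injective N)
  obtain ⟨k, hk, hk'⟩ := ((hG.eventually_gt_atTop (G N + ∑' k, e k)).and
    (eventually_ge_atTop N)).exists
  obtain ⟨m, rfl⟩ := Nat.exists_eq_add_of_le hk'
  exact absurd (h3 m) (not_le.2 hk)

variable {X : Type*} [MetricSpace X] [CompleteSpace X] (𝕏 : ComputableMetricSpace X)

theorem exists_incrementCode : ∃ c : ℕ × ℕ → ℕ, Computable c ∧ ∀ i j x,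
    basicFun 𝕏 (c (i, j)) x = max 0 (min 1 (basicFun 𝕏 j x - basicFun 𝕏 i x)) := by
  obtain ⟨z, hz⟩ := ratCode_surjective 0
  obtain ⟨u, hu⟩ := ratCode_surjective 1
  obtain ⟨v, hv⟩ := ratCode_surjective (-1)
  -- The code spells out `max (0 * 1 + 0 * 1) (min 1 (1 * f_j + (-1) * f_i))`.
  refine ⟨fun p => 4 * Nat.pair (4 * Nat.pair (Nat.pair z z) (Nat.pair 0 0) + 4)
    (4 * Nat.pair 0 (4 * Nat.pair (Nat.pair u v) (Nat.pair p.2 p.1) + 4) + 3) + 2, by fun_prop,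
    fun i j x => ?_⟩
  simp only [basicFun_max, basicFun_min, basicFun_lin, basicFun_zero, Nat.unpair_pair, hz, hu, hv]
  push_cast
  congr 2 <;> ring

end Increments

-- The sum of the indicators of a sequential test and its increments

section SequentialTest

variable {X : Type*} [MetricSpace X] [CompleteSpace X] [MeasurableSpace X]
  (𝕏 : ComputableMetricSpace X)

theorem IsUniformSchnorrSequentialTest.compReal_measure
    {U : ℕ → (ℕ → ℕ) → FiniteMeasure X → Set X}
    (hU : IsUniformSchnorrSequentialTest 𝕏 baireData (nameSet 𝕏) U) :
    CompReal (nameOracle 𝕏) fun ω n => (ω.1.2 : Measure X).real (U n ω.1.1 ω.1.2) :=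
  (CompReal.of_natProd (D := nameSet 𝕏) (fun _ _ hq => hq)
    (f := fun n q => (q.2 : Measure X).real (U n q.1 q.2))
    (CompReal.of_computableMapOn hU.computable_measure)).pullback
    (Reduces.nameSetPoint 𝕏 (nameSet 𝕏) subset_rfl)

variable [BorelSpace X]

theorem IsUniformSchnorrSequentialTest.lowerReal_indicator
    {U : ℕ → (ℕ → ℕ) → FiniteMeasure X → Set X}
    (hU : IsUniformSchnorrSequentialTest 𝕏 baireData (nameSet 𝕏) U) :
    LowerReal (joinOracle (nameOracle 𝕏) (NamesOn.name (P := 𝕏.data) (D := Set.univ)))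
      fun z n => (U n z.1.1.1 z.1.1.2).indicator (fun _ => (1 : ℝ)) z.2.pt := by
  obtain ⟨W, hW, HW⟩ := hU.sigma_one
  have hnbm := natData_effective.prod (baireData_effective.prod 𝕏.measureData_effective)
  let o := joinOracle (nameOracle 𝕏) (NamesOn.name (P := 𝕏.data) (D := Set.univ))
  let e : nameSet 𝕏 × NamesOn 𝕏.data Set.univ → ℕ →
      NamesOn ((natData.prod (baireData.prod 𝕏.measureData)).prod 𝕏.data) Set.univ := fun z n =>
    ⟨_, ((n, z.1.1), z.2.pt), trivial,
      ((isCauchyName_nat n).prodMk (isCauchyName_of_nameSet 𝕏 z.1)).prodMk z.2.isName⟩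
  have he : Reduces o NamesOn.name e := by
    refine ⟨fun x => Nat.pair (Nat.pair x.1 (Nat.pair
      (Encodable.encode ((List.range x.2.1).map fun i => (x.2.2.getD i 0).unpair.1))
      (x.2.2.getD x.2.1 0).unpair.1)) (x.2.2.getD x.2.1 0).unpair.2, ?_, fun z n i => ?_⟩
    · have := computable_rangeMap (f := fun x : ℕ × ℕ × List ℕ => x.2.1)
        (g := fun y => (y.1.2.2.getD y.2 0).unpair.1) (by fun_prop) (by fun_prop)
      fun_prop
    · have key : (List.range i).map (fun j => ((initSeg (o z) (i + 2)).getD j 0).unpair.1) =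
          initSeg z.1.1.1 i :=
        List.map_congr_left fun j hj => by
          rw [getD_initSeg _ (by have := List.mem_range.1 hj; omega)]
          simp [o, joinOracle, nameOracle]
      dsimp only
      rw [key, getD_initSeg _ (by omega)]
      simp [o, e, joinOracle, nameOracle]
  have hmem : ∀ (z : nameSet 𝕏 × NamesOn 𝕏.data Set.univ) n,
      z.2.pt ∈ U n z.1.1.1 z.1.1.2 ↔ ((n, z.1.1), z.2.pt) ∈ W := fun z n => by
    have := HW (n, z.1.1) z.1.2
    dsimp only at this
    rw [this]; rfl
  have h1 : SemiDec o fun z n => z.2.pt ∈ U n z.1.1.1 z.1.1.2 :=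
    (((hW.semiDec (hnbm.prod 𝕏.data_effective) Set.univ).subst he).comp
      (f := fun n : ℕ => (n, ())) (by fun_prop)).congr hmem
  refine (SemiDec.or (SemiDec.of_lt o (f := fun p : ℕ × ℕ => ratCode p.2) (g := fun _ => 0)
    (by fun_prop) (by fun_prop)) (SemiDec.and (h1.comp (f := fun p : ℕ × ℕ => p.1) (by fun_prop))
    (SemiDec.of_lt o (f := fun p : ℕ × ℕ => ratCode p.2) (g := fun _ => 1)
    (by fun_prop) (by fun_prop)))).congr fun z p => ?_
  by_cases hz : z.2.pt ∈ U p.1 z.1.1.1 z.1.1.2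
  · dsimp only
    rw [Set.indicator_of_mem hz]
    simp only [hz, true_and]
    rw [or_iff_right_of_imp fun h => h.trans zero_lt_one]
    exact_mod_cast Iff.rfl
  · dsimp only
    rw [Set.indicator_of_notMem hz]
    simp only [hz, false_and, or_false]
    exact_mod_cast Iff.rfl

theorem IsUniformSchnorrSequentialTest.lowerENNReal_tsum
    {U : ℕ → (ℕ → ℕ) → FiniteMeasure X → Set X}
    (hU : IsUniformSchnorrSequentialTest 𝕏 baireData (nameSet 𝕏) U) :
    LowerENNReal (joinOracle (nameOracle 𝕏) (NamesOn.name (P := 𝕏.data) (D := Set.univ)))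
      fun z (_ : Unit) => ∑' n, (U n z.1.1.1 z.1.1.2).indicator (fun _ => (1 : ℝ≥0∞)) z.2.pt := by
  have h3 := (lowerENNReal_ofReal (hU.lowerReal_indicator.comp (c := fun p : Unit × ℕ => p.2) (by fun_prop)).sum_range).iSup
  refine h3.congr fun z _ => ?_
  rw [ENNReal.tsum_eq_iSup_nat]
  refine iSup_congr fun N => ?_
  rw [ENNReal.ofReal_sum_of_nonneg fun n _ => Set.indicator_nonneg (fun _ _ => zero_le_one) _]
  refine Finset.sum_congr rfl fun n _ => ?_
  by_cases hz : z.2.pt ∈ U n z.1.1.1 z.1.1.2 <;> simp [hz]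

/-- The indicator is a countable supremum of nonnegative parts of continuous functions, hence
measurable, and the set is its preimage of `1`. -/
theorem IsUniformSchnorrSequentialTest.measurableSet
    {U : ℕ → (ℕ → ℕ) → FiniteMeasure X → Set X}
    (hU : IsUniformSchnorrSequentialTest 𝕏 baireData (nameSet 𝕏) U)
    (n : ℕ) (ω : nameSet 𝕏) : MeasurableSet (U n ω.1.1 ω.1.2) := by
  have h1 := (LowerENNReal.lintegral 𝕏 (compReal_integral_nameSet 𝕏)
    (F := fun ω x n => ENNReal.ofReal ((U n ω.1.1 ω.1.2).indicator (fun _ => (1 : ℝ)) x))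
    (lowerENNReal_ofReal hU.lowerReal_indicator)).1 ω n
  convert h1 (measurableSet_singleton 1)
  ext x
  by_cases hx : x ∈ U n ω.1.1 ω.1.2 <;> simp [hx]

/-- The points in all sets of a sequential test are detected by a sequence of basic functions
with small integrals, found by a search in the name of the measure. -/
theorem IsUniformSchnorrSequentialTest.exists_basicFun
    {U : ℕ → (ℕ → ℕ) → FiniteMeasure X → Set X}
    (hU : IsUniformSchnorrSequentialTest 𝕏 baireData (nameSet 𝕏) U) :
    ∃ (R : List ℕ × ℕ × ℕ → Bool) (c : List ℕ → ℕ), Computable R ∧ Computable c ∧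
      (∀ σ x, 0 ≤ basicFun 𝕏 (c σ) x ∧ basicFun 𝕏 (c σ) x ≤ 1) ∧
      (∀ ω : nameSet 𝕏, ∀ k, ∃ T, FirstHit R ω.1.1 k T) ∧
      (∀ ω : nameSet 𝕏, ∀ k T, FirstHit R ω.1.1 k T →
        ∫ x, basicFun 𝕏 (c (initSeg ω.1.1 T)) x ∂(ω.1.2 : Measure X) ≤ (2 : ℝ)⁻¹ ^ k) ∧
      ∀ ω : nameSet 𝕏, ∀ x ∈ ⋂ n, U n ω.1.1 ω.1.2, ∀ T : ℕ → ℕ, (∀ k, FirstHit R ω.1.1 k (T k)) →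
        ∑' k, ENNReal.ofReal (basicFun 𝕏 (c (initSeg ω.1.1 (T k))) x) = ∞ := by
  have hμ := compReal_integral_nameSet 𝕏
  let V : nameSet 𝕏 → X → Unit → ℝ≥0∞ := fun ω x _ =>
    ∑' n, (U n ω.1.1 ω.1.2).indicator (fun _ => (1 : ℝ≥0∞)) x
  have hV : LowerENNReal (joinOracle (nameOracle 𝕏) (NamesOn.name (P := 𝕏.data) (D := Set.univ)))
      fun z a => V z.1 z.2.pt a := hU.lowerENNReal_tsum
  obtain ⟨code, hcode, h0, hmono, hsup⟩ := hV.exists_basicFun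
  let f : nameSet 𝕏 → ℕ → X → ℝ := fun ω s => basicFun 𝕏 (code (initSeg ω.1.1 s, ()))
  have hint : ∀ (ω : nameSet 𝕏) s, Integrable (f ω s) (ω.1.2 : Measure X) := fun ω s =>
    integrable_basicFun 𝕏 _ _
  have hUmeas := hU.measurableSet
  have hVint : ∀ ω : nameSet 𝕏, HasSum (fun n => (ω.1.2 : Measure X).real (U n ω.1.1 ω.1.2))
      (∫⁻ x, V ω x () ∂(ω.1.2 : Measure X)).toReal ∧
      ∫⁻ x, V ω x () ∂(ω.1.2 : Measure X) ≠ ∞ := fun ω => by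
    have h1 : ∫⁻ x, V ω x () ∂(ω.1.2 : Measure X) =
        ∑' n, (ω.1.2 : Measure X) (U n ω.1.1 ω.1.2) := by
      simp only [V]
      rw [lintegral_tsum fun n => (measurable_const.indicator (hUmeas n ω)).aemeasurable]
      refine tsum_congr fun n => ?_
      rw [lintegral_indicator_const (hUmeas n ω), one_mul]
    have h2 : ∑' n, (ω.1.2 : Measure X) (U n ω.1.1 ω.1.2) ≠ ∞ := by
      refine ne_top_of_le_ne_top ?_ (ENNReal.tsum_le_tsum fun n => hU.measure_le n _ _ ω.2)
      rw [ENNReal.tsum_geometric]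
      simp
    rw [h1]
    refine ⟨?_, h2⟩
    rw [ENNReal.tsum_toReal_eq fun n => measure_ne_top _ _]
    exact ENNReal.hasSum_toReal h2
  have hJ : CompReal (nameOracle 𝕏) fun ω (_ : Unit) =>
      (∫⁻ x, V ω x () ∂(ω.1.2 : Measure X)).toReal := by
    refine CompReal.hasSum (g := fun ω (p : Unit × ℕ) => (ω.1.2 : Measure X).real (U p.2 ω.1.1 ω.1.2))
      (hU.compReal_measure.comp (c := fun p : Unit × ℕ => p.2) (by fun_prop)) 1
      (fun ω _ n => ?_) fun ω _ => (hVint ω).1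
    rw [abs_of_nonneg measureReal_nonneg]
    have h2 := ENNReal.toReal_mono (by simp) (hU.measure_le n _ _ ω.2)
    simpa [Measure.real] using h2
  have hfint : CompReal (nameOracle 𝕏) fun ω s => ∫ x, f ω s x ∂(ω.1.2 : Measure X) :=
    ((hμ.comp (c := fun p : (Unit × ℕ) × ℕ => p.2) (by fun_prop)).subst_val
      (ν := fun ω p => code (initSeg ω.1.1 p.2, p.1)) (SemiDec.val_initSeg _ hcode)).comp
      (c := fun s : ℕ => ((), s)) (by fun_prop)
  have hfmono : ∀ ω : nameSet 𝕏, Monotone fun s => ∫ x, f ω s x ∂(ω.1.2 : Measure X) :=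
    fun ω s s' hss' => integral_mono (hint ω s) (hint ω s') fun x => hmono ω.1.1 () x hss'
  have hfJ : ∀ (ω : nameSet 𝕏) s, ∫ x, f ω s x ∂(ω.1.2 : Measure X) ≤
      (∫⁻ x, V ω x () ∂(ω.1.2 : Measure X)).toReal := fun ω s => by
    rw [← ENNReal.ofReal_le_iff_le_toReal (hVint ω).2, ← iSup_ofReal_integral_basicFun 𝕏
      (fun s => h0 (initSeg ω.1.1 s) ()) (hmono ω.1.1 ()) (hsup ω ())]
    exact le_iSup (fun s => ENNReal.ofReal (∫ x, f ω s x ∂(ω.1.2 : Measure X))) s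
  -- At the stage sought, less than `2^{-k}` of the integral of `V` is missing. Requiring `k ≤ s`
  -- forces the chosen stages to exhaust `V` as `k` grows.
  have hS : SemiDec (nameOracle 𝕏) fun ω (p : ℕ × ℕ) => Nat.ble p.1 p.2 = true ∧
      (∫⁻ x, V ω x () ∂(ω.1.2 : Measure X)).toReal <
        ∫ x, f ω p.2 x ∂(ω.1.2 : Measure X) + ((2 : ℚ)⁻¹ ^ p.1 : ℚ) :=
    (SemiDec.of_computable _ (by fun_prop)).and
      (LowerReal.lt (hJ.comp (c := fun _ : ℕ × ℕ => ()) (by fun_prop)).2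
        ((hfint.comp (c := fun p : ℕ × ℕ => p.2) (by fun_prop)).1.add
          (LowerReal.of_rat _ (by fun_prop))))
  have hSex : ∀ ω k, ∃ s, Nat.ble k s = true ∧
      (∫⁻ x, V ω x () ∂(ω.1.2 : Measure X)).toReal <
        ∫ x, f ω s x ∂(ω.1.2 : Measure X) + ((2 : ℚ)⁻¹ ^ k : ℚ) := fun ω k => by
    by_contra hno
    push Not at hno
    have hk : (0 : ℝ) < ((2 : ℚ)⁻¹ ^ k : ℚ) := by push_cast; positivity
    have h1 : ∀ s, ∫ x, f ω s x ∂(ω.1.2 : Measure X) ≤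
        (∫⁻ x, V ω x () ∂(ω.1.2 : Measure X)).toReal - ((2 : ℚ)⁻¹ ^ k : ℚ) := fun s => by
      have h2 := hno (max k s) (Nat.ble_eq ▸ le_max_left _ _)
      have h3 := hfmono ω (le_max_right k s)
      dsimp only at h3
      linarith
    have h2 : (0 : ℝ) ≤ ∫ x, f ω 0 x ∂(ω.1.2 : Measure X) := integral_nonneg (h0 _ _)
    have h3 : ∫⁻ x, V ω x () ∂(ω.1.2 : Measure X) ≤ ENNReal.ofReal
        ((∫⁻ x, V ω x () ∂(ω.1.2 : Measure X)).toReal - ((2 : ℚ)⁻¹ ^ k : ℚ)) := by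
      conv_lhs => rw [← iSup_ofReal_integral_basicFun 𝕏
        (fun s => h0 (initSeg ω.1.1 s) ()) (hmono ω.1.1 ()) (hsup ω ())]
      exact iSup_le fun s => ENNReal.ofReal_le_ofReal (h1 s)
    have h4 := ENNReal.toReal_le_of_le_ofReal (h2.trans (h1 0)) h3
    linarith
  obtain ⟨R₀, hR₀, hR₀1, hR₀2⟩ := hS.exists_selector
  -- This search is posed for arbitrary `h`, name or not, because the integral test will run it
  -- everywhere. It seeks the first hits for `k` and `k + 1` together; by their uniqueness
  -- consecutive increments share an endpoint.
  have hS' : SemiDec (fun h : ℕ → ℕ => h) fun h (p : ℕ × ℕ) =>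
      FirstHit R₀ h p.1 p.2.unpair.1 ∧ FirstHit R₀ h (p.1 + 1) p.2.unpair.2 :=
    ((SemiDec.firstHit _ hR₀).comp (f := fun p : ℕ × ℕ => (p.1, p.2.unpair.1)) (by fun_prop)).and
      ((SemiDec.firstHit _ hR₀).comp (f := fun p : ℕ × ℕ => (p.1 + 1, p.2.unpair.2)) (by fun_prop))
  obtain ⟨R, hR, hR1, hR2⟩ := hS'.exists_selector
  obtain ⟨inc, hinc, Hinc⟩ := exists_incrementCode 𝕏
  -- The length of the prefix is the hit `T`. Its second component codes the hits for `k` and `k +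
  -- 1`, and the second component of each of these is a stage. All these numbers are at most `T`, so
  -- the prefix is long enough.
  let c : List ℕ → ℕ := fun σ => inc (code (σ.take σ.length.unpair.2.unpair.1.unpair.2, ()),
    code (σ.take σ.length.unpair.2.unpair.2.unpair.2, ()))
  have hc : ∀ (ω : nameSet 𝕏) T x, basicFun 𝕏 (c (initSeg ω.1.1 T)) x =
      max 0 (min 1 (f ω T.unpair.2.unpair.2.unpair.2 x - f ω T.unpair.2.unpair.1.unpair.2 x)) := by
    intro ω T x
    simp only [c, Hinc, length_initSeg]
    have h1 := Nat.unpair_right_le T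
    have h2 := Nat.unpair_left_le T.unpair.2
    have h3 := Nat.unpair_right_le T.unpair.2
    have h4 := Nat.unpair_right_le T.unpair.2.unpair.1
    have h5 := Nat.unpair_right_le T.unpair.2.unpair.2
    rw [take_initSeg _ (by omega), take_initSeg _ (by omega)]
  refine ⟨R, c, hR, by fun_prop, fun σ x => ?_, fun ω k => ?_, fun ω k T hT => ?_,
    fun ω x hx T hT => ?_⟩
  · simp only [c, Hinc]
    exact ⟨le_max_left _ _, max_le zero_le_one (min_le_left _ _)⟩
  · obtain ⟨T, hT⟩ := exists_firstHit (hR₀2 ω k (hSex ω k))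
    obtain ⟨T', hT'⟩ := exists_firstHit (hR₀2 ω (k + 1) (hSex ω (k + 1)))
    exact exists_firstHit (hR2 _ k ⟨Nat.pair T T', by simpa using ⟨hT, hT'⟩⟩)
  · obtain ⟨h1, h2⟩ := hR1 _ _ _ hT.1
    have h3 := (hR₀1 ω _ _ h1.1).2
    simp only [hc]
    -- The two stages come from separate searches and may be in reverse order; then the clamped
    -- increment vanishes.
    rcases le_total T.unpair.2.unpair.1.unpair.2 T.unpair.2.unpair.2.unpair.2 with hle | hle
    · calc _ ≤ ∫ x, (f ω T.unpair.2.unpair.2.unpair.2 x - f ω T.unpair.2.unpair.1.unpair.2 x)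
            ∂(ω.1.2 : Measure X) := by
            refine integral_mono ?_ ((hint _ _).sub (hint _ _)) fun x => ?_
            · simp only [← hc]
              exact integrable_basicFun 𝕏 _ _
            · exact max_le (sub_nonneg.2 (hmono ω.1.1 () x hle)) (min_le_right _ _)
        _ ≤ (2 : ℝ)⁻¹ ^ k := by
            rw [integral_sub (hint _ _) (hint _ _)]
            have := hfJ ω T.unpair.2.unpair.2.unpair.2
            push_cast at h3
            linarith
    · have : ∀ x, max 0 (min 1 (f ω T.unpair.2.unpair.2.unpair.2 x -
          f ω T.unpair.2.unpair.1.unpair.2 x)) = 0 := fun x =>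
        max_eq_left ((min_le_right _ _).trans (sub_nonpos.2 (hmono ω.1.1 () x hle)))
      simp only [this, integral_zero]
      positivity
  · have hVx : V ω x () = ∞ := by
      simp only [V]
      have : ∀ n, (U n ω.1.1 ω.1.2).indicator (fun _ => (1 : ℝ≥0∞)) x = 1 := fun n =>
        Set.indicator_of_mem (Set.mem_iInter.1 hx n) _
      simp only [this]
      exact ENNReal.tsum_const_eq_top_of_ne_zero one_ne_zero
    have hstep : ∀ k, FirstHit R₀ ω.1.1 k (T k).unpair.2.unpair.1 ∧
        (T k).unpair.2.unpair.2 = (T (k + 1)).unpair.2.unpair.1 := fun k =>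
      ⟨(hR1 _ _ _ (hT k).1).1, (hR1 _ _ _ (hT k).1).2.unique (hR1 _ _ _ (hT (k + 1)).1).1⟩
    have hG : Tendsto (fun k => f ω (T k).unpair.2.unpair.1.unpair.2 x) atTop atTop := by
      refine tendsto_atTop_mono (f := fun k => f ω k x) (fun k => hmono ω.1.1 () x
        (Nat.le_of_ble_eq_true (hR₀1 ω _ _ (hstep k).1.1).1)) (tendsto_atTop_atTop_of_monotone
        (hmono ω.1.1 () x) fun b => ?_)
      have h1 : ENNReal.ofReal b < ⨆ s, ENNReal.ofReal (f ω s x) := by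
        rw [show ⨆ s, ENNReal.ofReal (f ω s x) = V ω x () from hsup ω () x, hVx]
        exact ENNReal.ofReal_lt_top
      obtain ⟨s, hs⟩ := lt_iSup_iff.1 h1
      exact ⟨s, (ENNReal.ofReal_lt_ofReal_iff'.1 hs).1.le⟩
    rw [← tsum_increments_eq_top hG]
    refine tsum_congr fun k => ?_
    rw [hc, (hstep k).2]

end SequentialTest

/-! ## From sequential tests to integral tests -/

section FirstHit

variable {Ω : Type*} {α : Type*} [Primcodable α] {o : Ω → ℕ → ℕ}

/-- A value that depends on the result of a search is computable, even where the search does not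
terminate, if `κ` vanishes only where it terminates and the value is `0` after long searches
where `κ` is positive. -/
theorem CompReal.of_firstHit {R : List ℕ × α × ℕ → Bool} {h : Ω → ℕ → ℕ}
    (hhit : SemiDec o fun ω (p : α × ℕ) => FirstHit R (h ω) p.1 p.2)
    (hno : SemiDec o fun ω (p : α × ℕ) => ∀ i < p.2, ¬ FirstHit R (h ω) p.1 i)
    {q : Ω → α × ℕ → ℝ} (hq : CompReal o q) (hq0 : ∀ ω p, 0 ≤ q ω p)
    {κ : Ω → ℝ} (hκ : CompReal o fun ω (_ : Unit) => κ ω) (hκ0 : ∀ ω, 0 ≤ κ ω)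
    (hex : ∀ ω, κ ω = 0 → ∀ a, ∃ T, FirstHit R (h ω) a T)
    (hqκ : ∀ ω a T, 1 < 2 ^ T * κ ω → q ω (a, T) = 0)
    {f : Ω → α → ℝ} (hf1 : ∀ ω a T, FirstHit R (h ω) a T → f ω a = q ω (a, T))
    (hf0 : ∀ ω a, (∀ T, ¬ FirstHit R (h ω) a T) → f ω a = 0) : CompReal o f := by
  have hnn : ∀ ω a, 0 ≤ f ω a := fun ω a => by
    by_cases H : ∃ T, FirstHit R (h ω) a T
    · obtain ⟨T, hT⟩ := H
      rw [hf1 ω a T hT]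
      exact hq0 _ _
    · rw [hf0 ω a (not_exists.1 H)]
  have hhit' := hhit.comp (f := fun p : (α × ℕ) × ℕ => (p.1.1, p.2)) (by fun_prop)
  have hq' := hq.comp (c := fun p : (α × ℕ) × ℕ => (p.1.1, p.2)) (by fun_prop)
  constructor
  · refine ((SemiDec.of_lt o (f := fun p : α × ℕ => ratCode p.2) (g := fun _ => 0)
      (by fun_prop) (by fun_prop)).or (hhit'.and (hq'.1.rat_lt
      (q := fun p : (α × ℕ) × ℕ => ratCode p.1.2) (by fun_prop))).ex).congr fun ω p => ?_
    dsimp only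
    constructor
    · intro hlt
      by_cases H : ∃ T, FirstHit R (h ω) p.1 T
      · obtain ⟨T, hT⟩ := H
        rw [hf1 ω _ T hT] at hlt
        exact Or.inr ⟨T, hT, hlt⟩
      · rw [hf0 ω _ (not_exists.1 H)] at hlt
        exact Or.inl (by exact_mod_cast hlt)
    · rintro (hlt | ⟨T, hT, hlt⟩)
      · have h1 : (ratCode p.2 : ℝ) < 0 := by exact_mod_cast hlt
        exact h1.trans_le (hnn _ _)
      · rwa [hf1 ω _ T hT]
  · have h1 := (hκ.comp (c := fun _ : (α × ℕ) × ℕ => ()) (by fun_prop)).rat_mul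
      (c := fun p => (2 : ℚ) ^ p.2) (by fun_prop)
    refine ((hhit'.and (hq'.2.rat_lt (q := fun p : (α × ℕ) × ℕ => ratCode p.1.2)
      (by fun_prop))).ex.or ((SemiDec.of_lt o (f := fun p : α × ℕ => ratCode p.2) (g := fun _ => 0)
      (by fun_prop) (by fun_prop)).and ((hno.comp (f := fun p : (α × ℕ) × ℕ => (p.1.1, p.2))
      (by fun_prop)).and (h1.1.rat_lt (q := fun _ => 1) (by fun_prop))).ex)).congr fun ω p => ?_
    dsimp only
    push_cast
    constructor
    · intro hlt
      by_cases H : ∃ T, FirstHit R (h ω) p.1 T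
      · obtain ⟨T, hT⟩ := H
        rw [hf1 ω _ T hT] at hlt
        exact Or.inl ⟨T, hT, hlt⟩
      · rw [hf0 ω _ (not_exists.1 H), neg_zero] at hlt
        refine Or.inr ⟨by exact_mod_cast hlt, ?_⟩
        have h2 : 0 < κ ω := (hκ0 ω).lt_of_ne' fun h3 => H (hex ω h3 _)
        obtain ⟨T, hT⟩ := pow_unbounded_of_one_lt (κ ω)⁻¹ one_lt_two
        refine ⟨T, fun i _ => not_exists.1 H i, ?_⟩
        rwa [inv_lt_iff_one_lt_mul₀ h2] at hT
    · rintro (⟨T, hT, hlt⟩ | ⟨hlt, T, hT, hκT⟩)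
      · rwa [hf1 ω _ T hT]
      -- No hit occurs before `T`, and `2^T κ > 1` makes the value of any later hit `0`; the value
      -- without a hit is also `0`.
      · have h2 : (ratCode p.2 : ℝ) < 0 := by exact_mod_cast hlt
        suffices hz : f ω p.1 = 0 by rwa [hz, neg_zero]
        by_cases H : ∃ T, FirstHit R (h ω) p.1 T
        · obtain ⟨T', hT'⟩ := H
          rw [hf1 ω _ T' hT']
          have h3 : T ≤ T' := not_lt.1 fun h4 => hT T' h4 hT'
          exact hqκ _ _ _ (hκT.trans_le (mul_le_mul_of_nonneg_right
            (pow_le_pow_right₀ one_le_two h3) (hκ0 ω)))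
        · exact hf0 ω _ (not_exists.1 H)

end FirstHit

-- Search results with cut-offs

section CutoffPiece

variable {X : Type*} [MetricSpace X] [CompleteSpace X] [MeasurableSpace X]
  (𝕏 : ComputableMetricSpace X)

open Classical in
/-- The function found by the search `R`, cut off where its integral or the length of the search is
too large; `κ` is positive where the search may fail to terminate. -/
noncomputable def cutoffPiece (R : List ℕ × ℕ × ℕ → Bool) (c : List ℕ → ℕ) (κ : (ℕ → ℕ) × FiniteMeasure X → ℝ)
    (p : (ℕ → ℕ) × FiniteMeasure X) (x : X) (k : ℕ) : ℝ :=
  if H : ∃ T, FirstHit R p.1 k T then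
    max 0 (min (basicFun 𝕏 (c (initSeg p.1 H.choose)) x)
      (min (2 - 2 ^ k * ∫ y, basicFun 𝕏 (c (initSeg p.1 H.choose)) y ∂(p.2 : Measure X))
        (1 - 2 ^ H.choose * κ p)))
  else 0

variable {R : List ℕ × ℕ × ℕ → Bool} {c : List ℕ → ℕ} {κ : (ℕ → ℕ) × FiniteMeasure X → ℝ}

theorem cutoffPiece_of_firstHit {p : (ℕ → ℕ) × FiniteMeasure X} {k T : ℕ}
    (hT : FirstHit R p.1 k T) (x : X) : cutoffPiece 𝕏 R c κ p x k =
      max 0 (min (basicFun 𝕏 (c (initSeg p.1 T)) x)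
        (min (2 - 2 ^ k * ∫ y, basicFun 𝕏 (c (initSeg p.1 T)) y ∂(p.2 : Measure X))
          (1 - 2 ^ T * κ p))) := by
  have H : ∃ T, FirstHit R p.1 k T := ⟨T, hT⟩
  rw [cutoffPiece, dif_pos H, H.choose_spec.unique hT]

theorem cutoffPiece_of_not {p : (ℕ → ℕ) × FiniteMeasure X} {k : ℕ}
    (hT : ∀ T, ¬ FirstHit R p.1 k T) (x : X) : cutoffPiece 𝕏 R c κ p x k = 0 := by
  rw [cutoffPiece, dif_neg (not_exists.2 hT)]

theorem cutoffPiece_nonneg (p : (ℕ → ℕ) × FiniteMeasure X) (x : X) (k : ℕ) :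
    0 ≤ cutoffPiece 𝕏 R c κ p x k := by
  rw [cutoffPiece]
  split_ifs
  · exact le_max_left _ _
  · exact le_rfl

theorem cutoffPiece_le_one (hc : ∀ σ x, 0 ≤ basicFun 𝕏 (c σ) x ∧ basicFun 𝕏 (c σ) x ≤ 1)
    (p : (ℕ → ℕ) × FiniteMeasure X) (x : X) (k : ℕ) : cutoffPiece 𝕏 R c κ p x k ≤ 1 := by
  rw [cutoffPiece]
  split_ifs
  · exact max_le zero_le_one ((min_le_left _ _).trans (hc _ _).2)
  · exact zero_le_one

end CutoffPiece

-- The integral test built from the cut-off pieces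

section SequentialToIntegral

variable {X : Type*} [MetricSpace X] [CompleteSpace X] [MeasurableSpace X] [BorelSpace X]
  (𝕏 : ComputableMetricSpace X)

variable {R : List ℕ × ℕ × ℕ → Bool} {c : List ℕ → ℕ} {κ : (ℕ → ℕ) × FiniteMeasure X → ℝ}

/-- Integrals of computable functions with values in `[0, 1]` are computable. -/
theorem CompReal.lintegral {Ω : Type*} {α : Type*} [Primcodable α] {o : Ω → ℕ → ℕ}
    {μ : Ω → FiniteMeasure X}
    (hμ : CompReal o fun ω i => ∫ x, basicFun 𝕏 i x ∂(μ ω : Measure X)) {f : Ω → X → α → ℝ}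
    (hf : CompReal (joinOracle o (NamesOn.name (P := 𝕏.data) (D := Set.univ)))
      fun z a => f z.1 z.2.pt a) (h0 : ∀ ω x a, 0 ≤ f ω x a) (h1 : ∀ ω x a, f ω x a ≤ 1) :
    (∀ ω a, Measurable fun x => ENNReal.ofReal (f ω x a)) ∧
      CompReal o fun ω a => (∫⁻ x, ENNReal.ofReal (f ω x a) ∂(μ ω : Measure X)).toReal := by
  have hfin : ∀ ω (g : X → ℝ), (∀ x, g x ≤ 1) →
      ∫⁻ x, ENNReal.ofReal (g x) ∂(μ ω : Measure X) ≠ ∞ := fun ω g hg => by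
    refine ne_top_of_le_ne_top ?_ (lintegral_mono fun x => ENNReal.ofReal_le_ofReal (hg x))
    rw [lintegral_const]
    exact ENNReal.mul_ne_top ENNReal.ofReal_ne_top (measure_ne_top _ _)
  have h2 := LowerENNReal.lintegral 𝕏 hμ (F := fun ω x a => ENNReal.ofReal (f ω x a))
    (lowerENNReal_ofReal hf.1)
  -- Upper bounds of the integral come from lower bounds of `∫ (1 - f)` and upper bounds of the
  -- total mass, which is the integral of the basic function of code `0`.
  have h3 := LowerENNReal.lintegral 𝕏 hμ (F := fun ω x a => ENNReal.ofReal (1 - f ω x a))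
    (lowerENNReal_ofReal ((CompReal.of_rat _ (q := fun _ : α => 1) (by fun_prop)).sub hf).1
      |>.congr fun z a => by simp)
  refine ⟨h2.1, h2.2.toReal fun ω a => hfin ω _ fun x => h1 ω x a,
    ((h3.2.toReal fun ω a => hfin ω _ fun x => by linarith [h0 ω x a]).add
    (hμ.comp (c := fun _ : α => 0) (by fun_prop)).2).congr fun ω a => ?_⟩
  have h4 : ∫⁻ x, ENNReal.ofReal (f ω x a) ∂(μ ω : Measure X) +
      ∫⁻ x, ENNReal.ofReal (1 - f ω x a) ∂(μ ω : Measure X) = (μ ω : Measure X) Set.univ := by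
    rw [← lintegral_add_left (h2.1 ω a), ← lintegral_one]
    refine lintegral_congr fun x => ?_
    rw [← ENNReal.ofReal_add (h0 _ _ _) (by linarith [h1 ω x a]), add_sub_cancel, ENNReal.ofReal_one]
  have h5 := congrArg ENNReal.toReal h4
  rw [ENNReal.toReal_add (hfin ω _ fun x => h1 ω x a)
    (hfin ω _ fun x => by linarith [h0 ω x a])] at h5
  simp only [basicFun_zero, integral_const, smul_eq_mul, mul_one, Measure.real]
  linarith

/-- Either the function found has integral at most `2 * 2^{-k}`, or the cap `2 - 2^k ∫` is not
positive and the piece vanishes identically. The bound therefore holds for every measure, whether or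
not `h` is a name of it. -/
theorem lintegral_cutoffPiece_le (hc : ∀ σ x, 0 ≤ basicFun 𝕏 (c σ) x ∧ basicFun 𝕏 (c σ) x ≤ 1)
    (p : (ℕ → ℕ) × FiniteMeasure X) (k : ℕ) :
    ∫⁻ x, ENNReal.ofReal (cutoffPiece 𝕏 R c κ p x k) ∂(p.2 : Measure X) ≤
      ENNReal.ofReal (2 * (2 : ℝ)⁻¹ ^ k) := by
  by_cases H : ∃ T, FirstHit R p.1 k T
  · obtain ⟨T, hT⟩ := H
    simp only [cutoffPiece_of_firstHit 𝕏 hT]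
    rcases le_or_gt (∫ y, basicFun 𝕏 (c (initSeg p.1 T)) y ∂(p.2 : Measure X))
      (2 * (2 : ℝ)⁻¹ ^ k) with hle | hlt
    · refine le_trans (lintegral_mono fun x => ENNReal.ofReal_le_ofReal
        (max_le (hc (initSeg p.1 T) x).1 (min_le_left _ _))) ?_
      rw [← ofReal_integral_eq_lintegral_ofReal (integrable_basicFun 𝕏 _ _)
        (.of_forall fun x => (hc _ x).1)]
      exact ENNReal.ofReal_le_ofReal hle
    · have h1 : 2 - 2 ^ k * ∫ y, basicFun 𝕏 (c (initSeg p.1 T)) y ∂(p.2 : Measure X) ≤ 0 := by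
        rw [inv_pow, ← div_eq_mul_inv, div_lt_iff₀ (by positivity)] at hlt
        linarith
      have h2 : ∀ x, max 0 (min (basicFun 𝕏 (c (initSeg p.1 T)) x)
          (min (2 - 2 ^ k * ∫ y, basicFun 𝕏 (c (initSeg p.1 T)) y ∂(p.2 : Measure X))
          (1 - 2 ^ T * κ p))) = 0 := fun x =>
        max_eq_left ((min_le_right _ _).trans ((min_le_left _ _).trans h1))
      simp [h2]
  · simp [cutoffPiece_of_not 𝕏 (not_exists.1 H)]

/-- `CompReal.of_firstHit` applies because `1 - 2^T κ` is negative as soon as `2^T κ > 1`, so a late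
or missing hit gives `0`. -/
theorem compReal_cutoffPiece (hR : Computable R) (hc : Computable c)
    (hκ : CompReal (NamesOn.name (P := baireData.prod 𝕏.measureData) (D := Set.univ))
      fun ω (_ : Unit) => κ ω.pt) (hκ0 : ∀ p, 0 ≤ κ p)
    (hex : ∀ p, κ p = 0 → ∀ k, ∃ T, FirstHit R p.1 k T) :
    CompReal (joinOracle (NamesOn.name (P := baireData.prod 𝕏.measureData) (D := Set.univ))
      (NamesOn.name (P := 𝕏.data) (D := Set.univ)))
      fun z k => cutoffPiece 𝕏 R c κ z.1.pt z.2.pt k := by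
  have hM := 𝕏.measureData_effective
  let oB := NamesOn.name (P := baireData.prod 𝕏.measureData) (D := Set.univ)
  let oX := NamesOn.name (P := 𝕏.data) (D := Set.univ)
  have hpull : ∀ {P : (ℕ → ℕ) → ℕ × ℕ → Prop}, SemiDec (fun h => h) P →
      SemiDec oB fun ω a => P ω.pt.1 a := fun hP =>
    (hP.pullback (Reduces.baire Set.univ)).pullback (Reduces.namesFst baireData_effective
      (D' := Set.univ) fun _ _ => trivial)
  have hval : SemiDec oB fun ω (p : ℕ × ℕ) => c (initSeg ω.pt.1 p.1) = p.2 :=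
    hpull ((SemiDec.of_initSeg (fun h : ℕ → ℕ => h) (R := fun x : List ℕ × ℕ × ℕ =>
      Nat.beq (c x.1) x.2.2) (k := fun p => p.1) (by fun_prop) (by fun_prop)).congr
      fun ω p => by rw [Nat.beq_eq])
  have hint : CompReal oB fun ω T =>
      ∫ y, basicFun 𝕏 (c (initSeg ω.pt.1 T)) y ∂(ω.pt.2 : Measure X) :=
    (((compReal_integral_basicFun 𝕏 Set.univ).pullback (Reduces.namesSnd (P := baireData)
      hM (D := Set.univ) (D' := Set.univ) fun _ _ => trivial)).comp (c := fun p : ℕ × ℕ => p.2)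
      (by fun_prop)).subst_val (ν := fun ω T => c (initSeg ω.pt.1 T)) hval
  have hQ : CompReal oB fun ω (p : ℕ × ℕ) =>
      min (2 - 2 ^ p.1 * ∫ y, basicFun 𝕏 (c (initSeg ω.pt.1 p.2)) y ∂(ω.pt.2 : Measure X))
        (1 - 2 ^ p.2 * κ ω.pt) := by
    refine (((CompReal.of_rat oB (q := fun _ : ℕ × ℕ => 2) (by fun_prop)).sub ((hint.comp
      (c := fun p : ℕ × ℕ => p.2) (by fun_prop)).rat_mul (c := fun p => 2 ^ p.1)
      (by fun_prop))).min ((CompReal.of_rat oB (q := fun _ : ℕ × ℕ => 1) (by fun_prop)).sub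
      ((hκ.comp (c := fun _ : ℕ × ℕ => ()) (by fun_prop)).rat_mul (c := fun p => 2 ^ p.2)
      (by fun_prop)))).congr fun ω p => ?_
    push_cast
    rfl
  have hE : CompReal (joinOracle oB oX) fun z T => basicFun 𝕏 (c (initSeg z.1.pt.1 T)) z.2.pt :=
    (((compReal_basicFun 𝕏 Set.univ).pullback (Reduces.joinSnd oB oX)).comp
      (c := fun p : ℕ × ℕ => p.2) (by fun_prop)).subst_val
      (ν := fun z T => c (initSeg z.1.pt.1 T)) (hval.pullback (Reduces.joinFst oB oX))
  have hq := (CompReal.of_rat (joinOracle oB oX) (q := fun _ : ℕ × ℕ => 0) (by fun_prop)).max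
    ((hE.comp (c := fun p : ℕ × ℕ => p.2) (by fun_prop)).min
      (hQ.pullback (Reduces.joinFst oB oX)))
  refine CompReal.of_firstHit (h := fun z => z.1.pt.1) (κ := fun z => κ z.1.pt)
    ((hpull (SemiDec.firstHit _ hR)).pullback (Reduces.joinFst oB oX))
    ((hpull (SemiDec.forall_lt_not _ hR)).pullback (Reduces.joinFst oB oX)) hq
    (fun z p => ?_) (hκ.pullback (Reduces.joinFst oB oX)) (fun z => hκ0 _) (fun z => hex _)
    (fun z k T hT => ?_) (fun z k T hT => ?_) (fun z k hT => cutoffPiece_of_not 𝕏 hT _)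
  · push_cast
    exact le_max_left _ _
  · push_cast
    exact max_eq_left ((min_le_right _ _).trans ((min_le_right _ _).trans (by linarith)))
  · rw [cutoffPiece_of_firstHit 𝕏 hT]
    push_cast
    rfl

theorem coe_tsum_ofReal {u : ℕ → ℝ} (hu : ∀ k, 0 ≤ u k) :
    ((∑' k, ENNReal.ofReal (u k) : ℝ≥0∞) : EReal) =
      ⨆ n, ((∑ k ∈ Finset.range n, u k : ℝ) : EReal) := by
  rw [ENNReal.tsum_eq_iSup_nat, Monotone.map_ciSup_of_continuousAt
    continuous_coe_ennreal_ereal.continuousAt (fun _ _ h => EReal.coe_ennreal_le_coe_ennreal_iff.2 h)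
    (OrderTop.bddAbove _)]
  refine iSup_congr fun n => ?_
  rw [← ENNReal.ofReal_sum_of_nonneg fun k _ => hu k, EReal.coe_ennreal_ofReal,
    max_eq_left (Finset.sum_nonneg fun k _ => hu k)]

theorem lowerSemicomputable_cutoffPiece (hR : Computable R) (hc : Computable c)
    (hκ : CompReal (NamesOn.name (P := baireData.prod 𝕏.measureData) (D := Set.univ))
      fun ω (_ : Unit) => κ ω.pt) (hκ0 : ∀ p, 0 ≤ κ p)
    (hex : ∀ p, κ p = 0 → ∀ k, ∃ T, FirstHit R p.1 k T) :
    LowerSemicomputable (baireData.prod (𝕏.measureData.prod 𝕏.data)) fun s =>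
      ((∑' k, ENNReal.ofReal (cutoffPiece 𝕏 R c κ (s.1, s.2.1) s.2.2 k) : ℝ≥0∞) : EReal) := by
  have hM := 𝕏.measureData_effective
  let oB := NamesOn.name (P := baireData.prod 𝕏.measureData) (D := Set.univ)
  have hp := compReal_cutoffPiece 𝕏 hR hc hκ hκ0 hex
  let e : NamesOn (baireData.prod (𝕏.measureData.prod 𝕏.data)) Set.univ →
      NamesOn (baireData.prod 𝕏.measureData) Set.univ × NamesOn 𝕏.data Set.univ := fun ω =>
    (⟨_, (ω.pt.1, ω.pt.2.1), trivial, (ω.isName.fst baireData_effective).prodMk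
      ((ω.isName.snd (hM.prod 𝕏.data_effective)).fst hM)⟩,
      ⟨_, ω.pt.2.2, trivial, (ω.isName.snd (hM.prod 𝕏.data_effective)).snd 𝕏.data_effective⟩)
  have he : Reduces NamesOn.name (joinOracle oB NamesOn.name) fun ω (_ : Unit) => e ω :=
    Reduces.of_pointwise (F := fun x => Nat.pair (Nat.pair x.2.unpair.1 x.2.unpair.2.unpair.1)
      x.2.unpair.2.unpair.2) (by fun_prop) fun _ _ _ => rfl
  have h1 : CompReal (NamesOn.name (P := baireData.prod (𝕏.measureData.prod 𝕏.data))
      (D := Set.univ)) fun ω k => cutoffPiece 𝕏 R c κ (ω.pt.1, ω.pt.2.1) ω.pt.2.2 k :=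
    hp.pullback he
  have h2 := (h1.comp (c := fun p : Unit × ℕ => p.2) (by fun_prop)).sum_range
  have h3 := h2.comp (c := fun n : ℕ => ((), n)) (by fun_prop)
  have h4 : ∀ s : (ℕ → ℕ) × FiniteMeasure X × X,
      ((∑' k, ENNReal.ofReal (cutoffPiece 𝕏 R c κ (s.1, s.2.1) s.2.2 k) : ℝ≥0∞) : EReal) =
      ⨆ n, ((∑ k ∈ Finset.range n, cutoffPiece 𝕏 R c κ (s.1, s.2.1) s.2.2 k : ℝ) : EReal) :=
    fun s => coe_tsum_ofReal fun k => cutoffPiece_nonneg 𝕏 _ _ _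
  exact ⟨fun p => ∑ k ∈ Finset.range p.1, cutoffPiece 𝕏 R c κ (p.2.1, p.2.2.1) p.2.2.2 k,
    CompReal.computableMapOn (CompReal.natProd (baireData_effective.prod
    (hM.prod 𝕏.data_effective)) (D := Set.univ) (fun _ _ => trivial)
    (f := fun n s => ∑ k ∈ Finset.range n, cutoffPiece 𝕏 R c κ (s.1, s.2.1) s.2.2 k) h3), h4⟩

/-- The integral is the sum of the integrals of the pieces; these are uniformly computable, and the
`k`-th is at most `2 * 2^{-k}`, so the series converges at a known rate. -/
theorem isUniformSchnorrIntegralTest_cutoffPiece (hR : Computable R) (hc : Computable c)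
    (hc01 : ∀ σ x, 0 ≤ basicFun 𝕏 (c σ) x ∧ basicFun 𝕏 (c σ) x ≤ 1)
    (hκ : CompReal (NamesOn.name (P := baireData.prod 𝕏.measureData) (D := Set.univ))
      fun ω (_ : Unit) => κ ω.pt) (hκ0 : ∀ p, 0 ≤ κ p)
    (hex : ∀ p, κ p = 0 → ∀ k, ∃ T, FirstHit R p.1 k T) :
    IsUniformSchnorrIntegralTest 𝕏 baireData fun h μ x =>
      ∑' k, ENNReal.ofReal (cutoffPiece 𝕏 R c κ (h, μ) x k) := by
  have hM := 𝕏.measureData_effective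
  let oB := NamesOn.name (P := baireData.prod 𝕏.measureData) (D := Set.univ)
  have hp := compReal_cutoffPiece 𝕏 hR hc hκ hκ0 hex
  obtain ⟨hmeas, hint⟩ := CompReal.lintegral 𝕏 (o := oB) (μ := fun ω => ω.pt.2)
    (f := fun ω x k => cutoffPiece 𝕏 R c κ ω.pt x k)
    ((compReal_integral_basicFun 𝕏 Set.univ).pullback (Reduces.namesSnd (P := baireData) hM
      (D := Set.univ) (D' := Set.univ) fun _ _ => trivial)) hp
    (fun _ _ _ => cutoffPiece_nonneg 𝕏 _ _ _) (fun _ _ _ => cutoffPiece_le_one 𝕏 hc01 _ _ _)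
  have hmeas' : ∀ (p : (ℕ → ℕ) × FiniteMeasure X) k,
      Measurable fun x => ENNReal.ofReal (cutoffPiece 𝕏 R c κ p x k) := fun p k => by
    -- Measurability was obtained for named pairs; every pair has a name.
    obtain ⟨g, hg⟩ := (baireData_effective.prod hM).exists_isCauchyName p
    exact hmeas ⟨g, p, trivial, hg⟩ k
  have hsum : ∀ p : (ℕ → ℕ) × FiniteMeasure X,
      ∫⁻ x, ∑' k, ENNReal.ofReal (cutoffPiece 𝕏 R c κ p x k) ∂(p.2 : Measure X) =
        ∑' k, ∫⁻ x, ENNReal.ofReal (cutoffPiece 𝕏 R c κ p x k) ∂(p.2 : Measure X) := fun p =>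
    lintegral_tsum fun k => (hmeas' p k).aemeasurable
  have hs : Summable fun k : ℕ => 2 * (2 : ℝ)⁻¹ ^ k :=
    (summable_geometric_of_lt_one (by norm_num) (by norm_num)).mul_left 2
  have hfin : ∀ p : (ℕ → ℕ) × FiniteMeasure X,
      ∑' k, ∫⁻ x, ENNReal.ofReal (cutoffPiece 𝕏 R c κ p x k) ∂(p.2 : Measure X) ≠ ∞ := fun p => by
    refine ne_top_of_le_ne_top ?_ (ENNReal.tsum_le_tsum fun k => lintegral_cutoffPiece_le 𝕏 hc01 p k)
    rw [← ENNReal.ofReal_tsum_of_nonneg (fun k => by positivity) hs]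
    exact ENNReal.ofReal_ne_top
  refine ⟨?_, fun h μ => ?_, CompReal.computableMapOn ?_⟩
  · exact lowerSemicomputable_cutoffPiece 𝕏 hR hc hκ hκ0 hex
  · exact (hsum (h, μ)).trans_lt (hfin (h, μ)).lt_top
  · refine CompReal.hasSum (g := fun ω (p : Unit × ℕ) =>
      (∫⁻ x, ENNReal.ofReal (cutoffPiece 𝕏 R c κ ω.pt x p.2) ∂(ω.pt.2 : Measure X)).toReal)
      (hint.comp (c := fun p : Unit × ℕ => p.2) (by fun_prop)) 2 (fun ω _ k => ?_) fun ω _ => ?_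
    · rw [abs_of_nonneg ENNReal.toReal_nonneg]
      push_cast
      exact ENNReal.toReal_le_of_le_ofReal (by positivity) (lintegral_cutoffPiece_le 𝕏 hc01 _ k)
    · dsimp only
      rw [hsum ω.pt, ENNReal.tsum_toReal_eq fun k => ENNReal.ne_top_of_tsum_ne_top (hfin ω.pt) k]
      exact ENNReal.hasSum_toReal (hfin ω.pt)

/-- On `nameSet 𝕏` the cut-off pieces are the uncut increments, whose sum is infinite on the
intersection of the test. -/
theorem IsUniformSchnorrSequentialTest.exists_integralTest
    {U : ℕ → (ℕ → ℕ) → FiniteMeasure X → Set X}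
    (hU : IsUniformSchnorrSequentialTest 𝕏 baireData (nameSet 𝕏) U) :
    ∃ t, IsUniformSchnorrIntegralTest 𝕏 baireData t ∧
      ∀ h μ, (h, μ) ∈ nameSet 𝕏 → ∀ x ∈ ⋂ n, U n h μ, t h μ x = ∞ := by
  obtain ⟨R, c, hR, hc, hc01, hex, hint, htop⟩ := hU.exists_basicFun
  obtain ⟨κ, hκ, hκ0, hκK⟩ := (isEffectivelyClosed_nameSet 𝕏).exists_compReal
    (baireData_effective.prod 𝕏.measureData_effective)
  refine ⟨_, isUniformSchnorrIntegralTest_cutoffPiece 𝕏 hR hc hc01 (hκ Set.univ) hκ0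
    fun p hp => hex ⟨p, (hκK p).1 hp⟩, fun h μ hK x hx => ?_⟩
  choose T hT using hex ⟨(h, μ), hK⟩
  rw [← htop ⟨(h, μ), hK⟩ x hx T hT]
  refine tsum_congr fun k => ?_
  have h1 := hint ⟨(h, μ), hK⟩ k (T k) (hT k)
  have h2 := hc01 (initSeg h (T k)) x
  rw [cutoffPiece_of_firstHit 𝕏 (p := (h, μ)) (hT k), (hκK (h, μ)).2 hK, mul_zero, sub_zero]
  rw [inv_pow, ← one_div, le_div_iff₀ (by positivity)] at h1
  -- Both caps are at least `1` here: the integral is at most `2^{-k}`, and `κ` vanishes. The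
  -- increment itself is at most `1`.
  have h3 : basicFun 𝕏 (c (initSeg h (T k))) x ≤ min (2 - 2 ^ k *
      ∫ y, basicFun 𝕏 (c (initSeg h (T k))) y ∂(μ : Measure X)) 1 :=
    le_min (h2.2.trans (by dsimp only at h1; linarith)) h2.2
  rw [min_eq_left h3, max_eq_right h2.1]

end SequentialToIntegral

end SchnorrRandomness

theorem mainTheorem8 {X : Type*} [MetricSpace X] [CompleteSpace X]
    [MeasurableSpace X] [BorelSpace X] (𝕏 : SchnorrRandomness.ComputableMetricSpace X) :
    SchnorrRandomness.IsEffectivelyClosed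
        (SchnorrRandomness.baireData.prod 𝕏.measureData) (SchnorrRandomness.nameSet 𝕏) ∧
      ∀ (h₀ : ℕ → ℕ) (μ₀ : MeasureTheory.FiniteMeasure X),
        (h₀, μ₀) ∈ SchnorrRandomness.nameSet 𝕏 → ∀ x₀ : X,
          (x₀ ∈ SchnorrRandomness.SR 𝕏 SchnorrRandomness.baireData h₀ μ₀ ↔
            ∀ U : ℕ → (ℕ → ℕ) → MeasureTheory.FiniteMeasure X → Set X,
              SchnorrRandomness.IsUniformSchnorrSequentialTest 𝕏 SchnorrRandomness.baireData
                (SchnorrRandomness.nameSet 𝕏) U →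
              x₀ ∉ ⋂ n, U n h₀ μ₀) := by
  refine ⟨SchnorrRandomness.isEffectivelyClosed_nameSet 𝕏, fun h₀ μ₀ hK x₀ =>
    ⟨fun hx U hU hmem => ?_, fun H t ht => ?_⟩⟩
  · obtain ⟨t, ht, htop⟩ := hU.exists_integralTest
    exact (hx t ht).ne (htop h₀ μ₀ hK x₀ hmem)
  · obtain ⟨U, hU, hmem⟩ := ht.exists_sequentialTest
    by_contra htop
    exact H U hU (Set.mem_iInter.2 (hmem h₀ μ₀ x₀ hK (not_lt_top_iff.1 htop)))
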